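/- Let $S$ be a closed oriented smooth surface with a Riemannian metric, $X$ a continuous vector field on $S$, and $\phi:\mathbb{R}\times S\to S$ a continuous flow generated by $X$, that is, $\frac{d}{dt}\phi^t(x)=X(\phi^t(x))$ for all $x$ and $t$. Let $\Gamma\subset S$ be a compact $\phi$-invariant set which contains no fixed point (zero of $X$), no periodic orbit and no isolated orbit; here an orbit $L\subset\Gamma$ is isolated if it is relatively open in $\Gamma$, i.e. no point of $L$ is accumulated by points of $\Gamma\setminus L$. Then for every $\epsilon>0$ there is a compact set $K\supseteq\Gamma$ such that $d_H(\Gamma,K)<\epsilon$ in Hausdorff distance, $S_0=S\setminus\operatorname{int}(K)$ is a surface with piecewise $C^1$ boundary (the boundary being the frontier of $S_0$ in $S$), every boundary component of $S_0$ is a dumbbell, and all inflow and outflow edges of these dumbbells have length less than $\epsilon$. Here a boundary component $C$ of $S_0$ is a *dumbbell* if $C$ contains no fixed point (no zero of $X$) and, for some $n\ge1$, $C$ is a simple closed curve formed by $4n$ consecutive regular $C^1$ segments $\sigma_1,\dots,\sigma_{4n}$ such that - $\sigma_i$ is tangent to the flow (an arc of an orbit of $\phi$) for $i$ odd; - $\sigma_{2+4k}$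 is an outflow edge for $0\le k<n$: it is transverse to $X$, and there is a neighbourhood $U$ of $\sigma=\sigma_{2+4k}$ in $S_0$ such that for every $x\in U$ there is $t\ge0$ with $\phi^s(x)\in U$ for all $s\in[0,t]$ and $\phi^t(x)\in\sigma$; - $\sigma_{4k}$ is an inflow edge for $0<k\le n$: it is transverse to $X$, and there is a neighbourhood $U$ of $\sigma=\sigma_{4k}$ in $S_0$ such that for every $x\in U$ there is $t\le0$ with $\phi^s(x)\in U$ for all $s\in[t,0]$ and $\phi^t(x)\in\sigma$. -/

import Mathlib

open Set Topology Manifold Bundle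
open scoped ContDiff ENNReal

noncomputable section

namespace Dumbbell

/-- The Euclidean plane, on which surfaces are modelled. -/
abbrev Plane : Type := EuclideanSpace ℝ (Fin 2)

/-- A smooth surface is orientable if it has an atlas of smooth charts all of whose transition
maps have positive Jacobian determinant. -/
def IsOrientable (S : Type*) [TopologicalSpace S] [ChartedSpace Plane S] : Prop :=
  ∃ A : Set (OpenPartialHomeomorph S Plane),
    A ⊆ IsManifold.maximalAtlas (𝓡 2) ∞ S ∧
    (∀ x : S, ∃ e ∈ A, x ∈ e.source) ∧
    ∀ e ∈ A, ∀ e' ∈ A, ∀ x ∈ (e.symm.trans e').source,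
      0 < (fderiv ℝ (e.symm.trans e') x).det

section TopologicalNotions

variable {S : Type*} [TopologicalSpace S]

/-- The orbit of `x` is isolated in `Γ`: near `x`, the set `Γ` contains no point of any other
orbit. (As each `φ t` is a homeomorphism, for an invariant set `Γ` this does not depend on the
choice of `x` in the orbit; it says that the orbit is relatively open in `Γ`.) -/
def IsIsolatedOrbit (φ : Flow ℝ S) (Γ : Set S) (x : S) : Prop :=
  ∃ U ∈ 𝓝 x, U ∩ Γ ⊆ φ.orbit x

/-- `S₀` is a closed subset of the surface `S` which is itself a topological surface with boundary,
with manifold boundary equal to `frontier S₀`: at every frontier point the pair `(S, S₀)` is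
locally homeomorphic to the plane with a closed half-plane. -/
def IsSurfaceWithBoundary (S₀ : Set S) : Prop :=
  IsClosed S₀ ∧ ∀ p ∈ frontier S₀, ∃ e : OpenPartialHomeomorph S (ℝ × ℝ),
    p ∈ e.source ∧ ∀ q ∈ e.source, q ∈ S₀ ↔ 0 ≤ (e q).2

/-- `U` is a neighbourhood of `σ` in the subspace `S₀`. -/
def IsNhdIn (S₀ σ U : Set S) : Prop :=
  U ⊆ S₀ ∧ ∃ O : Set S, IsOpen O ∧ σ ⊆ O ∧ O ∩ S₀ ⊆ U

end TopologicalNotions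

variable {S : Type*} [TopologicalSpace S] [ChartedSpace Plane S]

/-- The velocity at time `t` of the curve `γ` restricted to `[a, b]` (one-sided at `a` and `b`). -/
def velocity (γ : ℝ → S) (a b t : ℝ) : TangentSpace (𝓡 2) (γ t) :=
  mfderivWithin 𝓘(ℝ, ℝ) (𝓡 2) γ (Icc a b) t 1

/-- `γ` restricted to `[a, b]` is a regular `C¹` curve, up to and including the endpoints. -/
def IsC1Segment (γ : ℝ → S) (a b : ℝ) : Prop :=
  ContMDiffOn 𝓘(ℝ, ℝ) (𝓡 2) 1 γ (Icc a b) ∧ ∀ t ∈ Icc a b, velocity γ a b t ≠ 0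

/-- The segment `γ|[a, b]` is tangent to the flow: it runs inside one orbit, with velocity
everywhere proportional to the generating vector field. -/
def IsTangentSegment (φ : Flow ℝ S) (X : (x : S) → TangentSpace (𝓡 2) x)
    (γ : ℝ → S) (a b : ℝ) : Prop :=
  (∃ x, γ '' Icc a b ⊆ φ.orbit x) ∧
    ∀ t ∈ Icc a b, ∃ c : ℝ, velocity γ a b t = c • X (γ t)

/-- The segment `γ|[a, b]` is transverse to the flow. -/
def IsTransverseSegment (X : (x : S) → TangentSpace (𝓡 2) x) (γ : ℝ → S) (a b : ℝ) : Prop :=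
  ∀ t ∈ Icc a b, LinearIndependent ℝ ![velocity γ a b t, X (γ t)]

/-- The transverse segment `γ|[a, b]` is an outflow edge of `S₀`. -/
def IsOutflowEdge (φ : Flow ℝ S) (X : (x : S) → TangentSpace (𝓡 2) x) (S₀ : Set S)
    (γ : ℝ → S) (a b : ℝ) : Prop :=
  IsTransverseSegment X γ a b ∧ ∃ U, IsNhdIn S₀ (γ '' Icc a b) U ∧
    ∀ x ∈ U, ∃ t : ℝ, 0 ≤ t ∧ (∀ s ∈ Icc 0 t, φ s x ∈ U) ∧ φ t x ∈ γ '' Icc a b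

/-- The transverse segment `γ|[a, b]` is an inflow edge of `S₀`. -/
def IsInflowEdge (φ : Flow ℝ S) (X : (x : S) → TangentSpace (𝓡 2) x) (S₀ : Set S)
    (γ : ℝ → S) (a b : ℝ) : Prop :=
  IsTransverseSegment X γ a b ∧ ∃ U, IsNhdIn S₀ (γ '' Icc a b) U ∧
    ∀ x ∈ U, ∃ t : ℝ, t ≤ 0 ∧ (∀ s ∈ Icc t 0, φ s x ∈ U) ∧ φ t x ∈ γ '' Icc a b

/-- `γ` traverses the simple closed curve `C`, with period `4 * n`, and exhibits it as a dumbbell of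
`S₀` with `4 * n` segments. The segments are `σ₁, …, σ₄ₙ` with `σ_{i+1} = γ|[i, i+1]`, so the
tangent segments (the lobes) are those with `i` even, the outflow edges those with `i = 4k + 1`, and
the inflow edges those with `i = 4k + 3`. -/
structure IsDumbbellCurve (φ : Flow ℝ S) (X : (x : S) → TangentSpace (𝓡 2) x) (S₀ C : Set S)
    (n : ℕ) (γ : ℝ → S) : Prop where
  pos : 0 < n
  continuous : Continuous γ
  periodic : Function.Periodic γ (4 * n)
  injOn : InjOn γ (Ico 0 (4 * n))
  range_eq : range γ = C
  no_fixed : ∀ p ∈ C, X p ≠ 0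
  isC1 : ∀ i : ℕ, i < 4 * n → IsC1Segment γ i (i + 1)
  lobe : ∀ i : ℕ, i < 4 * n → Even i → IsTangentSegment φ X γ i (i + 1)
  outflow : ∀ k : ℕ, k < n → IsOutflowEdge φ X S₀ γ (4 * k + 1) (4 * k + 2)
  inflow : ∀ k : ℕ, k < n → IsInflowEdge φ X S₀ γ (4 * k + 3) (4 * k + 4)

end Dumbbell

end

set_option linter.unusedSectionVars false

/-! The set `K` is `Γ` with its narrow slits filled by flow strips. Choose finitely many disjoint
arcs transverse to the flow, with ends off `frontier Γ`, such that every orbit in `frontier Γ`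
crosses one of them within bounded time (`exists_isCrossSection`). Since `X` is only continuous,
flow boxes are built by hand: in a chart whose first coordinate increases along orbits, orbits cross
vertical segments once, and the intermediate value theorem gives openness.

A gap is a component of an arc minus `Γ` with both ends in `Γ`. It is thin if it is shorter than `δ`
and the first return map carries it onto another gap shorter than `δ`. The `filling` adds to `Γ` the
orbit segments from thin gaps to their returns. It is compact, and as `δ` tends to `0` it is
Hausdorff close to `Γ`, by uniform continuity of the flow.

The boundary is read off locally. As no orbit of `Γ` is isolated, at a point of `Γ` that bounds a
gap `Γ` accumulates from the other side, and there all gaps close enough to the point are thin,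
forwards and backwards. So the gap side alone decides (`frontier_cases_on`). If it is thin both ways
the point is interior; if only forwards, it is a corner of an edge through which orbits leave `S₀`;
if only backwards, a corner of an edge through which they enter; if neither, the boundary runs along
the orbit. In the complement the local models are half-planes and quadrants, so `S₀` is a surface
with boundary.

Points where the boundary meets both `Γ` and the section are isolated, hence finite in number. An
orbit starting at an entry corner cannot stay in the boundary for ever: it would meet this finite
set at infinitely many times, and there are no periodic orbits. So it ends at an exit corner
(`exists_lobe`), and lobes match entry corners with exit corners bijectively. Passing to the
opposite end of an entry edge, or along a lobe, across the exit edge and back along another lobe,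
gives two fixed point free involutions `a`, `b` of the entry corners. Each cycle of `a ∘ b` closes
up into a simple closed curve with `4 * n` pieces, and these curves are the boundary components
(`exists_circuit`). Edges are short by absolute continuity of the length integral. -/

namespace Dumbbell

/-! ### Cross-sections of a flow along the frontier of an invariant set -/

section CrossSection

variable {S : Type*} [TopologicalSpace S] {ι : Type*}

/-- The union of the closed arcs `σ i '' [-1, 1]`. -/
def crossSet (σ : ι → ℝ → S) : Set S := ⋃ i, σ i '' Icc (-1) 1

/-- The arcs `σ i '' [-1, 1]` are disjoint, topologically transverse to the flow, and met by every
orbit in the frontier of the closed invariant set `Γ`, no orbit of which is isolated. -/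
structure IsCrossSection (φ : Flow ℝ S) (Γ : Set S) (σ : ι → ℝ → S) (c : ℝ) : Prop where
  isClosed : IsClosed Γ
  invariant : IsInvariant φ Γ
  not_isolated : ∀ x ∈ Γ, ¬ IsIsolatedOrbit φ Γ x
  pos : 0 < c
  box : ∀ i, ∃ e : OpenPartialHomeomorph (ℝ × ℝ) S,
    e.source = Ioo (-c) c ×ˢ Ioo (-2) 2 ∧ ∀ z ∈ e.source, e z = φ z.1 (σ i z.2)
  disjoint : ∀ i j, ∀ s ∈ Icc (-1 : ℝ) 1, ∀ u ∈ Icc (-1 : ℝ) 1, σ i s = σ j u → i = j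
  left_notMem : ∀ i, σ i (-1) ∉ frontier Γ
  right_notMem : ∀ i, σ i 1 ∉ frontier Γ
  hits : ∀ x ∈ frontier Γ, ∃ t : ℝ, |t| < 1 / 2 ∧ ∃ i, ∃ s ∈ Ioo (-1 : ℝ) 1, φ t x = σ i s

/-- `y` is the first point of the section on the forward orbit of the point `x` of the section,
reached at time `t < 2`. -/
def IsNext (φ : Flow ℝ S) (σ : ι → ℝ → S) (x y : S) (t : ℝ) : Prop :=
  0 < t ∧ t < 2 ∧ φ t x = y ∧ x ∈ crossSet σ ∧ y ∈ crossSet σ ∧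
    ∀ r ∈ Ioo 0 t, φ r x ∉ crossSet σ

/-- The arc `u ↦ σ i (s + η * u)`, `0 ≤ u ≤ w`, `η = ± 1`, meets `Γ` exactly in its endpoints. -/
structure IsGap (Γ : Set S) (σ : ι → ℝ → S) (i : ι) (s η w : ℝ) : Prop where
  sign : η = 1 ∨ η = -1
  pos : 0 < w
  start_mem : s ∈ Ioo (-1 : ℝ) 1
  last_mem : s + η * w ∈ Ioo (-1 : ℝ) 1
  start_inv : σ i s ∈ Γ
  last_inv : σ i (s + η * w) ∈ Γ
  notMem : ∀ u ∈ Ioo 0 w, σ i (s + η * u) ∉ Γ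

/-- The closed arc of a gap. -/
def gapArc (σ : ι → ℝ → S) (i : ι) (s η w : ℝ) : Set S := (fun u => σ i (s + η * u)) '' Icc 0 w

/-- The first return map carries `G` onto `G'`. -/
def IsSuccArc (φ : Flow ℝ S) (σ : ι → ℝ → S) (G G' : Set S) : Prop :=
  (∀ x ∈ G, ∃ y ∈ G', ∃ t, IsNext φ σ x y t) ∧ ∀ y ∈ G', ∃ x ∈ G, ∃ t, IsNext φ σ x y t

/-- A gap of width less than `δ` carried by the first return map onto another such gap. -/
structure IsThinGap (φ : Flow ℝ S) (Γ : Set S) (σ : ι → ℝ → S) (δ : ℝ) (i : ι) (s η w : ℝ) :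
    Prop where
  gap : IsGap Γ σ i s η w
  lt : w < δ
  succ : ∃ k u ξ v, IsGap Γ σ k u ξ v ∧ v < δ ∧
    IsSuccArc φ σ (gapArc σ i s η w) (gapArc σ k u ξ v)

/-- The union of the closed thin gaps. -/
def thinSet (φ : Flow ℝ S) (Γ : Set S) (σ : ι → ℝ → S) (δ : ℝ) : Set S :=
  {x | ∃ i s η w, IsThinGap φ Γ σ δ i s η w ∧ x ∈ gapArc σ i s η w}

/-- The set `Γ` together with the orbit segments from the thin gaps to their first return. -/
def filling (φ : Flow ℝ S) (Γ : Set S) (σ : ι → ℝ → S) (δ : ℝ) : Set S :=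
  Γ ∪ {z | ∃ x ∈ thinSet φ Γ σ δ, ∃ y t r, IsNext φ σ x y t ∧ 0 ≤ r ∧ r ≤ t ∧ φ r x = z}

variable {φ : Flow ℝ S} {Γ : Set S} {σ : ι → ℝ → S} {c δ : ℝ}

lemma flow_neg_apply (φ : Flow ℝ S) (t : ℝ) (x : S) : φ (-t) (φ t x) = x := by
  rw [← φ.map_add]; simp

lemma flow_apply_neg (φ : Flow ℝ S) (t : ℝ) (x : S) : φ t (φ (-t) x) = x := by
  rw [← φ.map_add]; simp

lemma flow_eq_iff {φ : Flow ℝ S} {t : ℝ} {x y : S} : φ t x = y ↔ x = φ (-t) y := by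
  constructor
  · rintro rfl; exact (flow_neg_apply φ t x).symm
  · rintro rfl; exact flow_apply_neg φ t y

lemma invariant_iff (h : IsInvariant φ Γ) (t : ℝ) (x : S) : φ t x ∈ Γ ↔ x ∈ Γ :=
  ⟨fun hx => by simpa [flow_neg_apply] using h (-t) hx, fun hx => h t hx⟩

lemma invariant_frontier (h : IsInvariant φ Γ) : IsInvariant φ (frontier Γ) := by
  rw [φ.isInvariant_iff_image_eq] at h ⊢
  intro t
  have := (φ.toHomeomorph t).image_frontier Γ
  rw [show (φ.toHomeomorph t) '' Γ = Γ from h t] at this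
  exact this

lemma continuous_flow (φ : Flow ℝ S) : Continuous fun z : ℝ × S => φ z.1 z.2 :=
  φ.continuous continuous_fst continuous_snd

/-! #### First returns -/

lemma IsNext.right_unique {x y y' : S} {t t' : ℝ} (h : IsNext φ σ x y t)
    (h' : IsNext φ σ x y' t') : t = t' ∧ y = y' := by
  obtain ⟨h0, _, h1, _, h2, h3⟩ := h
  obtain ⟨h0', _, h1', _, h2', h3'⟩ := h'
  have : t = t' := by
    rcases lt_trichotomy t t' with hlt | heq | hlt
    · exact absurd (h1 ▸ h2) (h3' t ⟨h0, hlt⟩)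
    · exact heq
    · exact absurd (h1' ▸ h2') (h3 t' ⟨h0', hlt⟩)
  subst this
  exact ⟨rfl, h1.symm.trans h1'⟩

/-- Time reversal exchanges the two ends of a return. Through this symmetry every fact about exits
from `S₀` is reused for entries. -/
lemma isNext_reverse {x y : S} {t : ℝ} : IsNext φ.reverse σ y x t ↔ IsNext φ σ x y t := by
  have key : ∀ (φ : Flow ℝ S) (x y : S), IsNext φ σ x y t → IsNext φ.reverse σ y x t := by
    rintro φ x y ⟨h0, h1, h2, h3, h4, h5⟩
    refine ⟨h0, h1, ?_, h4, h3, fun r hr => ?_⟩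
    · rw [Flow.reverse_apply, ← h2, flow_neg_apply]
    · rw [Flow.reverse_apply, ← h2, ← φ.map_add]
      exact h5 _ ⟨by linarith [hr.2], by linarith [hr.1]⟩
  refine ⟨fun h => ?_, key φ x y⟩
  have := key _ _ _ h
  rwa [show φ.reverse.reverse = φ from Flow.ext fun t x => by simp [Flow.reverse_apply]] at this

lemma reverse_reverse (φ : Flow ℝ S) : φ.reverse.reverse = φ :=
  Flow.ext fun t x => by simp [Flow.reverse_apply]

lemma IsNext.left_unique {x x' y : S} {t t' : ℝ} (h : IsNext φ σ x y t)
    (h' : IsNext φ σ x' y t') : t = t' ∧ x = x' :=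
  (isNext_reverse.2 h).right_unique (isNext_reverse.2 h')

lemma isSuccArc_reverse {G G' : Set S} : IsSuccArc φ.reverse σ G' G ↔ IsSuccArc φ σ G G' := by
  simp only [IsSuccArc, isNext_reverse]
  exact and_comm

/-- The width bound is imposed on the gap and on its image alike, so thinness survives time
reversal: the image is thin for `φ.reverse`. -/
lemma IsThinGap.exists_reverse {i : ι} {s η w : ℝ} (h : IsThinGap φ Γ σ δ i s η w) :
    ∃ k u η' w', IsThinGap φ.reverse Γ σ δ k u η' w' ∧
      IsSuccArc φ σ (gapArc σ i s η w) (gapArc σ k u η' w') := by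
  obtain ⟨hg, hlt, k, u, η', w', hg', hlt', hs⟩ := h
  exact ⟨k, u, η', w', ⟨hg', hlt', i, s, η, w, hg, hlt, isSuccArc_reverse.2 hs⟩, hs⟩

lemma IsNext.mem_thinSet_reverse {x y : S} {t : ℝ} (h : IsNext φ σ x y t)
    (hx : x ∈ thinSet φ Γ σ δ) : y ∈ thinSet φ.reverse Γ σ δ := by
  obtain ⟨i, s, η, w, hg, hx⟩ := hx
  obtain ⟨k, u, η', w', hg', hs⟩ := hg.exists_reverse
  obtain ⟨y', hy', t', h'⟩ := hs.1 x hx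
  rw [(h.right_unique h').2]
  exact ⟨k, u, η', w', hg', hy'⟩

lemma exists_isNext_of_mem_thinSet {x : S} (hx : x ∈ thinSet φ Γ σ δ) :
    ∃ y ∈ thinSet φ.reverse Γ σ δ, ∃ t, IsNext φ σ x y t := by
  obtain ⟨i, s, η, w, hg, hx'⟩ := id hx
  obtain ⟨k, u, η', w', hg', hs⟩ := hg.exists_reverse
  obtain ⟨y, hy, t, h⟩ := hs.1 x hx'
  exact ⟨y, h.mem_thinSet_reverse hx, t, h⟩

/-- A strip from a thin gap to its return, run backwards, is a strip of the reversed flow. -/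
lemma filling_reverse : filling φ.reverse Γ σ δ = filling φ Γ σ δ := by
  have key : ∀ φ : Flow ℝ S, filling φ.reverse Γ σ δ ⊆ filling φ Γ σ δ := by
    rintro φ z (hz | ⟨x, hx, y, t, r, h, hr0, hrt, rfl⟩)
    · exact Or.inl hz
    · have hy := h.mem_thinSet_reverse hx
      rw [reverse_reverse] at hy
      rw [isNext_reverse] at h
      refine Or.inr ⟨y, hy, x, t, t - r, h, by linarith, by linarith, ?_⟩
      rw [Flow.reverse_apply, ← h.2.2.1, ← φ.map_add]
      congr 1; ring
  refine (key φ).antisymm ?_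
  simpa [reverse_reverse] using key φ.reverse

/-! #### Gaps -/

/-- A gap is recorded from one of its ends, with `η` pointing into it. Flipping makes the two ends
interchangeable, so that corners need only be studied at the start. -/
lemma IsGap.flip {i : ι} {s η w : ℝ} (h : IsGap Γ σ i s η w) :
    IsGap Γ σ i (s + η * w) (-η) w := by
  have e : s + η * w + -η * w = s := by ring
  refine ⟨?_, h.pos, h.last_mem, by rw [e]; exact h.start_mem, h.last_inv,
    by rw [e]; exact h.start_inv, fun u hu => ?_⟩
  · rcases h.sign with h | h <;> simp [h]
  · have := h.notMem (w - u) ⟨by linarith [hu.2], by linarith [hu.1]⟩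
    rwa [show s + η * w + -η * u = s + η * (w - u) by ring]

lemma gapArc_flip (i : ι) (s η w : ℝ) : gapArc σ i (s + η * w) (-η) w = gapArc σ i s η w := by
  ext x
  constructor
  · rintro ⟨u, hu, rfl⟩
    exact ⟨w - u, ⟨by linarith [hu.2], by linarith [hu.1]⟩, by dsimp; congr 1; ring⟩
  · rintro ⟨u, hu, rfl⟩
    exact ⟨w - u, ⟨by linarith [hu.2], by linarith [hu.1]⟩, by dsimp; congr 1; ring⟩

lemma IsThinGap.flip {i : ι} {s η w : ℝ} (h : IsThinGap φ Γ σ δ i s η w) :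
    IsThinGap φ Γ σ δ i (s + η * w) (-η) w :=
  ⟨h.gap.flip, h.lt, by rw [gapArc_flip]; exact h.succ⟩

lemma IsGap.param_mem {i : ι} {s η w u : ℝ} (h : IsGap Γ σ i s η w) (hu : u ∈ Icc 0 w) :
    s + η * u ∈ Ioo (-1 : ℝ) 1 := by
  have h1 := h.start_mem
  have h2 := h.last_mem
  rcases h.sign with rfl | rfl
  · exact ⟨by linarith [h1.1, hu.1], by linarith [h2.2, hu.2]⟩
  · exact ⟨by linarith [h2.1, hu.2], by linarith [h1.2, hu.1]⟩

lemma mem_crossSet (i : ι) {s : ℝ} (hs : s ∈ Icc (-1 : ℝ) 1) : σ i s ∈ crossSet σ :=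
  mem_iUnion.2 ⟨i, s, hs, rfl⟩

/-- An interval of parameters off `Γ` that meets a gap lies in it. -/
lemma IsGap.mem_Ioo_of_segment {i : ι} {s η w u v : ℝ} (h : IsGap Γ σ i s η w) (hu : u ∈ Ioo 0 w)
    (hv : ∀ r ∈ uIcc (s + η * u) v, σ i r ∉ Γ) : η * (v - s) ∈ Ioo 0 w := by
  have h1 := h.start_inv
  have h2 := h.last_inv
  by_contra hcon
  rw [mem_Ioo, not_and_or, not_lt, not_lt] at hcon
  have hu1 := hu.1
  have hu2 := hu.2
  rcases h.sign with rfl | rfl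
  · rcases hcon with hcon | hcon
    · exact hv s (mem_uIcc.2 (Or.inr ⟨by linarith, by linarith⟩)) h1
    · exact hv _ (mem_uIcc.2 (Or.inl ⟨by linarith, by linarith⟩)) h2
  · rcases hcon with hcon | hcon
    · exact hv s (mem_uIcc.2 (Or.inl ⟨by linarith, by linarith⟩)) h1
    · exact hv _ (mem_uIcc.2 (Or.inr ⟨by linarith, by linarith⟩)) h2

end CrossSection

end Dumbbell

namespace Dumbbell

/-! ### First hits of the section and local continuity of the first return map. -/

section Returns

variable {S : Type*} [TopologicalSpace S] [T2Space S] {ι : Type*} [Finite ι]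
  {φ : Flow ℝ S} {Γ : Set S} {σ : ι → ℝ → S} {c δ : ℝ}

lemma orbit_reverse (x : S) : φ.reverse.orbit x = φ.orbit x := by
  ext y
  simp only [Flow.mem_orbit_iff, Flow.reverse_apply]
  exact ⟨fun ⟨t, h⟩ => ⟨-t, h⟩, fun ⟨t, h⟩ => ⟨-t, by rwa [neg_neg]⟩⟩

lemma IsCrossSection.reverse (h : IsCrossSection φ Γ σ c) : IsCrossSection φ.reverse Γ σ c where
  isClosed := h.isClosed
  invariant t x hx := h.invariant (-t) hx
  not_isolated x hx := by
    have := h.not_isolated x hx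
    rwa [IsIsolatedOrbit, orbit_reverse]
  pos := h.pos
  box i := by
    obtain ⟨e, he, hv⟩ := h.box i
    let n : ℝ × ℝ ≃ₜ ℝ × ℝ := (Homeomorph.neg ℝ).prodCongr (Homeomorph.refl ℝ)
    have hs : (n.toOpenPartialHomeomorph.trans e).source = Ioo (-c) c ×ˢ Ioo (-2) 2 := by
      ext ⟨t, s⟩
      simp only [OpenPartialHomeomorph.trans_source, Homeomorph.toOpenPartialHomeomorph_source,
        univ_inter, mem_preimage, he, n, mem_prod, mem_Ioo]
      change (-c < -t ∧ -t < c) ∧ -2 < s ∧ s < 2 ↔ _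
      constructor <;> rintro ⟨⟨h1, h2⟩, h3⟩ <;> exact ⟨⟨by linarith, by linarith⟩, h3⟩
    refine ⟨_, hs, fun z hz => ?_⟩
    rw [OpenPartialHomeomorph.trans_source] at hz
    exact hv _ hz.2
  disjoint := h.disjoint
  left_notMem := h.left_notMem
  right_notMem := h.right_notMem
  hits x hx := by
    obtain ⟨t, ht, i, s, hs, e⟩ := h.hits x hx
    exact ⟨-t, by rwa [abs_neg], i, s, hs, by rwa [Flow.reverse_apply, neg_neg]⟩

lemma IsCrossSection.continuousOn (h : IsCrossSection φ Γ σ c) (i : ι) :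
    ContinuousOn (σ i) (Ioo (-2) 2) := by
  obtain ⟨e, he, hv⟩ := h.box i
  have hm : ∀ s ∈ Ioo (-2 : ℝ) 2, ((0 : ℝ), s) ∈ e.source := fun s hs => by
    rw [he]; exact ⟨⟨by linarith [h.pos], h.pos⟩, hs⟩
  have : ContinuousOn (fun s : ℝ => e (0, s)) (Ioo (-2) 2) :=
    e.continuousOn.comp (by fun_prop) hm
  refine this.congr fun s hs => ?_
  simp only [hv _ (hm s hs), φ.map_zero_apply]

lemma IsCrossSection.continuousAt (h : IsCrossSection φ Γ σ c) (i : ι) {s : ℝ}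
    (hs : s ∈ Icc (-1 : ℝ) 1) : ContinuousAt (σ i) s :=
  (h.continuousOn i).continuousAt (Ioo_mem_nhds (by linarith [hs.1]) (by linarith [hs.2]))

/-- Injectivity of the flow box, which extends beyond the arc to parameters in `(-2, 2)`, rules out
quick returns to the same arc. -/
lemma IsCrossSection.eq_zero_of_flow_eq (h : IsCrossSection φ Γ σ c) (i : ι) {s u t : ℝ}
    (hs : s ∈ Ioo (-2 : ℝ) 2) (hu : u ∈ Ioo (-2 : ℝ) 2) (ht : |t| < c)
    (e : φ t (σ i s) = σ i u) : t = 0 ∧ s = u := by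
  obtain ⟨b, hb, hv⟩ := h.box i
  have h1 : ((t, s) : ℝ × ℝ) ∈ b.source := by rw [hb]; exact ⟨abs_lt.1 ht, hs⟩
  have h2 : ((0, u) : ℝ × ℝ) ∈ b.source := by
    rw [hb]; exact ⟨⟨by linarith [h.pos], h.pos⟩, hu⟩
  have := b.injOn h1 h2 (by rw [hv _ h1, hv _ h2]; simpa using e)
  exact ⟨congrArg Prod.fst this, congrArg Prod.snd this⟩

lemma Icc_subset_Ioo_two : Icc (-1 : ℝ) 1 ⊆ Ioo (-2) 2 := fun s hs =>
  ⟨by linarith [hs.1], by linarith [hs.2]⟩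

lemma IsCrossSection.inj (h : IsCrossSection φ Γ σ c) {i j : ι} {s u : ℝ}
    (hs : s ∈ Icc (-1 : ℝ) 1) (hu : u ∈ Icc (-1 : ℝ) 1) (e : σ i s = σ j u) : i = j ∧ s = u := by
  obtain rfl := h.disjoint i j s hs u hu e
  exact ⟨rfl, (h.eq_zero_of_flow_eq i (t := 0) (Icc_subset_Ioo_two hs) (Icc_subset_Ioo_two hu)
    (by simpa using h.pos) (by simpa using e)).2⟩

lemma IsCrossSection.isCompact_arc (h : IsCrossSection φ Γ σ c) (i : ι) :
    IsCompact (σ i '' Icc (-1) 1) :=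
  isCompact_Icc.image_of_continuousOn ((h.continuousOn i).mono Icc_subset_Ioo_two)

lemma IsCrossSection.isCompact_crossSet (h : IsCrossSection φ Γ σ c) :
    IsCompact (crossSet σ) := isCompact_iUnion h.isCompact_arc

lemma IsCrossSection.isClosed_crossSet (h : IsCrossSection φ Γ σ c) :
    IsClosed (crossSet σ) := h.isCompact_crossSet.isClosed

lemma IsCrossSection.continuousAt_flow (h : IsCrossSection φ Γ σ c) (i : ι) (t : ℝ) {s : ℝ}
    (hs : s ∈ Icc (-1 : ℝ) 1) :
    ContinuousAt (fun z : ℝ × ℝ => φ z.1 (σ i z.2)) (t, s) := by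
  have h1 : ContinuousAt (fun z : ℝ × ℝ => (z.1, σ i z.2)) (t, s) :=
    continuousAt_fst.prodMk (ContinuousAt.comp (f := Prod.snd) (h.continuousAt i hs)
      continuousAt_snd)
  exact ContinuousAt.comp (g := fun z : ℝ × S => φ z.1 z.2) (continuous_flow φ).continuousAt h1

/-- Near a point of the section, orbits do not return to the section in short time. -/
lemma IsCrossSection.eventually_notMem (h : IsCrossSection φ Γ σ c) (i : ι) {s : ℝ}
    (hs : s ∈ Icc (-1 : ℝ) 1) :
    ∀ᶠ z : ℝ × ℝ in 𝓝 (0, s), z.1 ≠ 0 → φ z.1 (σ i z.2) ∉ crossSet σ := by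
  have h1 : ∀ᶠ z : ℝ × ℝ in 𝓝 (0, s), |z.1| < c := by
    have : ContinuousAt (fun z : ℝ × ℝ => |z.1|) (0, s) := by fun_prop
    exact this.eventually_lt continuousAt_const (by simpa using h.pos)
  have h2 : ∀ᶠ z : ℝ × ℝ in 𝓝 (0, s), z.2 ∈ Ioo (-2 : ℝ) 2 :=
    continuousAt_snd.eventually (Ioo_mem_nhds (Icc_subset_Ioo_two hs).1 (Icc_subset_Ioo_two hs).2)
  have h3 : ∀ j, ∀ᶠ z : ℝ × ℝ in 𝓝 (0, s), j ≠ i → φ z.1 (σ i z.2) ∉ σ j '' Icc (-1) 1 := by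
    intro j
    by_cases hj : j = i
    · simp [hj]
    · have : φ 0 (σ i s) ∈ (σ j '' Icc (-1) 1)ᶜ := by
        rintro ⟨u, hu, e⟩
        exact hj (h.inj hu hs (by simpa using e)).1
      filter_upwards [(h.continuousAt_flow i 0 hs).eventually
        ((h.isCompact_arc j).isClosed.isOpen_compl.mem_nhds this)] with z hz _ using hz
  filter_upwards [h1, h2, Filter.eventually_all.2 h3] with z hz1 hz2 hz3 hz0 hmem
  obtain ⟨j, u, hu, e⟩ := mem_iUnion.1 hmem
  by_cases hj : j = i
  · subst hj
    exact hz0 (h.eq_zero_of_flow_eq j hz2 (Icc_subset_Ioo_two hu) hz1 e.symm).1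
  · exact hz3 j hj ⟨u, hu, e⟩

lemma IsCrossSection.exists_param (h : IsCrossSection φ Γ σ c) {x : S} (hx : x ∈ frontier Γ)
    (hT : x ∈ crossSet σ) : ∃ i, ∃ s ∈ Ioo (-1 : ℝ) 1, σ i s = x := by
  obtain ⟨i, s, hs, rfl⟩ := mem_iUnion.1 hT
  refine ⟨i, s, ⟨lt_of_le_of_ne hs.1 ?_, lt_of_le_of_ne hs.2 ?_⟩, rfl⟩
  · rintro rfl; exact h.left_notMem i hx
  · rintro rfl; exact h.right_notMem i hx

/-- An orbit in the frontier of `Γ` that starts at a point off the section or on it next meets the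
section after a positive time. -/
lemma IsCrossSection.exists_first_hit (h : IsCrossSection φ Γ σ c) {x : S}
    (hx : x ∈ frontier Γ) :
    ∃ t, 0 < t ∧ t < 2 ∧ φ t x ∈ crossSet σ ∧ ∀ r ∈ Ioo 0 t, φ r x ∉ crossSet σ := by
  -- Applying `hits` at `φ 1 x` produces a hit at a time in `(1/2, 3/2)`; this is where the bound
  -- `2` on return times comes from.
  obtain ⟨t₁, ht₁, i, s, hs, e⟩ := h.hits _ (invariant_frontier h.invariant 1 hx)
  rw [← φ.map_add] at e
  rw [abs_lt] at ht₁
  -- No hit occurs immediately after time `0`, so the hits in `[κ, t₁ + 1]` form a nonempty compact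
  -- set whose least element is the first positive hit.
  have hκ : ∃ κ > 0, ∀ r ∈ Ioo 0 κ, φ r x ∉ crossSet σ := by
    by_cases hT : x ∈ crossSet σ
    · obtain ⟨j, u, hu, rfl⟩ := h.exists_param hx hT
      have hc : ContinuousAt (fun r : ℝ => (r, u)) 0 := by fun_prop
      obtain ⟨κ, hκ, H⟩ := Metric.eventually_nhds_iff.1
        (hc.eventually (h.eventually_notMem j (Ioo_subset_Icc_self hu)))
      refine ⟨κ, hκ, fun r hr => H ?_ hr.1.ne'⟩
      rw [Real.dist_eq, sub_zero, abs_of_pos hr.1]; exact hr.2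
    · have hc : ContinuousAt (fun r : ℝ => φ r x) 0 :=
        (φ.continuous continuous_id continuous_const).continuousAt
      obtain ⟨κ, hκ, H⟩ := Metric.eventually_nhds_iff.1 (hc.eventually
        (h.isClosed_crossSet.isOpen_compl.mem_nhds (by simpa using hT)))
      refine ⟨κ, hκ, fun r hr => H ?_⟩
      rw [Real.dist_eq, sub_zero, abs_of_pos hr.1]; exact hr.2
  obtain ⟨κ, hκ, hno⟩ := hκ
  have hcl : IsClosed {t : ℝ | φ t x ∈ crossSet σ} :=
    h.isClosed_crossSet.preimage (φ.continuous continuous_id continuous_const)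
  have hT1 : φ (t₁ + 1) x ∈ crossSet σ := by
    rw [e]; exact mem_crossSet i (Ioo_subset_Icc_self hs)
  have hκ1 : κ ≤ t₁ + 1 := by
    by_contra hcon
    exact hno _ ⟨by linarith, not_le.1 hcon⟩ hT1
  obtain ⟨t, ht, hmin⟩ := (isCompact_Icc.inter_right hcl).exists_isLeast
    (⟨t₁ + 1, ⟨hκ1, le_rfl⟩, hT1⟩ : (Icc κ (t₁ + 1) ∩ _).Nonempty)
  refine ⟨t, by linarith [ht.1.1], by linarith [ht.1.2], ht.2, fun r hr hmem => ?_⟩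
  by_cases hrκ : r < κ
  · exact hno r ⟨hr.1, hrκ⟩ hmem
  · exact absurd (hmin ⟨⟨not_lt.1 hrκ, by linarith [ht.1.2, hr.2]⟩, hmem⟩) (not_le.2 hr.2)

lemma IsCrossSection.exists_isNext (h : IsCrossSection φ Γ σ c) {x : S} (hx : x ∈ frontier Γ)
    (hT : x ∈ crossSet σ) : ∃ y t, IsNext φ σ x y t := by
  obtain ⟨t, h0, h2, hy, hno⟩ := h.exists_first_hit hx
  exact ⟨_, t, h0, h2, rfl, hT, hy, hno⟩

/-- The first return map is locally given by a continuous change of parameters. -/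
lemma IsCrossSection.exists_return (h : IsCrossSection φ Γ σ c) {j k : ι} {s₀ u₀ t₀ : ℝ}
    (hs : s₀ ∈ Ioo (-1 : ℝ) 1) (hu : u₀ ∈ Ioo (-1 : ℝ) 1)
    (hn : IsNext φ σ (σ j s₀) (σ k u₀) t₀) :
    ∃ f θ : ℝ → ℝ, ∃ ρ > 0, ContinuousOn f (Ioo (s₀ - ρ) (s₀ + ρ)) ∧
      ContinuousOn θ (Ioo (s₀ - ρ) (s₀ + ρ)) ∧ f s₀ = u₀ ∧ θ s₀ = t₀ ∧
      ∀ s ∈ Ioo (s₀ - ρ) (s₀ + ρ), s ∈ Ioo (-1 : ℝ) 1 ∧ f s ∈ Ioo (-1 : ℝ) 1 ∧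
        IsNext φ σ (σ j s) (σ k (f s)) (θ s) := by
  obtain ⟨e, he, hv⟩ := h.box k
  obtain ⟨ht0, ht2, hty, hxT, hyT, hno⟩ := hn
  have hsI := Ioo_subset_Icc_self hs
  have huI := Ioo_subset_Icc_self hu
  have h0s : ((0, u₀) : ℝ × ℝ) ∈ e.source := by
    rw [he]; exact ⟨⟨by linarith [h.pos], h.pos⟩, Icc_subset_Ioo_two huI⟩
  have hy0 : e (0, u₀) = σ k u₀ := by rw [hv _ h0s]; simp
  have hyt : σ k u₀ ∈ e.target := hy0 ▸ e.map_source h0s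
  have hes : e.symm (σ k u₀) = (0, u₀) := by rw [← hy0, e.left_inv h0s]
  let G : ℝ → S := fun s => φ t₀ (σ j s)
  have hG : ∀ s ∈ Icc (-1 : ℝ) 1, ContinuousAt G s := fun s hs =>
    ContinuousAt.comp (g := fun x => φ t₀ x)
      (φ.continuous continuous_const continuous_id).continuousAt (h.continuousAt j hs)
  have hG0 : G s₀ = σ k u₀ := hty
  -- `F s` is the point `φ t₀ (σ j s)` in the flow box of the target arc: a time offset and an arc
  -- parameter.
  let F : ℝ → ℝ × ℝ := fun s => e.symm (G s)
  have hF0 : F s₀ = (0, u₀) := by simp only [F, hG0, hes]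
  have hFc : ∀ s ∈ Icc (-1 : ℝ) 1, G s ∈ e.target → ContinuousAt F s := fun s hs hs' =>
    ContinuousAt.comp (e.continuousAt_symm hs') (hG s hs)
  have hFc0 := hFc s₀ hsI (hG0 ▸ hyt)
  have hF1 : Filter.Tendsto (fun s => (F s).1) (𝓝 s₀) (𝓝 0) := by
    simpa only [hF0] using hFc0.fst.tendsto
  have hF2 : Filter.Tendsto (fun s => (F s).2) (𝓝 s₀) (𝓝 u₀) := by
    simpa only [hF0] using hFc0.snd.tendsto
  have e1 : ∀ᶠ s in 𝓝 s₀, s ∈ Ioo (-1 : ℝ) 1 := Ioo_mem_nhds hs.1 hs.2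
  have e2 : ∀ᶠ s in 𝓝 s₀, G s ∈ e.target :=
    (hG s₀ hsI).eventually (e.open_target.mem_nhds (hG0 ▸ hyt))
  have e3 : ∀ᶠ s in 𝓝 s₀, (F s).2 ∈ Ioo (-1 : ℝ) 1 := by
    exact hF2.eventually (Ioo_mem_nhds hu.1 hu.2)
  have e4 : ∀ᶠ s in 𝓝 s₀, (F s).1 < t₀ ∧ t₀ - 2 < (F s).1 := by
    filter_upwards [hF1.eventually (Ioo_mem_nhds (a := t₀ - 2) (by linarith) ht0)] with s hs
    exact ⟨hs.2, hs.1⟩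
  -- Intermediate hits are excluded in three ranges of time: near `0` and near the return by the
  -- flow boxes of the two arcs, in between by compactness.
  obtain ⟨κ₁, hκ₁, H₁⟩ := Metric.eventually_nhds_iff.1 (h.eventually_notMem j hsI)
  obtain ⟨κ₂, hκ₂, H₂⟩ := Metric.eventually_nhds_iff.1 (h.eventually_notMem k huI)
  have e5 : ∀ᶠ s in 𝓝 s₀, |s - s₀| < κ₁ := by
    filter_upwards [Metric.ball_mem_nhds s₀ hκ₁] with s hs using hs
  have e6 : ∀ᶠ s in 𝓝 s₀, |(F s).2 - u₀| < κ₂ := by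
    filter_upwards [hF2.eventually (Metric.ball_mem_nhds u₀ hκ₂)] with s hs using hs
  have e7 : ∀ᶠ s in 𝓝 s₀, |(F s).1| < κ₂ / 2 := by
    filter_upwards [hF1.eventually (Metric.ball_mem_nhds (0 : ℝ) (half_pos hκ₂))] with s hs
    simpa [Real.dist_eq] using hs
  have e8 : ∀ᶠ s in 𝓝 s₀, ∀ r ∈ Icc κ₁ (t₀ - κ₂ / 2), φ r (σ j s) ∉ crossSet σ := by
    refine isCompact_Icc.eventually_forall_of_forall_eventually fun r hr => ?_
    have hc : ContinuousAt (fun z : ℝ × ℝ => φ z.2 (σ j z.1)) (s₀, r) :=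
      ContinuousAt.comp (f := Prod.swap) (x := (s₀, r))
        (h.continuousAt_flow j r hsI) continuous_swap.continuousAt
    exact hc.eventually (h.isClosed_crossSet.isOpen_compl.mem_nhds
      (hno r ⟨by linarith [hr.1], by linarith [hr.2]⟩))
  obtain ⟨ρ, hρ, H⟩ := Metric.eventually_nhds_iff.1
    (e1.and (e2.and (e3.and (e4.and (e5.and (e6.and (e7.and e8)))))))
  have H' : ∀ s ∈ Ioo (s₀ - ρ) (s₀ + ρ), dist s s₀ < ρ := fun s hs => by
    rw [Real.dist_eq, abs_lt]; exact ⟨by linarith [hs.1], by linarith [hs.2]⟩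
  -- The target arc is met when the time offset vanishes, that is at time `t₀ - (F s).1`.
  refine ⟨fun s => (F s).2, fun s => t₀ - (F s).1, ρ, hρ, ?_, ?_, by simp [hF0], by simp [hF0],
    fun s hs => ?_⟩
  · intro s hs
    obtain ⟨h1, h2, -⟩ := H (H' s hs)
    exact (hFc s (Ioo_subset_Icc_self h1) h2).snd.continuousWithinAt
  · intro s hs
    obtain ⟨h1, h2, -⟩ := H (H' s hs)
    exact (continuousAt_const.sub (hFc s (Ioo_subset_Icc_self h1) h2).fst).continuousWithinAt
  · obtain ⟨h1, h2, h3, h4, h5, h6, h7, h8⟩ := H (H' s hs)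
    have hFs : F s ∈ e.source := e.map_target h2
    have hφ : φ (F s).1 (σ k (F s).2) = φ t₀ (σ j s) := by
      rw [← hv _ hFs]; exact e.right_inv h2
    have hback : ∀ r, φ r (σ j s) = φ (r - (t₀ - (F s).1)) (σ k (F s).2) := fun r => by
      rw [show r - (t₀ - (F s).1) = (r - t₀) + (F s).1 by ring, φ.map_add, hφ, ← φ.map_add]
      congr 1; ring
    refine ⟨h1, h3, by linarith [h4.1], by linarith [h4.2], ?_, mem_crossSet j
      (Ioo_subset_Icc_self h1), mem_crossSet k (Ioo_subset_Icc_self h3), fun r hr => ?_⟩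
    · rw [hback]; simp
    · rw [abs_lt] at h7
      by_cases hr1 : r < κ₁
      · refine H₁ (y := (r, s)) ?_ hr.1.ne'
        rw [Prod.dist_eq, max_lt_iff, Real.dist_eq, Real.dist_eq]
        refine ⟨?_, h5⟩
        dsimp only
        rw [sub_zero, abs_of_pos hr.1]; exact hr1
      by_cases hr2 : r ≤ t₀ - κ₂ / 2
      · exact h8 r ⟨not_lt.1 hr1, hr2⟩
      rw [hback]
      have hr3 := hr.2
      refine H₂ (y := (r - (t₀ - (F s).1), (F s).2)) ?_ (by dsimp only; linarith : _ < (0 : ℝ)).ne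
      rw [Prod.dist_eq, max_lt_iff, Real.dist_eq, Real.dist_eq]
      refine ⟨?_, h6⟩
      dsimp only
      rw [sub_zero, abs_lt]
      constructor <;> linarith [h7.1, h7.2]

end Returns

end Dumbbell

namespace Dumbbell

/-! ### Thin gaps near the frontier, and compactness of the filling. -/

section Filling

variable {S : Type*} [TopologicalSpace S] [T2Space S] {ι : Type*} [Finite ι]
  {φ : Flow ℝ S} {Γ : Set S} {σ : ι → ℝ → S} {c δ : ℝ}

lemma mem_uIcc_sign_iff {s η w x : ℝ} (hη : η = 1 ∨ η = -1) (hw : 0 ≤ w) :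
    x ∈ uIcc s (s + η * w) ↔ ∃ u ∈ Icc 0 w, s + η * u = x := by
  rcases hη with rfl | rfl
  · rw [uIcc_of_le (by linarith)]
    constructor
    · intro h; exact ⟨x - s, ⟨by linarith [h.1], by linarith [h.2]⟩, by ring⟩
    · rintro ⟨u, hu, rfl⟩; exact ⟨by linarith [hu.1], by linarith [hu.2]⟩
  · rw [uIcc_of_ge (by linarith)]
    constructor
    · intro h; exact ⟨s - x, ⟨by linarith [h.2], by linarith [h.1]⟩, by ring⟩
    · rintro ⟨u, hu, rfl⟩; exact ⟨by linarith [hu.2], by linarith [hu.1]⟩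

lemma gapArc_eq {i : ι} {s η w : ℝ} (hη : η = 1 ∨ η = -1) (hw : 0 ≤ w) :
    gapArc σ i s η w = σ i '' uIcc s (s + η * w) := by
  ext x
  constructor
  · rintro ⟨u, hu, rfl⟩; exact ⟨_, (mem_uIcc_sign_iff hη hw).2 ⟨u, hu, rfl⟩, rfl⟩
  · rintro ⟨y, hy, rfl⟩
    obtain ⟨u, hu, rfl⟩ := (mem_uIcc_sign_iff hη hw).1 hy
    exact ⟨u, hu, rfl⟩

lemma exists_sign_width {a b : ℝ} (hab : a ≠ b) :
    ∃ η w : ℝ, (η = 1 ∨ η = -1) ∧ 0 < w ∧ w = |b - a| ∧ a + η * w = b := by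
  rcases lt_or_gt_of_ne hab with h | h
  · exact ⟨1, b - a, Or.inl rfl, by linarith, (abs_of_pos (by linarith)).symm, by ring⟩
  · refine ⟨-1, a - b, Or.inr rfl, by linarith, ?_, by ring⟩
    rw [abs_of_neg (by linarith)]; ring

lemma IsGap.start_mem_frontier (h : IsCrossSection φ Γ σ c) {i : ι} {s η w : ℝ}
    (hg : IsGap Γ σ i s η w) : σ i s ∈ frontier Γ := by
  rw [h.isClosed.frontier_eq]
  refine ⟨hg.start_inv, fun h_int => ?_⟩
  have hc : ContinuousAt (fun u => σ i (s + η * u)) 0 := by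
    refine ContinuousAt.comp (g := σ i) (f := fun u => s + η * u) ?_ (by fun_prop)
    simpa using h.continuousAt i (Ioo_subset_Icc_self hg.start_mem)
  have : ∀ᶠ u in 𝓝[>] (0 : ℝ), σ i (s + η * u) ∈ interior Γ :=
    (hc.eventually (isOpen_interior.mem_nhds (by simpa using h_int))).filter_mono
      nhdsWithin_le_nhds
  obtain ⟨u, hu, hu'⟩ := (this.and (Ioo_mem_nhdsGT hg.pos)).exists
  exact hg.notMem u hu' (interior_subset hu)

/-- Gaps close to a point of the frontier are thin. -/
lemma IsCrossSection.exists_forall_isThinGap (h : IsCrossSection φ Γ σ c) (hδ : 0 < δ) {j : ι}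
    {s₀ : ℝ} (hs₀ : s₀ ∈ Ioo (-1 : ℝ) 1) (hfr : σ j s₀ ∈ frontier Γ) :
    ∃ ρ > 0, ∀ s η w, IsGap Γ σ j s η w → s ∈ Ioo (s₀ - ρ) (s₀ + ρ) →
      s + η * w ∈ Ioo (s₀ - ρ) (s₀ + ρ) → IsThinGap φ Γ σ δ j s η w := by
  obtain ⟨y, t₀, hn⟩ := h.exists_isNext hfr (mem_crossSet j (Ioo_subset_Icc_self hs₀))
  have hy : y ∈ frontier Γ := hn.2.2.1 ▸ invariant_frontier h.invariant t₀ hfr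
  obtain ⟨k, u₀, hu₀, rfl⟩ := h.exists_param hy hn.2.2.2.2.1
  obtain ⟨f, θ, ρ₀, hρ₀, hf, -, hf0, -, H⟩ := h.exists_return hs₀ hu₀ hn
  have hfc : ContinuousAt f s₀ :=
    hf.continuousAt (Ioo_mem_nhds (by linarith) (by linarith))
  obtain ⟨ρ₁, hρ₁, H₁⟩ := Metric.continuousAt_iff.1 hfc (δ / 2) (by linarith)
  -- Two starting points with the same first return coincide, because a return determines its
  -- predecessor. Being continuous and injective on an interval, `f` is monotone.
  have hinj : InjOn f (Ioo (s₀ - ρ₀) (s₀ + ρ₀)) := by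
    intro a ha b hb hab
    have h1 := (H a ha).2.2
    have h2 := (H b hb).2.2
    rw [hab] at h1
    exact (h.inj (Ioo_subset_Icc_self (H a ha).1) (Ioo_subset_Icc_self (H b hb).1)
      (h1.left_unique h2).2).2
  refine ⟨min ρ₀ (min ρ₁ (δ / 2)), by positivity, fun s η w hg hs hv => ?_⟩
  set ρ := min ρ₀ (min ρ₁ (δ / 2)) with hρ
  have hρ0 : ρ ≤ ρ₀ := min_le_left _ _
  have hρ1 : ρ ≤ ρ₁ := (min_le_right _ _).trans (min_le_left _ _)
  have hρ2 : ρ ≤ δ / 2 := (min_le_right _ _).trans (min_le_right _ _)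
  set v := s + η * w with hvdef
  have hsub : uIcc s v ⊆ Ioo (s₀ - ρ₀) (s₀ + ρ₀) := by
    have : Ioo (s₀ - ρ) (s₀ + ρ) ⊆ Ioo (s₀ - ρ₀) (s₀ + ρ₀) :=
      Ioo_subset_Ioo (by linarith) (by linarith)
    exact (ordConnected_Ioo.uIcc_subset hs hv).trans this
  have hsI := hsub left_mem_uIcc
  have hvI := hsub right_mem_uIcc
  have hsv : s ≠ v := by
    rcases hg.sign with h | h <;> rw [hvdef, h] <;> intro h' <;> linarith [hg.pos]
  have hfsv : f s ≠ f v := fun e => hsv (hinj hsI hvI e)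
  obtain ⟨η', w', hη', hw', hw'e, hfv⟩ := exists_sign_width hfsv
  have hclose : ∀ x ∈ Ioo (s₀ - ρ) (s₀ + ρ), |f x - u₀| < δ / 2 := by
    intro x hx
    rw [← hf0, ← Real.dist_eq]
    refine H₁ ?_
    rw [Real.dist_eq, abs_lt]; constructor <;> linarith [hx.1, hx.2]
  -- Invariance of `Γ` makes `f` match the points of `Γ` on both arcs, so it carries a gap exactly
  -- onto a gap.
  have hinv : ∀ x ∈ uIcc s v, (σ k (f x) ∈ Γ ↔ σ j x ∈ Γ) := by
    intro x hx
    have := (H x (hsub hx)).2.2.2.2.1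
    rw [← this, invariant_iff h.invariant]
  have hIVT : uIcc (f s) (f v) ⊆ f '' uIcc s v := intermediate_value_uIcc (hf.mono hsub)
  have hmaps : ∀ x ∈ uIcc s v, f x ∈ uIcc (f s) (f v) := by
    have hlt : s₀ - ρ₀ < s₀ + ρ₀ := by linarith
    intro x hx
    rcases hf.strictMonoOn_of_injOn_Ioo hlt hinj with hm | hm
    · rcases mem_uIcc.1 hx with hx' | hx'
      · exact mem_uIcc.2 (Or.inl ⟨hm.monotoneOn hsI (hsub hx) hx'.1,
          hm.monotoneOn (hsub hx) hvI hx'.2⟩)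
      · exact mem_uIcc.2 (Or.inr ⟨hm.monotoneOn hvI (hsub hx) hx'.1,
          hm.monotoneOn (hsub hx) hsI hx'.2⟩)
    · rcases mem_uIcc.1 hx with hx' | hx'
      · exact mem_uIcc.2 (Or.inr ⟨hm.antitoneOn (hsub hx) hvI hx'.2,
          hm.antitoneOn hsI (hsub hx) hx'.1⟩)
      · exact mem_uIcc.2 (Or.inl ⟨hm.antitoneOn (hsub hx) hsI hx'.2,
          hm.antitoneOn hvI (hsub hx) hx'.1⟩)
  refine ⟨hg, ?_, k, f s, η', w', ⟨hη', hw', (H s hsI).2.1, hfv ▸ (H v hvI).2.1,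
    (hinv s left_mem_uIcc).2 hg.start_inv, ?_, fun r hr => ?_⟩, ?_, ?_, ?_⟩
  · have : w = |v - s| := by
      rcases hg.sign with h | h <;> rw [hvdef, h] <;> simp [abs_of_pos hg.pos]
    rw [this, abs_lt]
    constructor <;> linarith [hs.1, hs.2, hv.1, hv.2]
  · rw [hfv]; exact (hinv v right_mem_uIcc).2 hg.last_inv
  · have hr' : f s + η' * r ∈ uIcc (f s) (f v) := by
      rw [← hfv]; exact (mem_uIcc_sign_iff hη' hw'.le).2 ⟨r, Ioo_subset_Icc_self hr, rfl⟩
    obtain ⟨x, hx, hxe⟩ := hIVT hr'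
    rw [← hxe, hinv x hx]
    obtain ⟨u, hu, rfl⟩ := (mem_uIcc_sign_iff hg.sign hg.pos.le).1 hx
    have hη0 : η' ≠ 0 := by rcases hη' with h | h <;> rw [h] <;> norm_num
    refine hg.notMem u ⟨lt_of_le_of_ne hu.1 ?_, lt_of_le_of_ne hu.2 ?_⟩
    · rintro rfl
      rw [mul_zero, add_zero] at hxe
      have : η' * r = 0 := by linarith
      rcases mul_eq_zero.1 this with h' | h'
      · exact hη0 h'
      · exact hr.1.ne' h'
    · rintro rfl
      rw [← hvdef, ← hfv] at hxe
      have := mul_left_cancel₀ hη0 (add_left_cancel hxe)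
      exact hr.2.ne' this
  · rw [hw'e, abs_lt]
    have h1 := abs_lt.1 (hclose s hs)
    have h2 := abs_lt.1 (hclose v hv)
    constructor <;> linarith [h1.1, h1.2, h2.1, h2.2]
  · intro x hx
    rw [gapArc_eq hg.sign hg.pos.le] at hx
    obtain ⟨a, ha, rfl⟩ := hx
    refine ⟨σ k (f a), ?_, θ a, (H a (hsub ha)).2.2⟩
    rw [gapArc_eq hη' hw'.le, hfv]
    exact ⟨_, hmaps a ha, rfl⟩
  · intro y hy
    rw [gapArc_eq hη' hw'.le, hfv] at hy
    obtain ⟨b, hb, rfl⟩ := hy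
    obtain ⟨a, ha, rfl⟩ := hIVT hb
    refine ⟨σ j a, ?_, θ a, (H a (hsub ha)).2.2⟩
    rw [gapArc_eq hg.sign hg.pos.le]
    exact ⟨a, ha, rfl⟩

/-- A point off `Γ` between two points of `Γ` on the same arc lies in a gap. -/
lemma IsCrossSection.exists_isGap (h : IsCrossSection φ Γ σ c) {j : ι} {s η a b u : ℝ}
    (hη : η = 1 ∨ η = -1) (hu : u ∈ Ioo a b)
    (hpar : ∀ r ∈ Icc a b, s + η * r ∈ Ioo (-1 : ℝ) 1)
    (ha : σ j (s + η * a) ∈ Γ) (hb : σ j (s + η * b) ∈ Γ) (hn : σ j (s + η * u) ∉ Γ) :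
    ∃ a' b', a ≤ a' ∧ a' < u ∧ u < b' ∧ b' ≤ b ∧ IsGap Γ σ j (s + η * a') η (b' - a') := by
  have hc : ContinuousOn (fun r => σ j (s + η * r)) (Icc a b) := fun r hr =>
    (ContinuousAt.comp (g := σ j) (f := fun r => s + η * r)
      (h.continuousAt j (Ioo_subset_Icc_self (hpar r hr))) (by fun_prop)).continuousWithinAt
  have hcl := hc.preimage_isClosed_of_isClosed isClosed_Icc h.isClosed
  have hcp : IsCompact (Icc a b ∩ (fun r => σ j (s + η * r)) ⁻¹' Γ) :=
    isCompact_Icc.of_isClosed_subset hcl inter_subset_left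
  -- The ends of the gap are the points of `Γ` nearest to `u` on either side.
  obtain ⟨a', ha', hmax⟩ := (hcp.inter_right (isClosed_Iic (a := u))).exists_isGreatest
    ⟨a, ⟨⟨le_rfl, (hu.1.trans hu.2).le⟩, ha⟩, hu.1.le⟩
  obtain ⟨b', hb', hmin⟩ := (hcp.inter_right (isClosed_Ici (a := u))).exists_isLeast
    ⟨b, ⟨⟨(hu.1.trans hu.2).le, le_rfl⟩, hb⟩, hu.2.le⟩
  have h1 : a' < u := lt_of_le_of_ne ha'.2 (by rintro rfl; exact hn ha'.1.2)
  have h2 : u < b' := lt_of_le_of_ne hb'.2 (by rintro rfl; exact hn hb'.1.2)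
  have e : s + η * a' + η * (b' - a') = s + η * b' := by ring
  refine ⟨a', b', ha'.1.1.1, h1, h2, hb'.1.1.2, hη, by linarith, hpar _ ha'.1.1,
    e ▸ hpar _ hb'.1.1, ha'.1.2, by rw [e]; exact hb'.1.2, fun r hr hmem => ?_⟩
  rw [show s + η * a' + η * r = s + η * (a' + r) by ring] at hmem
  have hr1 := hr.1
  have hr2 := hr.2
  have hI : a' + r ∈ Icc a b := ⟨by linarith [ha'.1.1.1], by linarith [hb'.1.1.2]⟩
  rcases le_total (a' + r) u with h' | h'
  · have := hmax ⟨⟨hI, hmem⟩, h'⟩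
    linarith
  · have := hmin ⟨⟨hI, hmem⟩, h'⟩
    linarith

lemma exists_param_radius {s₀ : ℝ} (hs₀ : s₀ ∈ Ioo (-1 : ℝ) 1) :
    ∃ ρ > 0, ∀ η u : ℝ, (η = 1 ∨ η = -1) → |u| < ρ → s₀ + η * u ∈ Ioo (-1 : ℝ) 1 := by
  refine ⟨min (1 - s₀) (s₀ + 1), lt_min (by linarith [hs₀.2]) (by linarith [hs₀.1]), ?_⟩
  intro η u hη hu
  rw [lt_min_iff, abs_lt, abs_lt] at hu
  rcases hη with rfl | rfl <;> constructor <;> linarith [hu.1.1, hu.1.2, hu.2.1, hu.2.2]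

/-- On a side from which `Γ` accumulates, all nearby points of the section are in `Γ` or thin. -/
lemma IsCrossSection.exists_filled_side (h : IsCrossSection φ Γ σ c) (hδ : 0 < δ) {j : ι}
    {s₀ η : ℝ} (hs₀ : s₀ ∈ Ioo (-1 : ℝ) 1) (hη : η = 1 ∨ η = -1) (hfr : σ j s₀ ∈ frontier Γ)
    (hacc : ∀ ρ > 0, ∃ u ∈ Ioo 0 ρ, σ j (s₀ + η * u) ∈ Γ) :
    ∃ ρ > 0, ∀ u ∈ Ioo 0 ρ, σ j (s₀ + η * u) ∈ thinSet φ Γ σ δ ∪ Γ := by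
  obtain ⟨ρ₁, hρ₁, H₁⟩ := h.exists_forall_isThinGap hδ hs₀ hfr
  obtain ⟨ρ₂, hρ₂, H₂⟩ := exists_param_radius hs₀
  obtain ⟨u₁, hu₁, hm⟩ := hacc (min ρ₁ ρ₂) (lt_min hρ₁ hρ₂)
  have hu₁₁ := hu₁.2.trans_le (min_le_left _ _)
  have hu₁₂ := hu₁.2.trans_le (min_le_right _ _)
  refine ⟨u₁, hu₁.1, fun u hu => ?_⟩
  by_cases hmem : σ j (s₀ + η * u) ∈ Γ
  · exact Or.inr hmem
  -- A parameter off `Γ` lies between `s₀` and the accumulating point `u₁`, hence in a gap trapped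
  -- near `s₀`, and such gaps are thin.
  obtain ⟨a, b, ha0, hau, hub, hb1, hg⟩ := h.exists_isGap (j := j) (s := s₀) (a := 0) (b := u₁) hη
    hu (fun r hr => H₂ η r hη (by rw [abs_of_nonneg hr.1]; linarith [hr.2]))
    (by simpa using h.isClosed.frontier_subset hfr) hm hmem
  refine Or.inl ⟨j, _, η, _, H₁ _ _ _ hg ?_ ?_, u - a, ⟨by linarith, by linarith⟩, ?_⟩
  · rcases hη with rfl | rfl <;> constructor <;> linarith
  · rcases hη with rfl | rfl <;> constructor <;> linarith
  · dsimp only; congr 1; ring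

/-- If `Γ` avoided both sides of the point, a small flow box would meet `Γ` only along the orbit of
the point, which would then be isolated. -/
lemma IsCrossSection.accumulates_of_gap_side (h : IsCrossSection φ Γ σ c) {j : ι}
    {s₀ η : ℝ} (hs₀ : s₀ ∈ Ioo (-1 : ℝ) 1) (hη : η = 1 ∨ η = -1) (hΓ : σ j s₀ ∈ Γ)
    {w : ℝ} (hw : 0 < w) (hno : ∀ u ∈ Ioo 0 w, σ j (s₀ + η * u) ∉ Γ) :
    ∀ ρ > 0, ∃ u ∈ Ioo 0 ρ, σ j (s₀ + -η * u) ∈ Γ := by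
  intro ρ hρ
  by_contra! hcon
  obtain ⟨e, he, hv⟩ := h.box j
  have h0 : ((0, s₀) : ℝ × ℝ) ∈ e.source := by
    rw [he]; exact ⟨⟨by linarith [h.pos], h.pos⟩, Icc_subset_Ioo_two (Ioo_subset_Icc_self hs₀)⟩
  set r := min ρ w
  have hr : 0 < r := lt_min hρ hw
  have hN : e.source ∩ (univ ×ˢ Ioo (s₀ - r) (s₀ + r)) ∈ 𝓝 ((0, s₀) : ℝ × ℝ) :=
    (e.open_source.inter (isOpen_univ.prod isOpen_Ioo)).mem_nhds
      ⟨h0, mem_univ _, by linarith, by linarith⟩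
  have hI := e.image_mem_nhds h0 hN
  rw [show e (0, s₀) = σ j s₀ by rw [hv _ h0]; simp] at hI
  refine h.not_isolated _ hΓ ⟨_, hI, ?_⟩
  rintro y ⟨⟨⟨t, s⟩, ⟨hz, -, hs⟩, rfl⟩, hyΓ⟩
  rw [hv _ hz] at hyΓ ⊢
  rw [invariant_iff h.invariant] at hyΓ
  dsimp only at hyΓ hs ⊢
  have : s = s₀ := by
    by_contra hne
    have hr1 : r ≤ ρ := min_le_left _ _
    have hr2 : r ≤ w := min_le_right _ _
    obtain ⟨ξ, u, hξ, hu, hue, hus⟩ := exists_sign_width (Ne.symm hne)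
    have hur : u < r := by
      rw [hue, abs_lt]; constructor <;> linarith [hs.1, hs.2]
    rw [← hus] at hyΓ
    by_cases hξη : ξ = η
    · subst hξη; exact hno u ⟨hu, by linarith⟩ hyΓ
    · have : ξ = -η := by
        rcases hξ with rfl | rfl <;> rcases hη with rfl | rfl <;> simp_all
      subst this; exact hcon u ⟨hu, by linarith⟩ hyΓ
  rw [this]
  exact φ.mem_orbit _ _

/-- Being thin is constant along segments of the section off `Γ`. -/
lemma IsCrossSection.thinSet_of_segment (h : IsCrossSection φ Γ σ c) {j : ι} {a b : ℝ}
    (ha : a ∈ Icc (-1 : ℝ) 1) (hseg : ∀ r ∈ uIcc a b, σ j r ∉ Γ)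
    (hm : σ j a ∈ thinSet φ Γ σ δ) : σ j b ∈ thinSet φ Γ σ δ := by
  obtain ⟨i, s, η, w, hg, u, hu, e⟩ := hm
  obtain ⟨rfl, rfl⟩ := h.inj (Ioo_subset_Icc_self (hg.gap.param_mem hu)) ha e
  have hna := hseg _ left_mem_uIcc
  have hu' : u ∈ Ioo 0 w := by
    refine ⟨lt_of_le_of_ne hu.1 ?_, lt_of_le_of_ne hu.2 ?_⟩
    · rintro rfl; exact hna (by simpa using hg.gap.start_inv)
    · rintro rfl; exact hna hg.gap.last_inv
  have := hg.gap.mem_Ioo_of_segment hu' hseg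
  refine ⟨i, s, η, w, hg, η * (b - s), Ioo_subset_Icc_self this, ?_⟩
  dsimp only
  congr 1
  rcases hg.gap.sign with rfl | rfl <;> ring

lemma IsCrossSection.exists_param_of_thinSet {x : S} (hx : x ∈ thinSet φ Γ σ δ) :
    ∃ i, ∃ s ∈ Ioo (-1 : ℝ) 1, σ i s = x := by
  obtain ⟨i, s, η, w, hg, u, hu, rfl⟩ := hx
  exact ⟨i, _, hg.gap.param_mem hu, rfl⟩

lemma thinSet_subset_crossSet : thinSet φ Γ σ δ ⊆ crossSet σ := by
  intro x hx
  obtain ⟨i, s, hs, rfl⟩ := IsCrossSection.exists_param_of_thinSet hx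
  exact mem_crossSet i (Ioo_subset_Icc_self hs)

lemma IsCrossSection.mem_frontier_of_thinSet (h : IsCrossSection φ Γ σ c) {x : S}
    (hx : x ∈ thinSet φ Γ σ δ) (hΓ : x ∈ Γ) : x ∈ frontier Γ := by
  obtain ⟨i, s, η, w, hg, u, hu, rfl⟩ := hx
  rcases eq_or_lt_of_le hu.1 with rfl | h0
  · simpa using hg.gap.start_mem_frontier h
  rcases eq_or_lt_of_le hu.2 with rfl | h1
  · exact hg.gap.flip.start_mem_frontier h
  · exact absurd hΓ (hg.gap.notMem u ⟨h0, h1⟩)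

/-- Near a point of one arc, the section consists of nearby points of this arc. -/
lemma IsCrossSection.eventually_param (h : IsCrossSection φ Γ σ c) (i : ι) {s₀ r : ℝ}
    (hs₀ : s₀ ∈ Icc (-1 : ℝ) 1) (hr : 0 < r) :
    ∀ᶠ y in 𝓝 (σ i s₀), y ∈ crossSet σ → ∃ s ∈ Icc (-1 : ℝ) 1, |s - s₀| < r ∧ σ i s = y := by
  have h1 : ∀ j, ∀ᶠ y in 𝓝 (σ i s₀), j ≠ i → y ∉ σ j '' Icc (-1) 1 := by
    intro j
    by_cases hj : j = i
    · simp [hj]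
    · have : σ i s₀ ∈ (σ j '' Icc (-1) 1)ᶜ := by
        rintro ⟨u, hu, e⟩
        exact hj (h.inj hu hs₀ e).1
      filter_upwards [(h.isCompact_arc j).isClosed.isOpen_compl.mem_nhds this] with z hz _ using hz
  have hcp : IsCompact (σ i '' (Icc (-1) 1 ∩ (Ioo (s₀ - r) (s₀ + r))ᶜ)) :=
    (isCompact_Icc.inter_right isOpen_Ioo.isClosed_compl).image_of_continuousOn
      ((h.continuousOn i).mono (inter_subset_left.trans Icc_subset_Ioo_two))
  have h2 : σ i s₀ ∈ (σ i '' (Icc (-1) 1 ∩ (Ioo (s₀ - r) (s₀ + r))ᶜ))ᶜ := by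
    rintro ⟨u, hu, e⟩
    obtain ⟨-, rfl⟩ := h.inj hu.1 hs₀ e
    exact hu.2 ⟨by linarith, by linarith⟩
  filter_upwards [Filter.eventually_all.2 h1, hcp.isClosed.isOpen_compl.mem_nhds h2]
    with y hy1 hy2 hyT
  obtain ⟨j, s, hs, rfl⟩ := mem_iUnion.1 hyT
  by_cases hj : j = i
  · subst hj
    refine ⟨s, hs, ?_, rfl⟩
    by_contra hcon
    refine hy2 ⟨s, ⟨hs, fun hs' => hcon ?_⟩, rfl⟩
    rw [abs_lt]; constructor <;> linarith [hs'.1, hs'.2]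
  · exact absurd ⟨s, hs, rfl⟩ (hy1 j hj)

/-- Off `Γ`, thinness is locally constant along the arcs, so it passes to limits. Thin gaps may also
shrink towards a point of `Γ`; such limits lie on the frontier, which is why that part is added. -/
lemma IsCrossSection.isClosed_thin (h : IsCrossSection φ Γ σ c) :
    IsClosed (thinSet φ Γ σ δ ∪ (frontier Γ ∩ crossSet σ)) := by
  rw [← closure_subset_iff_isClosed]
  intro x hx
  have hxT : x ∈ crossSet σ := by
    have : thinSet φ Γ σ δ ∪ (frontier Γ ∩ crossSet σ) ⊆ crossSet σ :=
      union_subset thinSet_subset_crossSet inter_subset_right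
    exact h.isClosed_crossSet.closure_subset_iff.2 this hx
  by_cases hfr : x ∈ frontier Γ
  · exact Or.inr ⟨hfr, hxT⟩
  left
  rw [mem_closure_iff_nhds] at hx
  by_cases hxΓ : x ∈ Γ
  · have h_int : x ∈ interior Γ := by
      by_contra hcon
      exact hfr (by rw [h.isClosed.frontier_eq]; exact ⟨hxΓ, hcon⟩)
    obtain ⟨y, hy, hy'⟩ := hx _ (isOpen_interior.mem_nhds h_int)
    have hyf : y ∈ frontier Γ := by
      rcases hy' with hy' | hy'
      · exact h.mem_frontier_of_thinSet hy' (interior_subset hy)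
      · exact hy'.1
    exact absurd hy hyf.2
  · obtain ⟨i, s₀, hs₀, rfl⟩ := mem_iUnion.1 hxT
    have hev : ∀ᶠ s in 𝓝 s₀, σ i s ∉ Γ :=
      (h.continuousAt i hs₀).eventually (h.isClosed.isOpen_compl.mem_nhds hxΓ)
    obtain ⟨r, hr, H⟩ := Metric.eventually_nhds_iff.1 hev
    obtain ⟨y, hy, hy'⟩ := hx _ ((h.eventually_param i hs₀ hr).and
      (h.isClosed.isOpen_compl.mem_nhds hxΓ))
    have hythin : y ∈ thinSet φ Γ σ δ := by
      rcases hy' with hy' | hy'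
      · exact hy'
      · exact absurd (h.isClosed.frontier_subset hy'.1) hy.2
    obtain ⟨s, hs, hsr, rfl⟩ := hy.1 (thinSet_subset_crossSet hythin)
    refine h.thinSet_of_segment hs (fun r' hr' => H ?_) hythin
    rw [Real.dist_eq, abs_sub_comm]
    exact (abs_sub_right_of_mem_uIcc hr').trans_lt (by rwa [abs_sub_comm])

lemma IsCrossSection.exists_isNext_of_mem (h : IsCrossSection φ Γ σ c) {x : S}
    (hx : x ∈ thinSet φ Γ σ δ ∪ (frontier Γ ∩ crossSet σ)) :
    ∃ t, ∃ i, ∃ s ∈ Ioo (-1 : ℝ) 1, ∃ k, ∃ u ∈ Ioo (-1 : ℝ) 1,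
      σ i s = x ∧ IsNext φ σ x (σ k u) t := by
  rcases hx with hx | ⟨hx, hxT⟩
  · obtain ⟨y, hy, t, hn⟩ := exists_isNext_of_mem_thinSet hx
    obtain ⟨i, s, hs, e⟩ := IsCrossSection.exists_param_of_thinSet hx
    obtain ⟨k, u, hu, rfl⟩ := IsCrossSection.exists_param_of_thinSet hy
    exact ⟨t, i, s, hs, k, u, hu, e, hn⟩
  · obtain ⟨y, t, hn⟩ := h.exists_isNext hx hxT
    obtain ⟨i, s, hs, e⟩ := h.exists_param hx hxT
    obtain ⟨k, u, hu, rfl⟩ := h.exists_param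
      (hn.2.2.1 ▸ invariant_frontier h.invariant t hx) hn.2.2.2.2.1
    exact ⟨t, i, s, hs, k, u, hu, e, hn⟩

/-- The return time is continuous on the closed set `A` of thin and frontier points of the section,
so the pairs `(r, x)` with `0 ≤ r ≤ τ x` form a compact set. The flow maps it onto the strips
together with orbit segments of frontier points, and the latter already lie in `Γ`. -/
lemma IsCrossSection.isCompact_filling (h : IsCrossSection φ Γ σ c) (hΓ : IsCompact Γ) :
    IsCompact (filling φ Γ σ δ) := by
  classical
  set A := thinSet φ Γ σ δ ∪ (frontier Γ ∩ crossSet σ) with hA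
  have hAc : IsCompact A := h.isCompact_crossSet.of_isClosed_subset h.isClosed_thin
    (union_subset thinSet_subset_crossSet inter_subset_right)
  have hex : ∀ x ∈ A, ∃ t y, IsNext φ σ x y t := fun x hx => by
    obtain ⟨t, i, s, -, k, u, -, -, hn⟩ := h.exists_isNext_of_mem hx
    exact ⟨t, _, hn⟩
  let τ : S → ℝ := fun x => if hx : x ∈ A then (hex x hx).choose else 0
  have hτ : ∀ x ∈ A, ∃ y, IsNext φ σ x y (τ x) := fun x hx => by
    simp only [τ, dif_pos hx]; exact (hex x hx).choose_spec
  -- By uniqueness of returns, `τ` coincides locally with the continuous return time `θ` of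
  -- `exists_return`.
  have hτc : ContinuousOn τ A := by
    intro x hx
    obtain ⟨t, i, s₀, hs₀, k, u₀, hu₀, rfl, hn⟩ := h.exists_isNext_of_mem hx
    obtain ⟨f, θ, ρ, hρ, -, hθ, -, hθ0, H⟩ := h.exists_return hs₀ hu₀ hn
    have hθc : ContinuousAt θ s₀ :=
      hθ.continuousAt (Ioo_mem_nhds (by linarith) (by linarith))
    rw [Metric.continuousWithinAt_iff']
    intro ε hε
    obtain ⟨ρ₁, hρ₁, H₁⟩ := Metric.continuousAt_iff.1 hθc ε hε
    have hev := h.eventually_param i (Ioo_subset_Icc_self hs₀) (lt_min hρ hρ₁)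
    filter_upwards [nhdsWithin_le_nhds hev, self_mem_nhdsWithin] with y hy hyA
    obtain ⟨s, hs, hsr, rfl⟩ := hy (union_subset thinSet_subset_crossSet inter_subset_right hyA)
    rw [lt_min_iff] at hsr
    obtain ⟨y', hy'⟩ := hτ _ hyA
    obtain ⟨y'', hy''⟩ := hτ _ hx
    have hs' : s ∈ Ioo (s₀ - ρ) (s₀ + ρ) := by
      have := abs_lt.1 hsr.1
      exact ⟨by linarith, by linarith⟩
    rw [(hy'.right_unique (H s hs').2.2).1, (hy''.right_unique hn).1, ← hθ0]
    exact H₁ (by rw [Real.dist_eq]; exact hsr.2)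
  have hD : IsCompact {z ∈ Icc (0 : ℝ) 2 ×ˢ A | z.1 ≤ τ z.2} := by
    have hP : IsCompact (Icc (0 : ℝ) 2 ×ˢ A) := isCompact_Icc.prod hAc
    refine hP.of_isClosed_subset ?_ (sep_subset _ _)
    exact hP.isClosed.isClosed_le continuousOn_fst
      (hτc.comp continuousOn_snd fun z hz => hz.2)
  have hK : filling φ Γ σ δ =
      Γ ∪ (fun z : ℝ × S => φ z.1 z.2) '' {z ∈ Icc (0 : ℝ) 2 ×ˢ A | z.1 ≤ τ z.2} := by
    ext z
    constructor
    · rintro (hz | ⟨x, hx, y, t, r, hn, hr0, hrt, rfl⟩)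
      · exact Or.inl hz
      · obtain ⟨y', hy'⟩ := hτ x (Or.inl hx)
        refine Or.inr ⟨(r, x), ⟨⟨⟨hr0, ?_⟩, Or.inl hx⟩, ?_⟩, rfl⟩
        · exact hrt.trans hn.2.1.le
        · exact hrt.trans_eq (hn.right_unique hy').1
    · rintro (hz | ⟨⟨r, x⟩, ⟨⟨⟨hr0, hr2⟩, hx⟩, hrt⟩, rfl⟩)
      · exact Or.inl hz
      · rcases hx with hx | hx
        · obtain ⟨y', hy'⟩ := hτ x (Or.inl hx)
          exact Or.inr ⟨x, hx, y', _, r, hy', hr0, hrt, rfl⟩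
        · exact Or.inl (h.invariant r (h.isClosed.frontier_subset hx.1))
  rw [hK]
  exact hΓ.union (hD.image (continuous_flow φ))

/-- If the orbit has not met the section since `x`, the only strip segment that can contain the
point is the one issuing from `x`. Near an arc, the filling after it is thus governed by forward
thinness, and the filling before it by thinness for the reversed flow. -/
lemma mem_filling_iff_of_forward (hinv : IsInvariant φ Γ) {x : S} {t : ℝ} (hx : x ∈ crossSet σ)
    (ht : 0 < t) (hno : ∀ r ∈ Ioc 0 t, φ r x ∉ crossSet σ) :
    φ t x ∈ filling φ Γ σ δ ↔ x ∈ thinSet φ Γ σ δ ∪ Γ := by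
  constructor
  · rintro (hz | ⟨x', hx', y, t', r, hn, hr0, hrt, e⟩)
    · exact Or.inr ((invariant_iff hinv t x).1 hz)
    · have hzT := hno t ⟨ht, le_rfl⟩
      have hr0' : 0 < r := lt_of_le_of_ne hr0 (by
        rintro rfl; rw [← e] at hzT; exact hzT (by simpa using hn.2.2.2.1))
      have hrt' : r < t' := lt_of_le_of_ne hrt (by
        rintro rfl; rw [← e, hn.2.2.1] at hzT; exact hzT hn.2.2.2.2.1)
      rcases lt_trichotomy r t with hlt | rfl | hlt
      · have : φ (t - r) x = x' := by
          rw [show t - r = -r + t by ring, φ.map_add, ← e, flow_neg_apply]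
        exact absurd (this ▸ hn.2.2.2.1) (hno (t - r) ⟨by linarith, by linarith⟩)
      · have : x' = x := by
          rw [← flow_neg_apply φ r x', e, flow_neg_apply]
        exact Or.inl (this ▸ hx')
      · have : φ (r - t) x' = x := by
          rw [show r - t = -t + r by ring, φ.map_add, e, flow_neg_apply]
        exact absurd (this ▸ hx) (hn.2.2.2.2.2 (r - t) ⟨by linarith, by linarith⟩)
  · rintro (hx' | hx')
    · obtain ⟨y, -, t', hn⟩ := exists_isNext_of_mem_thinSet hx'
      refine Or.inr ⟨x, hx', y, t', t, hn, ht.le, ?_, rfl⟩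
      by_contra hcon
      exact hno t' ⟨hn.1, (not_le.1 hcon).le⟩ (hn.2.2.1 ▸ hn.2.2.2.2.1)
    · exact Or.inl (hinv t hx')

lemma mem_filling_iff_of_backward (hinv : IsInvariant φ Γ) {x : S} {t : ℝ} (hx : x ∈ crossSet σ)
    (ht : t < 0) (hno : ∀ r ∈ Ico t 0, φ r x ∉ crossSet σ) :
    φ t x ∈ filling φ Γ σ δ ↔ x ∈ thinSet φ.reverse Γ σ δ ∪ Γ := by
  have := mem_filling_iff_of_forward (φ := φ.reverse) (δ := δ) (t := -t)
    (fun t x hx => hinv (-t) hx) hx (by linarith)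
    (fun r hr => hno (-r) ⟨by linarith [hr.2], by linarith [hr.1]⟩)
  rwa [filling_reverse, Flow.reverse_apply, neg_neg] at this

/-- On the section itself a point may be the start of one strip or the end of another. -/
lemma mem_filling_iff_of_mem_crossSet {x : S} (hx : x ∈ crossSet σ) :
    x ∈ filling φ Γ σ δ ↔ x ∈ thinSet φ Γ σ δ ∪ Γ ∨ x ∈ thinSet φ.reverse Γ σ δ ∪ Γ := by
  constructor
  · rintro (hz | ⟨x', hx', y, t', r, hn, hr0, hrt, e⟩)
    · exact Or.inl (Or.inr hz)
    · rcases eq_or_lt_of_le hr0 with rfl | h0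
      · left; left; rw [← e]; simpa using hx'
      rcases eq_or_lt_of_le hrt with rfl | h1
      · right; left; rw [← e, hn.2.2.1]; exact hn.mem_thinSet_reverse hx'
      · exact absurd (e ▸ hx) (hn.2.2.2.2.2 r ⟨h0, h1⟩)
  · rintro ((hx' | hx') | (hx' | hx'))
    · obtain ⟨y, -, t', hn⟩ := exists_isNext_of_mem_thinSet hx'
      exact Or.inr ⟨x, hx', y, t', 0, hn, le_rfl, hn.1.le, by simp⟩
    · exact Or.inl hx'
    · obtain ⟨y, hy, t', hn⟩ := exists_isNext_of_mem_thinSet hx'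
      rw [reverse_reverse] at hy
      rw [isNext_reverse] at hn
      exact Or.inr ⟨y, hy, x, t', t', hn, hn.1.le, le_rfl, hn.2.2.1⟩
    · exact Or.inl hx'

end Filling

end Dumbbell

namespace Dumbbell

/-! ### Local models of the complement of the filling. -/

section Models

variable {S : Type*} [TopologicalSpace S]

/-- In flow box coordinates `(t, x) ↦ φ t (g x)` near the origin, `S₀` is the product `P ×ˢ Q`. -/
def IsModel (φ : Flow ℝ S) (S₀ : Set S) (g : ℝ → S) (P Q : Set ℝ) : Prop :=
  ∃ ρ > 0, ∃ e : OpenPartialHomeomorph (ℝ × ℝ) S, e.source = Ioo (-ρ) ρ ×ˢ Ioo (-ρ) ρ ∧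
    (∀ z ∈ e.source, e z = φ z.1 (g z.2)) ∧ ∀ z ∈ e.source, e z ∈ S₀ ↔ z.1 ∈ P ∧ z.2 ∈ Q

/-- There is a flow box `(t, x) ↦ φ t (g x)` near the origin. -/
def IsFlowBox (φ : Flow ℝ S) (g : ℝ → S) : Prop :=
  ∃ e : OpenPartialHomeomorph (ℝ × ℝ) S, (0 : ℝ × ℝ) ∈ e.source ∧
    ∀ z ∈ e.source, e z = φ z.1 (g z.2)

variable {φ : Flow ℝ S} {K S₀ : Set S} {g : ℝ → S} {P Q : Set ℝ}

lemma ball_prod_zero (ρ : ℝ) : Metric.ball (0 : ℝ × ℝ) ρ = Ioo (-ρ) ρ ×ˢ Ioo (-ρ) ρ := by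
  rw [← Prod.mk_zero_zero, ← ball_prod_same, Real.ball_eq_Ioo]; simp

/-- The complement of the interior of `K` is the closure of the complement of `K`, and closure
commutes with the box homeomorphism. It therefore suffices to know the complement of `K` up to
closure, as a product `P ×ˢ Q`. -/
lemma IsFlowBox.isModel (hb : IsFlowBox φ g)
    (hK : ∀ᶠ z : ℝ × ℝ in 𝓝 0, (φ z.1 (g z.2) ∈ K ↔ ¬(z.1 ∈ P ∧ z.2 ∈ Q))) :
    IsModel φ (interior K)ᶜ g (closure P) (closure Q) := by
  obtain ⟨e, h0, he⟩ := hb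
  obtain ⟨ρ, hρ, H⟩ := Metric.mem_nhds_iff.1
    (Filter.inter_mem (e.open_source.mem_nhds h0) hK)
  refine ⟨ρ, hρ, e.restrOpen _ (Metric.isOpen_ball (x := (0 : ℝ × ℝ)) (ε := ρ)), ?_, ?_, ?_⟩
  · rw [e.restrOpen_source, ← ball_prod_zero]
    exact inter_eq_right.2 fun z hz => (H hz).1
  · intro z hz
    rw [e.restrOpen_source] at hz
    exact he z hz.1
  · have him : (e.restrOpen _ (Metric.isOpen_ball (x := (0 : ℝ × ℝ)) (ε := ρ))).IsImage
        (P ×ˢ Q) Kᶜ := by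
      intro z hz
      rw [e.restrOpen_source] at hz
      have : φ z.1 (g z.2) ∈ K ↔ _ := (H hz.2).2
      change e z ∈ Kᶜ ↔ _
      rw [he z hz.1, mem_compl_iff, this, not_not]
      rfl
    intro z hz
    have := him.closure.apply_mem_iff hz
    rw [closure_compl, closure_prod_eq] at this
    exact this

lemma IsFlowBox.mem_interior (hb : IsFlowBox φ g)
    (hK : ∀ᶠ z : ℝ × ℝ in 𝓝 0, φ z.1 (g z.2) ∈ K) : g 0 ∈ interior K := by
  obtain ⟨e, h0, he⟩ := hb
  have e0 : e 0 = g 0 := by rw [he 0 h0]; simp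
  rw [← e0, mem_interior_iff_mem_nhds, ← e.map_nhds_eq h0, Filter.mem_map]
  filter_upwards [hK, e.open_source.mem_nhds h0] with z hz hz'
  rw [mem_preimage, he z hz']; exact hz

variable [T2Space S] {ι : Type*} [Finite ι] {Γ : Set S} {σ : ι → ℝ → S} {c δ : ℝ}

lemma IsCrossSection.isFlowBox (h : IsCrossSection φ Γ σ c) (j : ι) {s₀ η : ℝ}
    (hs₀ : s₀ ∈ Ioo (-1 : ℝ) 1) (hη : η = 1 ∨ η = -1) (t₀ : ℝ) :
    IsFlowBox φ fun x => φ t₀ (σ j (s₀ + η * x)) := by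
  obtain ⟨e, hs, he⟩ := h.box j
  have hη0 : η ≠ 0 := by rcases hη with rfl | rfl <;> norm_num
  let a : ℝ ≃ₜ ℝ := (Homeomorph.mulLeft₀ η hη0).trans (Homeomorph.addLeft s₀)
  let n : ℝ × ℝ ≃ₜ ℝ × ℝ := (Homeomorph.refl ℝ).prodCongr a
  refine ⟨(n.toOpenPartialHomeomorph.trans e).trans
    (φ.toHomeomorph t₀).toOpenPartialHomeomorph, ?_, ?_⟩
  · simp only [OpenPartialHomeomorph.trans_source, mem_inter_iff]
    refine ⟨⟨mem_univ _, ?_⟩, mem_univ _⟩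
    change ((0 : ℝ), s₀ + η * 0) ∈ e.source
    rw [hs, mul_zero, add_zero]
    exact ⟨⟨by linarith [h.pos], h.pos⟩, Icc_subset_Ioo_two (Ioo_subset_Icc_self hs₀)⟩
  · intro z hz
    simp only [OpenPartialHomeomorph.trans_source, mem_inter_iff] at hz
    change φ t₀ (e (z.1, s₀ + η * z.2)) = _
    rw [he (z.1, s₀ + η * z.2) hz.1.2, ← φ.map_add, ← φ.map_add, add_comm]

lemma tendsto_param (s₀ η : ℝ) :
    Filter.Tendsto (fun z : ℝ × ℝ => (z.1, s₀ + η * z.2)) (𝓝 0) (𝓝 (0, s₀)) := by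
  have : Continuous (fun z : ℝ × ℝ => (z.1, s₀ + η * z.2)) := by fun_prop
  simpa using this.tendsto 0

/-- The filling near a point of the section. -/
lemma IsCrossSection.eventually_mem_filling (h : IsCrossSection φ Γ σ c) (j : ι) {s₀ : ℝ} (η : ℝ)
    (hs₀ : s₀ ∈ Ioo (-1 : ℝ) 1) :
    ∀ᶠ z : ℝ × ℝ in 𝓝 0,
      (0 < z.1 → (φ z.1 (σ j (s₀ + η * z.2)) ∈ filling φ Γ σ δ ↔
        σ j (s₀ + η * z.2) ∈ thinSet φ Γ σ δ ∪ Γ)) ∧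
      (z.1 < 0 → (φ z.1 (σ j (s₀ + η * z.2)) ∈ filling φ Γ σ δ ↔
        σ j (s₀ + η * z.2) ∈ thinSet φ.reverse Γ σ δ ∪ Γ)) ∧
      (z.1 = 0 → (φ z.1 (σ j (s₀ + η * z.2)) ∈ filling φ Γ σ δ ↔
        σ j (s₀ + η * z.2) ∈ thinSet φ Γ σ δ ∪ Γ ∨
        σ j (s₀ + η * z.2) ∈ thinSet φ.reverse Γ σ δ ∪ Γ)) := by
  have h1 := (tendsto_param s₀ η).eventually ((h.eventually_notMem j
    (Ioo_subset_Icc_self hs₀)).and (continuousAt_snd.eventually (Ioo_mem_nhds hs₀.1 hs₀.2)))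
  obtain ⟨ρ, hρ, H⟩ := Metric.eventually_nhds_iff_ball.1 h1
  refine Metric.eventually_nhds_iff_ball.2 ⟨ρ, hρ, fun z hz => ?_⟩
  rw [ball_prod_zero] at hz H
  have hT : σ j (s₀ + η * z.2) ∈ crossSet σ :=
    mem_crossSet j (Ioo_subset_Icc_self (H z hz).2)
  refine ⟨fun h0 => mem_filling_iff_of_forward h.invariant hT h0 fun r hr => ?_,
    fun h0 => mem_filling_iff_of_backward h.invariant hT h0 fun r hr => ?_, fun h0 => ?_⟩
  · exact (H (r, z.2) ⟨⟨by linarith [hr.1], by linarith [hr.2, hz.1.2]⟩, hz.2⟩).1 hr.1.ne'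
  · exact (H (r, z.2) ⟨⟨by linarith [hr.1, hz.1.1], by linarith [hr.2]⟩, hz.2⟩).1 hr.2.ne
  · rw [h0, φ.map_zero_apply]; exact mem_filling_iff_of_mem_crossSet hT

/-- The filling near a point off the section. -/
lemma IsCrossSection.eventually_mem_filling_of_pos (h : IsCrossSection φ Γ σ c) (j : ι) {s₀ t₀ : ℝ}
    (η : ℝ) (hs₀ : s₀ ∈ Ioo (-1 : ℝ) 1) (ht₀ : 0 < t₀)
    (hno : ∀ r ∈ Ioc 0 t₀, φ r (σ j s₀) ∉ crossSet σ) :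
    ∀ᶠ z : ℝ × ℝ in 𝓝 0, (φ z.1 (φ t₀ (σ j (s₀ + η * z.2))) ∈ filling φ Γ σ δ ↔
        σ j (s₀ + η * z.2) ∈ thinSet φ Γ σ δ ∪ Γ) := by
  have hsI := Ioo_subset_Icc_self hs₀
  obtain ⟨κ₁, hκ₁, H₁⟩ := Metric.eventually_nhds_iff_ball.1 (h.eventually_notMem j hsI)
  have hcT : ContinuousAt (fun r : ℝ => φ r (σ j s₀)) t₀ :=
    (φ.continuous continuous_id continuous_const).continuousAt
  obtain ⟨κ₂, hκ₂, H₂⟩ := Metric.eventually_nhds_iff_ball.1 (hcT.eventually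
    (h.isClosed_crossSet.isOpen_compl.mem_nhds (hno t₀ ⟨ht₀, le_rfl⟩)))
  have e8 : ∀ᶠ s in 𝓝 s₀, ∀ r ∈ Icc (κ₁ / 2) (t₀ + κ₂ / 2), φ r (σ j s) ∉ crossSet σ := by
    refine isCompact_Icc.eventually_forall_of_forall_eventually fun r hr => ?_
    have hc : ContinuousAt (fun z : ℝ × ℝ => φ z.2 (σ j z.1)) (s₀, r) :=
      ContinuousAt.comp (f := Prod.swap) (x := (s₀, r))
        (h.continuousAt_flow j r hsI) continuous_swap.continuousAt
    refine hc.eventually (h.isClosed_crossSet.isOpen_compl.mem_nhds ?_)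
    rcases le_or_gt r t₀ with hr' | hr'
    · exact hno r ⟨by linarith [hr.1], hr'⟩
    · refine H₂ r ?_
      rw [Metric.mem_ball, Real.dist_eq, abs_of_pos (by linarith)]
      linarith [hr.2]
  have e1 : ∀ᶠ s in 𝓝 s₀, s ∈ Ioo (-1 : ℝ) 1 := Ioo_mem_nhds hs₀.1 hs₀.2
  have e2 : ∀ᶠ s in 𝓝 s₀, |s - s₀| < κ₁ := by
    filter_upwards [Metric.ball_mem_nhds s₀ hκ₁] with s hs using hs
  have hsn : Filter.Tendsto (fun z : ℝ × ℝ => s₀ + η * z.2) (𝓝 0) (𝓝 s₀) :=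
    (continuous_snd.tendsto _).comp (tendsto_param s₀ η)
  have e3 : ∀ᶠ z : ℝ × ℝ in 𝓝 0, |z.1| < min t₀ (κ₂ / 2) := by
    have : ContinuousAt (fun z : ℝ × ℝ => |z.1|) 0 := by fun_prop
    exact this.eventually_lt continuousAt_const (by simpa using ⟨ht₀, hκ₂⟩)
  filter_upwards [hsn.eventually e8, hsn.eventually e1, hsn.eventually e2, e3]
    with z hz8 hz1 hz2 hz3
  rw [lt_min_iff, abs_lt, abs_lt] at hz3
  rw [← φ.map_add]
  refine mem_filling_iff_of_forward h.invariant (mem_crossSet j (Ioo_subset_Icc_self hz1))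
    (by linarith [hz3.1.1]) fun r hr => ?_
  by_cases hr1 : r < κ₁
  · refine H₁ (r, s₀ + η * z.2) ?_ hr.1.ne'
    rw [Metric.mem_ball, Prod.dist_eq, max_lt_iff, Real.dist_eq, Real.dist_eq]
    refine ⟨?_, hz2⟩
    dsimp only
    rw [sub_zero, abs_of_pos hr.1]; exact hr1
  · exact hz8 r ⟨by linarith, by linarith [hr.2, hz3.2.2]⟩

/-! #### Edges -/

/-- A thin gap through which orbits enter the filling. -/
structure IsOutEdge (φ : Flow ℝ S) (Γ : Set S) (σ : ι → ℝ → S) (δ : ℝ) (j : ι) (s η w : ℝ) :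
    Prop where
  thin : IsThinGap φ Γ σ δ j s η w
  notMem : ∀ u ∈ Ioo 0 w, σ j (s + η * u) ∉ thinSet φ.reverse Γ σ δ

lemma IsOutEdge.flip {j : ι} {s η w : ℝ} (h : IsOutEdge φ Γ σ δ j s η w) :
    IsOutEdge φ Γ σ δ j (s + η * w) (-η) w := by
  refine ⟨h.thin.flip, fun u hu => ?_⟩
  rw [show s + η * w + -η * u = s + η * (w - u) by ring]
  exact h.notMem _ ⟨by linarith [hu.2], by linarith [hu.1]⟩

/-- Backward thinness is constant along an open gap, so its failure at one point makes it fail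
throughout the gap. -/
lemma IsCrossSection.exists_isOutEdge (h : IsCrossSection φ Γ σ c) {j : ι} {a : ℝ}
    (ha : a ∈ Icc (-1 : ℝ) 1) (hΓ : σ j a ∉ Γ) (hA : σ j a ∈ thinSet φ Γ σ δ)
    (hB : σ j a ∉ thinSet φ.reverse Γ σ δ) :
    ∃ s η w, IsOutEdge φ Γ σ δ j s η w ∧ ∃ u ∈ Ioo 0 w, s + η * u = a := by
  obtain ⟨i, s, η, w, hg, u, hu, e⟩ := hA
  obtain ⟨rfl, rfl⟩ := h.inj (Ioo_subset_Icc_self (hg.gap.param_mem hu)) ha e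
  have hu' : u ∈ Ioo 0 w := by
    refine ⟨lt_of_le_of_ne hu.1 ?_, lt_of_le_of_ne hu.2 ?_⟩
    · rintro rfl; exact hΓ (by simpa using hg.gap.start_inv)
    · rintro rfl; exact hΓ hg.gap.last_inv
  refine ⟨s, η, w, ⟨hg, fun v hv hmem => hB ?_⟩, u, hu', rfl⟩
  refine h.reverse.thinSet_of_segment
    (Ioo_subset_Icc_self (hg.gap.param_mem (Ioo_subset_Icc_self hv))) (fun r hr => ?_) hmem
  have hconv : ∃ x ∈ Ioo 0 w, s + η * x = r := by
    have h1 := hu'.1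
    have h2 := hu'.2
    have h3 := hv.1
    have h4 := hv.2
    refine ⟨η * (r - s), ?_, ?_⟩
    · rcases hg.gap.sign with rfl | rfl <;> rcases mem_uIcc.1 hr with hr | hr <;>
        constructor <;> linarith [hr.1, hr.2]
    · rcases hg.gap.sign with rfl | rfl <;> ring
  obtain ⟨x, hx, rfl⟩ := hconv
  exact hg.gap.notMem x hx

lemma eventually_zero_of_sides {p : ℝ → Prop} {ρ₁ ρ₂ : ℝ} (h₁ : 0 < ρ₁) (h₂ : 0 < ρ₂)
    (H₁ : ∀ u ∈ Ioo 0 ρ₁, p u) (H₂ : ∀ u ∈ Ioo 0 ρ₂, p (-u)) (h0 : p 0) :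
    ∀ᶠ z : ℝ × ℝ in 𝓝 0, p z.2 := by
  have : ∀ᶠ x : ℝ in 𝓝 0, p x := by
    filter_upwards [Ioo_mem_nhds (neg_lt_zero.2 h₂) h₁] with x hx
    rcases lt_trichotomy x 0 with h | rfl | h
    · have := H₂ (-x) ⟨by linarith, by linarith [hx.1]⟩
      rwa [neg_neg] at this
    · exact h0
    · exact H₁ x ⟨h, hx.2⟩
  exact (continuous_snd.tendsto (0 : ℝ × ℝ)).eventually this

/-- `Γ` accumulates from the side opposite to a gap, and on such a side the section is filled near
the point. -/
lemma IsGap.side_filled (h : IsCrossSection φ Γ σ c) (hδ : 0 < δ) {j : ι} {s η w : ℝ}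
    (hs : s ∈ Ioo (-1 : ℝ) 1) (hη : η = 1 ∨ η = -1) (hfr : σ j s ∈ frontier Γ) (hw : 0 < w)
    (hno : ∀ u ∈ Ioo 0 w, σ j (s + η * u) ∉ Γ) :
    ∃ ρ > 0, ∀ u ∈ Ioo 0 ρ, σ j (s + η * (-u)) ∈ thinSet φ Γ σ δ ∪ Γ := by
  have hη' : -η = 1 ∨ -η = -1 := by rcases hη with rfl | rfl <;> simp
  obtain ⟨ρ, hρ, H⟩ := h.exists_filled_side hδ hs hη' hfr
    (h.accumulates_of_gap_side hs hη (h.isClosed.frontier_subset hfr) hw hno)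
  refine ⟨ρ, hρ, fun u hu => ?_⟩
  have := H u hu
  rwa [neg_mul_comm] at this

/-- Near an end of the edge three quarters of the flow box are filled: all of it after the arc, and
before the arc the side away from the gap, where `Γ` accumulates. The remaining quarter lies before
the arc and over the gap. -/
lemma IsOutEdge.model_start (h : IsCrossSection φ Γ σ c) (hδ : 0 < δ) {j : ι} {s η w : ℝ}
    (he : IsOutEdge φ Γ σ δ j s η w) :
    IsModel φ (interior (filling φ Γ σ δ))ᶜ (fun x => σ j (s + η * x)) (Iic 0) (Ici 0) := by
  have hg := he.thin.gap
  have hfr := hg.start_mem_frontier h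
  have hb := h.isFlowBox j hg.start_mem hg.sign 0
  simp only [φ.map_zero_apply] at hb
  obtain ⟨ρ₁, hρ₁, H₁⟩ := IsGap.side_filled h hδ hg.start_mem hg.sign hfr hg.pos hg.notMem
  obtain ⟨ρ₂, hρ₂, H₂⟩ := IsGap.side_filled h.reverse hδ hg.start_mem hg.sign hfr hg.pos hg.notMem
  have hs0 : σ j (s + η * 0) ∈ Γ := by simpa using hg.start_inv
  have hA : ∀ᶠ z : ℝ × ℝ in 𝓝 0, σ j (s + η * z.2) ∈ thinSet φ Γ σ δ ∪ Γ :=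
    eventually_zero_of_sides (p := fun x => σ j (s + η * x) ∈ thinSet φ Γ σ δ ∪ Γ) hg.pos hρ₁
      (fun u hu => Or.inl ⟨j, s, η, w, he.thin, u, Ioo_subset_Icc_self hu, rfl⟩) H₁ (Or.inr hs0)
  have hB : ∀ᶠ z : ℝ × ℝ in 𝓝 0,
      (σ j (s + η * z.2) ∈ thinSet φ.reverse Γ σ δ ∪ Γ ↔ ¬ 0 < z.2) := by
    refine eventually_zero_of_sides (p := fun x =>
      (σ j (s + η * x) ∈ thinSet φ.reverse Γ σ δ ∪ Γ ↔ ¬ 0 < x)) hg.pos hρ₂ (fun u hu => ?_)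
      (fun u hu => ?_) ?_
    · refine iff_of_false ?_ (not_not.2 hu.1)
      rintro (h' | h')
      · exact he.notMem u hu h'
      · exact hg.notMem u hu h'
    · exact iff_of_true (H₂ u hu) (by linarith [hu.1])
    · exact iff_of_true (Or.inr hs0) (lt_irrefl _)
  have := hb.isModel (K := filling φ Γ σ δ) (P := Iio 0) (Q := Ioi 0) (by
    filter_upwards [hA, hB, h.eventually_mem_filling j η hg.start_mem] with z hzA hzB hz
    rcases lt_trichotomy z.1 0 with h0 | h0 | h0
    · rw [hz.2.1 h0, hzB]; simp [h0]
    · rw [hz.2.2 h0]; simp [hzA, h0]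
    · rw [hz.1 h0]; simp [hzA, h0.le])
  rwa [closure_Iio, closure_Ioi] at this

/-- Over the open gap the strip begins at the arc, and no strip arrives there. -/
lemma IsOutEdge.model_mid (h : IsCrossSection φ Γ σ c) {j : ι} {s η w u : ℝ}
    (he : IsOutEdge φ Γ σ δ j s η w) (hu : u ∈ Ioo 0 w) :
    IsModel φ (interior (filling φ Γ σ δ))ᶜ (fun x => σ j (s + η * (u + x))) (Iic 0) univ := by
  have hg := he.thin.gap
  have hp := hg.param_mem (Ioo_subset_Icc_self hu)
  have hb := h.isFlowBox j hp hg.sign 0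
  simp only [φ.map_zero_apply] at hb
  have hev : ∀ᶠ z : ℝ × ℝ in 𝓝 0, u + z.2 ∈ Ioo 0 w := by
    have : Filter.Tendsto (fun z : ℝ × ℝ => u + z.2) (𝓝 0) (𝓝 u) := by
      have : Continuous (fun z : ℝ × ℝ => u + z.2) := by fun_prop
      simpa using this.tendsto 0
    exact this.eventually (Ioo_mem_nhds hu.1 hu.2)
  have := hb.isModel (K := filling φ Γ σ δ) (P := Iio 0) (Q := univ) (by
    filter_upwards [hev, h.eventually_mem_filling j η hp] with z hzu hz
    rw [show s + η * u + η * z.2 = s + η * (u + z.2) by ring] at hz ⊢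
    have hA : σ j (s + η * (u + z.2)) ∈ thinSet φ Γ σ δ ∪ Γ :=
      Or.inl ⟨j, s, η, w, he.thin, _, Ioo_subset_Icc_self hzu, rfl⟩
    have hB : σ j (s + η * (u + z.2)) ∉ thinSet φ.reverse Γ σ δ ∪ Γ := by
      rintro (h' | h')
      · exact he.notMem _ hzu h'
      · exact hg.notMem _ hzu h'
    rcases lt_trichotomy z.1 0 with h0 | h0 | h0
    · rw [hz.2.1 h0]; simp only [hB]; simp [h0]
    · rw [hz.2.2 h0]; simp [hA, h0]
    · rw [hz.1 h0]; simp [hA, h0.le])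
  rw [closure_Iio, closure_univ] at this
  simpa only [show ∀ x, s + η * (u + x) = s + η * u + η * x from fun x => by ring] using this

/-- A point of `Γ` near which `S₀` is one side of the orbit. -/
def IsLobePoint (φ : Flow ℝ S) (Γ S₀ : Set S) (p : S) : Prop :=
  p ∈ Γ ∧ ∃ g : ℝ → S, g 0 = p ∧ IsModel φ S₀ g univ (Ici 0)

lemma frontier_cases_aux {K : Set S} (hK : IsClosed K) {p : S} (hp : p ∈ frontier (interior K)ᶜ) :
    p ∈ K ∧ p ∉ interior K := by
  rw [frontier_compl, isOpen_interior.frontier_eq] at hp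
  exact ⟨hK.closure_interior_subset hp.1, hp.2⟩

/-- Either `Γ` accumulates from both sides, or there is a side in the complement of `Γ`. -/
lemma accumulates_or_gap_side (j : ι) (s₀ : ℝ) :
    (∀ η : ℝ, (η = 1 ∨ η = -1) → ∀ ρ > 0, ∃ u ∈ Ioo 0 ρ, σ j (s₀ + η * u) ∈ Γ) ∨
      ∃ η w : ℝ, (η = 1 ∨ η = -1) ∧ 0 < w ∧ ∀ u ∈ Ioo 0 w, σ j (s₀ + η * u) ∉ Γ := by
  by_contra! hcon
  obtain ⟨⟨η, hη, ρ, hρ, H⟩, H'⟩ := hcon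
  obtain ⟨u, hu, hm⟩ := H' η ρ hη hρ
  exact H u hu hm

/-- The side of a point of the frontier towards a gap is thin or not as a whole. -/
lemma IsCrossSection.side_dichotomy (h : IsCrossSection φ Γ σ c) {j : ι} {s₀ η w : ℝ}
    (hs₀ : s₀ ∈ Ioo (-1 : ℝ) 1) (hη : η = 1 ∨ η = -1) (hw : 0 < w)
    (hno : ∀ u ∈ Ioo 0 w, σ j (s₀ + η * u) ∉ Γ) :
    ∃ ρ > 0, ρ ≤ w ∧ ((∀ u ∈ Ioo 0 ρ, σ j (s₀ + η * u) ∈ thinSet φ Γ σ δ) ∨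
      ∀ u ∈ Ioo 0 ρ, σ j (s₀ + η * u) ∉ thinSet φ Γ σ δ ∪ Γ) := by
  obtain ⟨ρ₂, hρ₂, H₂⟩ := exists_param_radius hs₀
  refine ⟨min w ρ₂, lt_min hw hρ₂, min_le_left _ _, ?_⟩
  by_cases hex : ∃ u ∈ Ioo 0 (min w ρ₂), σ j (s₀ + η * u) ∈ thinSet φ Γ σ δ
  · left
    obtain ⟨u, hu, hmem⟩ := hex
    intro v hv
    refine h.thinSet_of_segment (Ioo_subset_Icc_self (H₂ η u hη ?_)) (fun r hr => ?_) hmem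
    · rw [abs_of_pos hu.1]; exact hu.2.trans_le (min_le_right _ _)
    · have hu1 := hu.1
      have hv1 := hv.1
      have hu2 := hu.2.trans_le (min_le_left _ _)
      have hv2 := hv.2.trans_le (min_le_left _ _)
      have : σ j (s₀ + η * (η * (r - s₀))) ∉ Γ := hno _ (by
        rcases hη with rfl | rfl <;> rcases mem_uIcc.1 hr with hr | hr <;>
          constructor <;> linarith [hr.1, hr.2])
      rwa [show s₀ + η * (η * (r - s₀)) = r by rcases hη with rfl | rfl <;> ring] at this
  · right
    push Not at hex
    rintro u hu (h' | h')
    · exact hex u hu h'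
    · exact hno u ⟨hu.1, hu.2.trans_le (min_le_left _ _)⟩ h'

/-- All points near `s₀` on the given side lie in one gap, since no point of `Γ` separates them. The
closed arc of this gap contains the limit point. -/
lemma IsOutEdge.mem_gapArc_of_limit (h : IsCrossSection φ Γ σ c) {j : ι} {s₀ η ρ : ℝ}
    (hs₀ : s₀ ∈ Ioo (-1 : ℝ) 1) (hη : η = 1 ∨ η = -1) (hρ : 0 < ρ)
    (hΓ : ∀ u ∈ Ioo 0 ρ, σ j (s₀ + η * u) ∉ Γ)
    (hA : ∀ u ∈ Ioo 0 ρ, σ j (s₀ + η * u) ∈ thinSet φ Γ σ δ)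
    (hB : ∀ u ∈ Ioo 0 ρ, σ j (s₀ + η * u) ∉ thinSet φ.reverse Γ σ δ ∪ Γ) :
    ∃ s ξ w, IsOutEdge φ Γ σ δ j s ξ w ∧ σ j s₀ ∈ gapArc σ j s ξ w := by
  obtain ⟨ρ₂, hρ₂, H₂⟩ := exists_param_radius hs₀
  set r := min ρ ρ₂ with hr
  have hr0 : 0 < r := lt_min hρ hρ₂
  have hr1 : r ≤ ρ := min_le_left _ _
  have hr2 : r ≤ ρ₂ := min_le_right _ _
  have hmem : r / 2 ∈ Ioo 0 ρ := ⟨by linarith, by linarith⟩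
  obtain ⟨s, ξ, w, he, u, hu, e⟩ := h.exists_isOutEdge (j := j) (a := s₀ + η * (r / 2))
    (Ioo_subset_Icc_self (H₂ η _ hη (by rw [abs_of_pos hmem.1]; linarith)))
    (hΓ _ hmem) (hA _ hmem) (fun h' => hB _ hmem (Or.inl h'))
  have hv : ∀ v ∈ Ioo 0 (r / 2), ξ * (s₀ + η * v - s) ∈ Ioo 0 w := by
    intro v hv
    refine he.thin.gap.mem_Ioo_of_segment hu fun x hx => ?_
    rw [e] at hx
    have hv1 := hv.1
    have hv2 := hv.2
    have : σ j (s₀ + η * (η * (x - s₀))) ∉ Γ := hΓ _ (by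
      rcases hη with rfl | rfl <;> rcases mem_uIcc.1 hx with hx | hx <;>
        constructor <;> linarith [hx.1, hx.2])
    rwa [show s₀ + η * (η * (x - s₀)) = x by rcases hη with rfl | rfl <;> ring] at this
  have hlim : Filter.Tendsto (fun v : ℝ => ξ * (s₀ + η * v - s)) (𝓝[>] 0)
      (𝓝 (ξ * (s₀ - s))) := by
    have : Continuous (fun v : ℝ => ξ * (s₀ + η * v - s)) := by fun_prop
    have := this.tendsto 0
    rw [mul_zero, add_zero] at this
    exact this.mono_left nhdsWithin_le_nhds
  have hev : ∀ᶠ v in 𝓝[>] (0 : ℝ), ξ * (s₀ + η * v - s) ∈ Icc 0 w := by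
    filter_upwards [Ioo_mem_nhdsGT (half_pos hr0)] with v hv'
    exact Ioo_subset_Icc_self (hv v hv')
  refine ⟨s, ξ, w, he, ξ * (s₀ - s), isClosed_Icc.mem_of_tendsto hlim hev, ?_⟩
  dsimp only
  congr 1
  rcases he.thin.gap.sign with rfl | rfl <;> ring

/-- If `Γ` accumulates from both sides the point is interior to the filling. Otherwise one side is a
gap side, the other one is filled both forwards and backwards, and only the thinness of the gap side
in the two time directions remains to be decided. -/
lemma IsCrossSection.frontier_cases_on (h : IsCrossSection φ Γ σ c) (hδ : 0 < δ) {j : ι}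
    {s₀ : ℝ} (hs₀ : s₀ ∈ Ioo (-1 : ℝ) 1) (hfr : σ j s₀ ∈ frontier Γ)
    (h_int : σ j s₀ ∉ interior (filling φ Γ σ δ)) :
    (∃ s η w, IsOutEdge φ Γ σ δ j s η w ∧ σ j s₀ ∈ gapArc σ j s η w) ∨
    (∃ s η w, IsOutEdge φ.reverse Γ σ δ j s η w ∧ σ j s₀ ∈ gapArc σ j s η w) ∨
    IsLobePoint φ Γ (interior (filling φ Γ σ δ))ᶜ (σ j s₀) := by
  have hΓ0 := h.isClosed.frontier_subset hfr
  have hΓ0' : ∀ η : ℝ, σ j (s₀ + η * 0) ∈ Γ := by simpa using hΓ0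
  have hfull : ∀ η : ℝ, (η = 1 ∨ η = -1) → ¬ ((∀ᶠ z : ℝ × ℝ in 𝓝 0, σ j (s₀ + η * z.2) ∈
      thinSet φ Γ σ δ ∪ Γ) ∧ (∀ᶠ z : ℝ × ℝ in 𝓝 0, σ j (s₀ + η * z.2) ∈
      thinSet φ.reverse Γ σ δ ∪ Γ)) := by
    rintro η hη ⟨hA, hB⟩
    have hb := h.isFlowBox j hs₀ hη 0
    simp only [φ.map_zero_apply] at hb
    have := hb.mem_interior (K := filling φ Γ σ δ) (by
      filter_upwards [hA, hB, h.eventually_mem_filling j η hs₀] with z hzA hzB hz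
      rcases lt_trichotomy z.1 0 with h0 | h0 | h0
      · exact (hz.2.1 h0).2 hzB
      · exact (hz.2.2 h0).2 (Or.inl hzA)
      · exact (hz.1 h0).2 hzA)
    exact h_int (by simpa using this)
  rcases accumulates_or_gap_side (Γ := Γ) (σ := σ) j s₀ with hacc | ⟨η, w, hη, hw, hno⟩
  · exfalso
    refine hfull 1 (Or.inl rfl) ⟨?_, ?_⟩
    · obtain ⟨ρ₁, h₁, H₁⟩ := h.exists_filled_side hδ hs₀ (Or.inl rfl) hfr (hacc 1 (Or.inl rfl))
      obtain ⟨ρ₂, h₂, H₂⟩ := h.exists_filled_side hδ hs₀ (Or.inr rfl) hfr (hacc (-1) (Or.inr rfl))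
      exact eventually_zero_of_sides h₁ h₂ H₁
        (fun u hu => by have := H₂ u hu; rwa [neg_mul_comm] at this) (Or.inr (hΓ0' 1))
    · obtain ⟨ρ₁, h₁, H₁⟩ := h.reverse.exists_filled_side hδ hs₀ (Or.inl rfl) hfr
        (hacc 1 (Or.inl rfl))
      obtain ⟨ρ₂, h₂, H₂⟩ := h.reverse.exists_filled_side hδ hs₀ (Or.inr rfl) hfr
        (hacc (-1) (Or.inr rfl))
      exact eventually_zero_of_sides h₁ h₂ H₁
        (fun u hu => by have := H₂ u hu; rwa [neg_mul_comm] at this) (Or.inr (hΓ0' 1))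
  obtain ⟨ρ₁, hρ₁, H₁⟩ := IsGap.side_filled h hδ hs₀ hη hfr hw hno
  obtain ⟨ρ₂, hρ₂, H₂⟩ := IsGap.side_filled h.reverse hδ hs₀ hη hfr hw hno
  obtain ⟨ρ₃, hρ₃, hρ₃w, H₃⟩ := h.side_dichotomy (δ := δ) hs₀ hη hw hno
  obtain ⟨ρ₄, hρ₄, hρ₄w, H₄⟩ := h.reverse.side_dichotomy (δ := δ) hs₀ hη hw hno
  set r := min ρ₃ ρ₄ with hr
  have hr0 : 0 < r := lt_min hρ₃ hρ₄
  have hr3 : ∀ u ∈ Ioo 0 r, u ∈ Ioo 0 ρ₃ := fun u hu => ⟨hu.1, hu.2.trans_le (min_le_left _ _)⟩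
  have hr4 : ∀ u ∈ Ioo 0 r, u ∈ Ioo 0 ρ₄ := fun u hu => ⟨hu.1, hu.2.trans_le (min_le_right _ _)⟩
  have hrw : ∀ u ∈ Ioo 0 r, σ j (s₀ + η * u) ∉ Γ := fun u hu =>
    hno u ⟨hu.1, (hr3 u hu).2.trans_le hρ₃w⟩
  -- The cases in order: thin both ways (interior), only forwards (exit edge), only backwards (entry
  -- edge), neither way (lobe).
  rcases H₃ with H₃ | H₃ <;> rcases H₄ with H₄ | H₄
  · exact absurd ⟨eventually_zero_of_sides
      (p := fun x => σ j (s₀ + η * x) ∈ thinSet φ Γ σ δ ∪ Γ) hρ₃ hρ₁ (fun u hu => Or.inl (H₃ u hu)) H₁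
      (Or.inr (hΓ0' η)), eventually_zero_of_sides
      (p := fun x => σ j (s₀ + η * x) ∈ thinSet φ.reverse Γ σ δ ∪ Γ) hρ₄ hρ₂
      (fun u hu => Or.inl (H₄ u hu)) H₂
      (Or.inr (hΓ0' η))⟩ (hfull η hη)
  · left
    exact IsOutEdge.mem_gapArc_of_limit h hs₀ hη hr0 hrw (fun u hu => H₃ u (hr3 u hu))
      (fun u hu => H₄ u (hr4 u hu))
  · right; left
    exact IsOutEdge.mem_gapArc_of_limit h.reverse hs₀ hη hr0 hrw (fun u hu => H₄ u (hr4 u hu))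
      (fun u hu => by rw [reverse_reverse]; exact H₃ u (hr3 u hu))
  · right; right
    have hb := h.isFlowBox j hs₀ hη 0
    simp only [φ.map_zero_apply] at hb
    refine ⟨hΓ0, fun x => σ j (s₀ + η * x), by simp, ?_⟩
    have hside : ∀ (A : Set S) (ρ ρ' : ℝ), 0 < ρ → 0 < ρ' →
        (∀ u ∈ Ioo 0 ρ, σ j (s₀ + η * u) ∉ A ∪ Γ) →
        (∀ u ∈ Ioo 0 ρ', σ j (s₀ + η * (-u)) ∈ A ∪ Γ) →
        ∀ᶠ z : ℝ × ℝ in 𝓝 0, (σ j (s₀ + η * z.2) ∈ A ∪ Γ ↔ ¬ 0 < z.2) := by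
      intro A ρ ρ' hρ hρ' h1 h2
      refine eventually_zero_of_sides (p := fun x => (σ j (s₀ + η * x) ∈ A ∪ Γ ↔ ¬ 0 < x)) hρ hρ'
        (fun u hu => iff_of_false (h1 u hu) (not_not.2 hu.1))
        (fun u hu => iff_of_true (h2 u hu) (by linarith [hu.1]))
        (iff_of_true (Or.inr (hΓ0' η)) (lt_irrefl _))
    have := hb.isModel (K := filling φ Γ σ δ) (P := univ) (Q := Ioi 0) (by
      filter_upwards [hside _ ρ₃ ρ₁ hρ₃ hρ₁ H₃ H₁, hside _ ρ₄ ρ₂ hρ₄ hρ₂ H₄ H₂,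
        h.eventually_mem_filling j η hs₀] with z hzA hzB hz
      rcases lt_trichotomy z.1 0 with h0 | h0 | h0
      · rw [hz.2.1 h0, hzB]; simp
      · rw [hz.2.2 h0, hzA, hzB]; simp
      · rw [hz.1 h0, hzA]; simp)
    rwa [closure_univ, closure_Ioi] at this

/-- Between two hits of the section the filling is a product along the orbit, determined by forward
thinness at the last hit. So there are no corners off the section. -/
lemma IsCrossSection.frontier_cases_off (h : IsCrossSection φ Γ σ c) (hδ : 0 < δ) {j : ι}
    {s₀ t₀ : ℝ} (hs₀ : s₀ ∈ Ioo (-1 : ℝ) 1) (hfr : σ j s₀ ∈ frontier Γ) (ht₀ : 0 < t₀)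
    (hno : ∀ r ∈ Ioc 0 t₀, φ r (σ j s₀) ∉ crossSet σ)
    (h_int : φ t₀ (σ j s₀) ∉ interior (filling φ Γ σ δ)) :
    IsLobePoint φ Γ (interior (filling φ Γ σ δ))ᶜ (φ t₀ (σ j s₀)) := by
  have hΓ0 := h.isClosed.frontier_subset hfr
  have hΓ0' : ∀ η : ℝ, σ j (s₀ + η * 0) ∈ Γ := by simpa using hΓ0
  have hfull : ∀ η : ℝ, (η = 1 ∨ η = -1) → ¬ (∀ᶠ z : ℝ × ℝ in 𝓝 0, σ j (s₀ + η * z.2) ∈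
      thinSet φ Γ σ δ ∪ Γ) := by
    rintro η hη hA
    have hb := h.isFlowBox j hs₀ hη t₀
    have := hb.mem_interior (K := filling φ Γ σ δ) (by
      filter_upwards [hA, h.eventually_mem_filling_of_pos j η hs₀ ht₀ hno] with z hzA hz
      exact hz.2 hzA)
    exact h_int (by simpa using this)
  rcases accumulates_or_gap_side (Γ := Γ) (σ := σ) j s₀ with hacc | ⟨η, w, hη, hw, hnoΓ⟩
  · exfalso
    refine hfull 1 (Or.inl rfl) ?_
    obtain ⟨ρ₁, h₁, H₁⟩ := h.exists_filled_side hδ hs₀ (Or.inl rfl) hfr (hacc 1 (Or.inl rfl))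
    obtain ⟨ρ₂, h₂, H₂⟩ := h.exists_filled_side hδ hs₀ (Or.inr rfl) hfr (hacc (-1) (Or.inr rfl))
    exact eventually_zero_of_sides h₁ h₂ H₁
      (fun u hu => by have := H₂ u hu; rwa [neg_mul_comm] at this) (Or.inr (hΓ0' 1))
  obtain ⟨ρ₁, hρ₁, H₁⟩ := IsGap.side_filled h hδ hs₀ hη hfr hw hnoΓ
  obtain ⟨ρ₃, hρ₃, -, H₃⟩ := h.side_dichotomy (δ := δ) hs₀ hη hw hnoΓ
  rcases H₃ with H₃ | H₃
  · exact absurd (eventually_zero_of_sides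
      (p := fun x => σ j (s₀ + η * x) ∈ thinSet φ Γ σ δ ∪ Γ) hρ₃ hρ₁ (fun u hu => Or.inl (H₃ u hu)) H₁
      (Or.inr (hΓ0' η))) (hfull η hη)
  refine ⟨h.invariant t₀ hΓ0, fun x => φ t₀ (σ j (s₀ + η * x)), by simp, ?_⟩
  have hside : ∀ᶠ z : ℝ × ℝ in 𝓝 0,
      (σ j (s₀ + η * z.2) ∈ thinSet φ Γ σ δ ∪ Γ ↔ ¬ 0 < z.2) :=
    eventually_zero_of_sides (p := fun x => (σ j (s₀ + η * x) ∈ thinSet φ Γ σ δ ∪ Γ ↔ ¬ 0 < x))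
      hρ₃ hρ₁ (fun u hu => iff_of_false (H₃ u hu) (not_not.2 hu.1))
      (fun u hu => iff_of_true (H₁ u hu) (by linarith [hu.1]))
      (iff_of_true (Or.inr (hΓ0' η)) (lt_irrefl _))
  have := (h.isFlowBox j hs₀ hη t₀).isModel (K := filling φ Γ σ δ) (P := univ) (Q := Ioi 0) (by
    filter_upwards [hside, h.eventually_mem_filling_of_pos j η hs₀ ht₀ hno] with z hzA hz
    rw [hz, hzA]; simp)
  rwa [closure_univ, closure_Ioi] at this

/-- A boundary point in `Γ` is treated on the section, or transported from its last hit. A boundary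
point off `Γ` must lie on the section, because the strips are open away from their ends and from
`Γ`. -/
lemma IsCrossSection.frontier_cases (h : IsCrossSection φ Γ σ c) (hΓ : IsCompact Γ) (hδ : 0 < δ)
    {p : S} (hp : p ∈ frontier (interior (filling φ Γ σ δ))ᶜ) :
    (∃ j s η w, IsOutEdge φ Γ σ δ j s η w ∧ p ∈ gapArc σ j s η w) ∨
    (∃ j s η w, IsOutEdge φ.reverse Γ σ δ j s η w ∧ p ∈ gapArc σ j s η w) ∨
    IsLobePoint φ Γ (interior (filling φ Γ σ δ))ᶜ p := by
  obtain ⟨hpK, h_int⟩ := frontier_cases_aux (h.isCompact_filling hΓ).isClosed hp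
  by_cases hpΓ : p ∈ Γ
  · have hfr : p ∈ frontier Γ := by
      rw [h.isClosed.frontier_eq]
      exact ⟨hpΓ, fun h' => h_int (interior_mono subset_union_left h')⟩
    by_cases hT : p ∈ crossSet σ
    · obtain ⟨j, s₀, hs₀, rfl⟩ := h.exists_param hfr hT
      rcases h.frontier_cases_on hδ hs₀ hfr h_int with h' | h' | h'
      · exact Or.inl ⟨j, h'⟩
      · exact Or.inr (Or.inl ⟨j, h'⟩)
      · exact Or.inr (Or.inr h')
    · obtain ⟨t, ht, -, hq, hno⟩ := h.reverse.exists_first_hit hfr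
      rw [Flow.reverse_apply] at hq
      obtain ⟨j, s₀, hs₀, e⟩ := h.exists_param (invariant_frontier h.invariant (-t) hfr) hq
      have hpe : φ t (σ j s₀) = p := by rw [e, flow_apply_neg]
      refine Or.inr (Or.inr ?_)
      rw [← hpe] at h_int ⊢
      refine h.frontier_cases_off hδ hs₀ (e ▸ invariant_frontier h.invariant (-t) hfr) ht
        (fun r hr => ?_) h_int
      rcases eq_or_lt_of_le hr.2 with rfl | hlt
      · rw [hpe]; exact hT
      · have := hno (t - r) ⟨by linarith, by linarith [hr.1]⟩
        rwa [Flow.reverse_apply, ← hpe, ← φ.map_add, show -(t - r) + t = r by ring] at this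
  · have hW : ∀ᶠ x in 𝓝 p, x ∉ Γ := h.isClosed.isOpen_compl.mem_nhds hpΓ
    have hnear : ∀ (φ : Flow ℝ S) {j : ι} {s : ℝ}, IsCrossSection φ Γ σ c →
        s ∈ Ioo (-1 : ℝ) 1 → σ j s ∉ Γ →
        σ j s ∈ thinSet φ Γ σ δ → ∀ᶠ z : ℝ × ℝ in 𝓝 0, σ j (s + 1 * z.2) ∈ thinSet φ Γ σ δ := by
      intro φ j s h hs hsΓ hA
      have hev : ∀ᶠ r in 𝓝 s, σ j r ∉ Γ :=
        (h.continuousAt j (Ioo_subset_Icc_self hs)).eventually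
          (h.isClosed.isOpen_compl.mem_nhds hsΓ)
      obtain ⟨ρ, hρ, H⟩ := Metric.eventually_nhds_iff.1 hev
      have hsn : Filter.Tendsto (fun z : ℝ × ℝ => s + 1 * z.2) (𝓝 0) (𝓝 s) :=
        (continuous_snd.tendsto _).comp (tendsto_param s 1)
      filter_upwards [hsn.eventually (Metric.ball_mem_nhds s hρ)] with z hz
      refine h.thinSet_of_segment (Ioo_subset_Icc_self hs) (fun r hr => H ?_) hA
      rw [Real.dist_eq]
      exact (abs_sub_left_of_mem_uIcc hr).trans_lt hz
    -- a point of the section off `Γ`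
    have hon : ∀ {j : ι} {s : ℝ}, s ∈ Ioo (-1 : ℝ) 1 → σ j s = p →
        (∃ s η w, IsOutEdge φ Γ σ δ j s η w ∧ p ∈ gapArc σ j s η w) ∨
        (∃ s η w, IsOutEdge φ.reverse Γ σ δ j s η w ∧ p ∈ gapArc σ j s η w) := by
      rintro j s hs rfl
      have hs' := Ioo_subset_Icc_self hs
      have hmem := (mem_filling_iff_of_mem_crossSet (mem_crossSet j hs')).1 hpK
      by_cases hA : σ j s ∈ thinSet φ Γ σ δ
      · by_cases hB : σ j s ∈ thinSet φ.reverse Γ σ δ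
        · exfalso
          have hb := h.isFlowBox j hs (Or.inl rfl) 0
          simp only [φ.map_zero_apply] at hb
          have := hb.mem_interior (K := filling φ Γ σ δ) (by
            filter_upwards [hnear φ h hs hpΓ hA, hnear _ h.reverse hs hpΓ hB,
              h.eventually_mem_filling j 1 hs] with z hzA hzB hz
            rcases lt_trichotomy z.1 0 with h0 | h0 | h0
            · exact (hz.2.1 h0).2 (Or.inl hzB)
            · exact (hz.2.2 h0).2 (Or.inl (Or.inl hzA))
            · exact (hz.1 h0).2 (Or.inl hzA))
          exact h_int (by simpa using this)
        · left
          obtain ⟨s', η, w, he, u, hu, e⟩ := h.exists_isOutEdge hs' hpΓ hA hB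
          exact ⟨s', η, w, he, u, Ioo_subset_Icc_self hu, by dsimp only; rw [e]⟩
      · right
        have hB : σ j s ∈ thinSet φ.reverse Γ σ δ := by
          rcases hmem with (h' | h') | (h' | h')
          · exact absurd h' hA
          · exact absurd h' hpΓ
          · exact h'
          · exact absurd h' hpΓ
        obtain ⟨s', η, w, he, u, hu, e⟩ := h.reverse.exists_isOutEdge hs' hpΓ hB
          (by rwa [reverse_reverse])
        exact ⟨s', η, w, he, u, Ioo_subset_Icc_self hu, by dsimp only; rw [e]⟩
    have hon' : ∀ {j : ι} {s : ℝ}, s ∈ Ioo (-1 : ℝ) 1 → σ j s = p →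
        (∃ j s η w, IsOutEdge φ Γ σ δ j s η w ∧ p ∈ gapArc σ j s η w) ∨
        (∃ j s η w, IsOutEdge φ.reverse Γ σ δ j s η w ∧ p ∈ gapArc σ j s η w) ∨
        IsLobePoint φ Γ (interior (filling φ Γ σ δ))ᶜ p := by
      intro j s hs e
      rcases hon hs e with h' | h'
      · exact Or.inl ⟨j, h'⟩
      · exact Or.inr (Or.inl ⟨j, h'⟩)
    rcases hpK with hpK | ⟨x, hx, y, t, r, hn, hr0, hrt, e⟩
    · exact absurd hpK hpΓ
    rcases eq_or_lt_of_le hr0 with rfl | hr0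
    · obtain ⟨j, s, hs, e'⟩ := IsCrossSection.exists_param_of_thinSet hx
      exact hon' hs (by rw [e', ← e, φ.map_zero_apply])
    rcases eq_or_lt_of_le hrt with rfl | hrt
    · obtain ⟨j, s, hs, e'⟩ := IsCrossSection.exists_param_of_thinSet (hn.mem_thinSet_reverse hx)
      exact hon' hs (by rw [e', ← e, hn.2.2.1])
    · exfalso
      obtain ⟨j, s, hs, rfl⟩ := IsCrossSection.exists_param_of_thinSet hx
      have hsΓ : σ j s ∉ Γ := by rwa [← e, invariant_iff h.invariant] at hpΓ
      -- Strictly between the two ends of a strip and off `Γ`, the neighbouring orbits also start in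
      -- the thin gap, so the filling is a neighbourhood.
      have := (h.isFlowBox j hs (Or.inl rfl) r).mem_interior (K := filling φ Γ σ δ) (by
        filter_upwards [hnear φ h hs hsΓ hx, h.eventually_mem_filling_of_pos j 1 hs hr0
          (fun r' hr' => hn.2.2.2.2.2 r' ⟨hr'.1, hr'.2.trans_lt hrt⟩)] with z hzA hz
        exact hz.2 (Or.inl hzA))
      exact h_int (by simpa [e] using this)

end Models

end Dumbbell

namespace Dumbbell

/-! ### The boundary as a topological curve: charts, corners and lobes. -/

section Boundary

variable {S : Type*} [TopologicalSpace S]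

/-- The quadrant `t ≤ 0 ≤ x` is carried to the half-plane `0 ≤ v` by this homeomorphism. -/
def quadrantHomeomorph : ℝ × ℝ ≃ₜ ℝ × ℝ where
  -- The minimum of `-t` and `x` is nonnegative exactly on the quadrant. With the difference of the
  -- two, it determines both: each equals the minimum plus a positive part of the difference.
  toFun z := (-z.1 - z.2, min (-z.1) z.2)
  invFun z := (-(z.2 + max z.1 0), z.2 + max (-z.1) 0)
  left_inv z := by
    ext
    · dsimp only
      rcases le_total (-z.1) z.2 with h | h
      · rw [min_eq_left h, max_eq_right (by linarith)]; ring
      · rw [min_eq_right h, max_eq_left (by linarith)]; ring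
    · dsimp only
      rcases le_total (-z.1) z.2 with h | h
      · rw [min_eq_left h, max_eq_left (by linarith)]; ring
      · rw [min_eq_right h, max_eq_right (by linarith)]; ring
  right_inv z := by
    ext
    · dsimp only
      rcases le_total z.1 0 with h | h
      · rw [max_eq_right h, max_eq_left (by linarith)]; ring
      · rw [max_eq_left h, max_eq_right (by linarith)]; ring
    · dsimp only
      rcases le_total z.1 0 with h | h
      · rw [max_eq_right h, max_eq_left (by linarith), min_eq_left (by linarith)]; ring
      · rw [max_eq_left h, max_eq_right (by linarith), min_eq_right (by linarith)]; ring
  continuous_toFun := by fun_prop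
  continuous_invFun := by fun_prop

/-- The half-plane `t ≤ 0` is carried to the half-plane `0 ≤ v` by this homeomorphism. -/
def quarterTurnHomeomorph : ℝ × ℝ ≃ₜ ℝ × ℝ where
  toFun z := (z.2, -z.1)
  invFun z := (-z.2, z.1)
  left_inv z := by simp
  right_inv z := by simp
  continuous_toFun := by fun_prop
  continuous_invFun := by fun_prop

variable {φ : Flow ℝ S} {S₀ : Set S} {g : ℝ → S} {P Q : Set ℝ}

lemma IsModel.exists_chart (h : IsModel φ S₀ g P Q) (H : ℝ × ℝ ≃ₜ ℝ × ℝ)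
    (hH : ∀ z : ℝ × ℝ, 0 ≤ (H z).2 ↔ z.1 ∈ P ∧ z.2 ∈ Q) :
    ∃ e : OpenPartialHomeomorph S (ℝ × ℝ), g 0 ∈ e.source ∧ ∀ q ∈ e.source, q ∈ S₀ ↔
      0 ≤ (e q).2 := by
  obtain ⟨ρ, hρ, e, hs, he, hS⟩ := h
  have h0 : (0 : ℝ × ℝ) ∈ e.source := by rw [hs]; simp [hρ]
  have hsrc : (e.symm.trans H.toOpenPartialHomeomorph).source = e.target := by
    ext q; simp
  refine ⟨e.symm.trans H.toOpenPartialHomeomorph, ?_, fun q hq => ?_⟩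
  · rw [hsrc, show g 0 = e 0 by rw [he 0 h0]; simp]; exact e.map_source h0
  · rw [hsrc] at hq
    change _ ↔ 0 ≤ (H (e.symm q)).2
    rw [hH, ← hS _ (e.map_target hq), e.right_inv hq]

lemma IsModel.frontier_iff (h : IsModel φ S₀ g P Q) :
    ∃ ρ > 0, ∃ e : OpenPartialHomeomorph (ℝ × ℝ) S, e.source = Ioo (-ρ) ρ ×ˢ Ioo (-ρ) ρ ∧
      (∀ z ∈ e.source, e z = φ z.1 (g z.2)) ∧
      (∀ z ∈ e.source, e z ∈ S₀ ↔ z.1 ∈ P ∧ z.2 ∈ Q) ∧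
      ∀ z ∈ e.source, e z ∈ frontier S₀ ↔ z ∈ frontier (P ×ˢ Q) := by
  obtain ⟨ρ, hρ, e, hs, he, hS⟩ := h
  refine ⟨ρ, hρ, e, hs, he, hS, fun z hz => ?_⟩
  have him : e.IsImage (P ×ˢ Q) S₀ := fun z hz => hS z hz
  exact him.frontier.apply_mem_iff hz

lemma frontier_half : frontier ((univ : Set ℝ) ×ˢ Ici (0 : ℝ)) = {z | z.2 = 0} := by
  rw [frontier_univ_prod_eq, frontier_Ici]; ext z; simp

lemma mem_frontier_quadrant {z : ℝ × ℝ} : z ∈ frontier (Iic (0 : ℝ) ×ˢ Ici (0 : ℝ)) ↔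
    (z.1 = 0 ∧ 0 ≤ z.2) ∨ (z.1 ≤ 0 ∧ z.2 = 0) := by
  rw [(isClosed_Iic.prod isClosed_Ici).frontier_eq, interior_prod_eq, interior_Iic, interior_Ici]
  simp only [mem_sdiff, mem_prod, mem_Iic, mem_Ici, mem_Iio, mem_Ioi, not_and, not_lt]
  constructor
  · rintro ⟨⟨h1, h2⟩, h3⟩
    rcases eq_or_lt_of_le h1 with h | h
    · exact Or.inl ⟨h, h2⟩
    · exact Or.inr ⟨h1, le_antisymm (h3 h) h2⟩
  · rintro (⟨h1, h2⟩ | ⟨h1, h2⟩)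
    · exact ⟨⟨h1.le, h2⟩, fun h => absurd h1 h.ne⟩
    · exact ⟨⟨h1, h2.ge⟩, fun _ => h2.le⟩

lemma frontier_lower : frontier (Iic (0 : ℝ) ×ˢ (univ : Set ℝ)) = {z | z.1 = 0} := by
  rw [frontier_prod_univ_eq, frontier_Iic]; ext z; simp

lemma IsLobePoint.exists_flow_mem {Γ : Set S} {p : S} (h : IsLobePoint φ Γ S₀ p) :
    ∃ ρ > 0, ∀ t, |t| < ρ → φ t p ∈ frontier S₀ := by
  obtain ⟨-, g, rfl, hm⟩ := h
  obtain ⟨ρ, hρ, e, hs, he, -, hF⟩ := hm.frontier_iff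
  refine ⟨ρ, hρ, fun t ht => ?_⟩
  have hz : ((t, 0) : ℝ × ℝ) ∈ e.source := by
    rw [hs]; exact ⟨abs_lt.1 ht, by linarith, hρ⟩
  have := (hF _ hz).2 (by rw [frontier_half]; rfl)
  rwa [he _ hz] at this

/-- The orbit follows the boundary before the corner and leaves it right afterwards. This asymmetry
distinguishes exit corners, entry corners and lobe points. -/
lemma IsModel.exists_flow_mem_of_quadrant (hm : IsModel φ S₀ g (Iic 0) (Ici 0)) :
    ∃ ρ > 0, (∀ t ∈ Ioc (-ρ) 0, φ t (g 0) ∈ frontier S₀) ∧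
      ∀ t ∈ Ioo 0 ρ, φ t (g 0) ∉ frontier S₀ := by
  obtain ⟨ρ, hρ, e, hs, he, -, hF⟩ := hm.frontier_iff
  have key : ∀ t, |t| < ρ → (φ t (g 0) ∈ frontier S₀ ↔ t ≤ 0) := by
    intro t ht
    have hz : ((t, 0) : ℝ × ℝ) ∈ e.source := by
      rw [hs]; exact ⟨abs_lt.1 ht, by linarith, hρ⟩
    rw [show φ t (g 0) = e (t, 0) from (he _ hz).symm, hF _ hz, mem_frontier_quadrant]
    constructor
    · rintro (h | h)
      · exact h.1.le
      · exact h.1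
    · intro h; exact Or.inr ⟨h, rfl⟩
  refine ⟨ρ, hρ, fun t ht => (key t ?_).2 ht.2, fun t ht h => ?_⟩
  · rw [abs_lt]; exact ⟨ht.1, by linarith [ht.2]⟩
  · have := (key t (by rw [abs_of_pos ht.1]; exact ht.2)).1 h
    linarith [ht.1]

lemma mem_frontier_of_isModel_lower (hm : IsModel φ S₀ g (Iic 0) univ) : g 0 ∈ frontier S₀ := by
  obtain ⟨ρ, hρ, e, hs, he, -, hF⟩ := hm.frontier_iff
  have hz : (0 : ℝ × ℝ) ∈ e.source := by rw [hs]; simp [hρ]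
  have := (hF 0 hz).2 (by rw [frontier_lower]; rfl)
  rw [he 0 hz] at this
  simpa using this

variable [T2Space S] {ι : Type*} [Finite ι] {Γ : Set S} {σ : ι → ℝ → S} {c δ : ℝ}

/-- The complement of the interior of the filling. -/
def outer (φ : Flow ℝ S) (Γ : Set S) (σ : ι → ℝ → S) (δ : ℝ) : Set S :=
  (interior (filling φ Γ σ δ))ᶜ

lemma outer_reverse : outer φ.reverse Γ σ δ = outer φ Γ σ δ := by
  rw [outer, filling_reverse, outer]

lemma isClosed_outer : IsClosed (outer φ Γ σ δ) := isOpen_interior.isClosed_compl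

/-- Each case of `frontier_cases` gives a half-plane or a quadrant in a flow box, and a
homeomorphism of the plane straightens it to `0 ≤ v`. -/
lemma IsCrossSection.isSurfaceWithBoundary (h : IsCrossSection φ Γ σ c) (hΓ : IsCompact Γ)
    (hδ : 0 < δ) : IsSurfaceWithBoundary (outer φ Γ σ δ) := by
  have hquad : ∀ z : ℝ × ℝ, 0 ≤ (quadrantHomeomorph z).2 ↔ z.1 ∈ Iic 0 ∧ z.2 ∈ Ici 0 := fun z => by
    change 0 ≤ min (-z.1) z.2 ↔ _
    rw [le_min_iff, neg_nonneg]; rfl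
  have hturn : ∀ z : ℝ × ℝ, 0 ≤ (quarterTurnHomeomorph z).2 ↔ z.1 ∈ Iic 0 ∧ z.2 ∈ univ :=
    fun z => by
      change 0 ≤ -z.1 ↔ _
      rw [neg_nonneg]; simp
  have hedge : ∀ ψ : Flow ℝ S, IsCrossSection ψ Γ σ c → ∀ {j s η w p},
      IsOutEdge ψ Γ σ δ j s η w → p ∈ gapArc σ j s η w →
      ∃ e : OpenPartialHomeomorph S (ℝ × ℝ), p ∈ e.source ∧ ∀ q ∈ e.source,
        q ∈ outer ψ Γ σ δ ↔ 0 ≤ (e q).2 := by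
    rintro ψ h j s η w p he ⟨u, hu, rfl⟩
    rcases eq_or_lt_of_le hu.1 with rfl | h0
    · exact (he.model_start h hδ).exists_chart _ hquad
    rcases eq_or_lt_of_le hu.2 with rfl | h1
    · obtain ⟨e, h1, h2⟩ := (he.flip.model_start h hδ).exists_chart _ hquad
      exact ⟨e, by simpa using h1, h2⟩
    · obtain ⟨e, h1, h2⟩ := (he.model_mid h ⟨h0, h1⟩).exists_chart _ hturn
      exact ⟨e, by simpa using h1, h2⟩
  refine ⟨isClosed_outer, fun p hp => ?_⟩
  rcases h.frontier_cases hΓ hδ hp with ⟨j, s, η, w, he, hpe⟩ | ⟨j, s, η, w, he, hpe⟩ |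
    ⟨-, g, rfl, hm⟩
  · exact hedge φ h he hpe
  · obtain ⟨e, h1, h2⟩ := hedge _ h.reverse he hpe
    rw [outer_reverse] at h2
    exact ⟨e, h1, h2⟩
  · exact hm.exists_chart (Homeomorph.refl _) (fun z => by simp)

/-! #### Corners -/

/-- The endpoints of the edges through which orbits enter the filling. -/
def IsCorner (φ : Flow ℝ S) (Γ : Set S) (σ : ι → ℝ → S) (δ : ℝ) (p : S) : Prop :=
  ∃ j s η w, IsOutEdge φ Γ σ δ j s η w ∧ σ j s = p

lemma IsCorner.mem {p : S} (hp : IsCorner φ Γ σ δ p) : p ∈ Γ := by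
  obtain ⟨j, s, η, w, he, rfl⟩ := hp
  exact he.thin.gap.start_inv

lemma IsCorner.exists_flow_mem (h : IsCrossSection φ Γ σ c) (hδ : 0 < δ) {p : S}
    (hp : IsCorner φ Γ σ δ p) :
    ∃ ρ > 0, (∀ t ∈ Ioc (-ρ) 0, φ t p ∈ frontier (outer φ Γ σ δ)) ∧
      ∀ t ∈ Ioo 0 ρ, φ t p ∉ frontier (outer φ Γ σ δ) := by
  obtain ⟨j, s, η, w, he, rfl⟩ := hp
  have := (he.model_start h hδ).exists_flow_mem_of_quadrant
  rwa [mul_zero, add_zero] at this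

lemma IsCorner.exists_flow_mem_reverse (h : IsCrossSection φ Γ σ c) (hδ : 0 < δ) {p : S}
    (hp : IsCorner φ.reverse Γ σ δ p) :
    ∃ ρ > 0, (∀ t ∈ Ico 0 ρ, φ t p ∈ frontier (outer φ Γ σ δ)) ∧
      ∀ t ∈ Ioo (-ρ) 0, φ t p ∉ frontier (outer φ Γ σ δ) := by
  obtain ⟨ρ, hρ, h1, h2⟩ := hp.exists_flow_mem h.reverse hδ
  rw [outer_reverse] at h1 h2
  refine ⟨ρ, hρ, fun t ht => ?_, fun t ht => ?_⟩
  · simpa [Flow.reverse_apply] using h1 (-t) ⟨by linarith [ht.2], by linarith [ht.1]⟩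
  · simpa [Flow.reverse_apply] using h2 (-t) ⟨by linarith [ht.2], by linarith [ht.1]⟩

lemma IsOutEdge.gapArc_subset (h : IsCrossSection φ Γ σ c) (hδ : 0 < δ) {j : ι} {s η w : ℝ}
    (he : IsOutEdge φ Γ σ δ j s η w) : gapArc σ j s η w ⊆ frontier (outer φ Γ σ δ) := by
  have hc : ∀ p, IsCorner φ Γ σ δ p → p ∈ frontier (outer φ Γ σ δ) := fun p hp => by
    obtain ⟨ρ, hρ, h1, -⟩ := hp.exists_flow_mem h hδ
    simpa using h1 0 ⟨by linarith, le_rfl⟩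
  rintro _ ⟨u, hu, rfl⟩
  rcases eq_or_lt_of_le hu.1 with rfl | h0
  · exact hc _ ⟨j, s, η, w, he, by simp⟩
  rcases eq_or_lt_of_le hu.2 with rfl | h1
  · exact hc _ ⟨j, _, _, _, he.flip, rfl⟩
  · have := mem_frontier_of_isModel_lower (he.model_mid h ⟨h0, h1⟩)
    rwa [add_zero] at this

lemma IsCorner.mem_frontier_outer (h : IsCrossSection φ Γ σ c) (hδ : 0 < δ) {p : S}
    (hp : IsCorner φ Γ σ δ p) : p ∈ frontier (outer φ Γ σ δ) := by
  obtain ⟨ρ, hρ, h1, -⟩ := hp.exists_flow_mem h hδ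
  simpa using h1 0 ⟨by linarith, le_rfl⟩

lemma IsOutEdge.isCorner_of_mem {j : ι} {s η w : ℝ} (he : IsOutEdge φ Γ σ δ j s η w) {p : S}
    (hp : p ∈ gapArc σ j s η w) (hΓ : p ∈ Γ) : IsCorner φ Γ σ δ p := by
  obtain ⟨u, hu, rfl⟩ := hp
  rcases eq_or_lt_of_le hu.1 with rfl | h0
  · exact ⟨j, s, η, w, he, by simp⟩
  rcases eq_or_lt_of_le hu.2 with rfl | h1
  · exact ⟨j, _, _, _, he.flip, rfl⟩
  · exact absurd hΓ (he.thin.gap.notMem u ⟨h0, h1⟩)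

lemma IsCrossSection.corner_cases (h : IsCrossSection φ Γ σ c) (hΓ : IsCompact Γ) (hδ : 0 < δ)
    {p : S} (hp : p ∈ frontier (outer φ Γ σ δ)) (hpΓ : p ∈ Γ) :
    IsCorner φ Γ σ δ p ∨ IsCorner φ.reverse Γ σ δ p ∨ IsLobePoint φ Γ (outer φ Γ σ δ) p := by
  rcases h.frontier_cases hΓ hδ hp with ⟨j, s, η, w, he, hpe⟩ | ⟨j, s, η, w, he, hpe⟩ | hl
  · exact Or.inl (he.isCorner_of_mem hpe hpΓ)
  · exact Or.inr (Or.inl (he.isCorner_of_mem hpe hpΓ))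
  · exact Or.inr (Or.inr hl)

lemma IsCorner.not_isLobePoint (h : IsCrossSection φ Γ σ c) (hδ : 0 < δ) {p : S}
    (hp : IsCorner φ Γ σ δ p) : ¬ IsLobePoint φ Γ (outer φ Γ σ δ) p := by
  intro hl
  obtain ⟨ρ, hρ, -, h2⟩ := hp.exists_flow_mem h hδ
  obtain ⟨ρ', hρ', h'⟩ := hl.exists_flow_mem
  have hm : 0 < min ρ ρ' := lt_min hρ hρ'
  refine h2 (min ρ ρ' / 2) ⟨by linarith, by linarith [min_le_left ρ ρ']⟩ (h' _ ?_)
  rw [abs_of_pos (by linarith)]; linarith [min_le_right ρ ρ']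

lemma IsCorner.not_isLobePoint_reverse (h : IsCrossSection φ Γ σ c) (hδ : 0 < δ) {p : S}
    (hp : IsCorner φ.reverse Γ σ δ p) : ¬ IsLobePoint φ Γ (outer φ Γ σ δ) p := by
  intro hl
  obtain ⟨ρ, hρ, -, h2⟩ := hp.exists_flow_mem_reverse h hδ
  obtain ⟨ρ', hρ', h'⟩ := hl.exists_flow_mem
  have hm : 0 < min ρ ρ' := lt_min hρ hρ'
  refine h2 (-(min ρ ρ' / 2)) ⟨by linarith [min_le_left ρ ρ'], by linarith⟩ (h' _ ?_)
  rw [abs_neg, abs_of_pos (by linarith)]; linarith [min_le_right ρ ρ']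

lemma IsCorner.not_reverse (h : IsCrossSection φ Γ σ c) (hδ : 0 < δ) {p : S}
    (hp : IsCorner φ Γ σ δ p) : ¬ IsCorner φ.reverse Γ σ δ p := by
  intro hp'
  obtain ⟨ρ, hρ, -, h2⟩ := hp.exists_flow_mem h hδ
  obtain ⟨ρ', hρ', h', -⟩ := hp'.exists_flow_mem_reverse h hδ
  have hm : 0 < min ρ ρ' := lt_min hρ hρ'
  exact h2 (min ρ ρ' / 2) ⟨by linarith, by linarith [min_le_left ρ ρ']⟩
    (h' _ ⟨by linarith, by linarith [min_le_right ρ ρ']⟩)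

/-- In the flow box at the corner, the section lies at time `0` and the outer set on the gap side,
where there is no further point of `Γ`. The corner is thus isolated in this intersection, which
leads to finiteness. -/
lemma IsOutEdge.eventually_eq (h : IsCrossSection φ Γ σ c) (hδ : 0 < δ) {j : ι} {s η w : ℝ}
    (he : IsOutEdge φ Γ σ δ j s η w) :
    ∀ᶠ y in 𝓝 (σ j s), y ∈ frontier (outer φ Γ σ δ) ∩ Γ ∩ crossSet σ → y = σ j s := by
  have hg := he.thin.gap
  obtain ⟨ρ, hρ, e, hs, hev, hS, -⟩ := (he.model_start h hδ).frontier_iff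
  have h0 : (0 : ℝ × ℝ) ∈ e.source := by rw [hs]; simp [hρ]
  have e0 : e 0 = σ j s := by rw [hev 0 h0]; simp
  rw [← e0, ← e.map_nhds_eq h0, Filter.eventually_map]
  filter_upwards [e.open_source.mem_nhds h0, (tendsto_param s η).eventually
    (h.eventually_notMem j (Ioo_subset_Icc_self hg.start_mem)),
    (continuous_snd.tendsto (0 : ℝ × ℝ)).eventually (gt_mem_nhds hg.pos)] with z hz hzT hzw hy
  have hz1 : z.1 = 0 := by
    by_contra hne
    have := hzT hne
    rw [← hev z hz] at this
    exact this hy.2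
  have hval : e z = σ j (s + η * z.2) := by rw [hev z hz, hz1, φ.map_zero_apply]
  have hmem : 0 ≤ z.2 :=
    ((hS z hz).1 (isClosed_outer.frontier_subset hy.1.1)).2
  rcases eq_or_lt_of_le hmem with h2 | h2
  · rw [e0, hval, ← h2]; simp
  · have := hg.notMem z.2 ⟨h2, hzw⟩
    rw [← hval] at this
    exact absurd hy.1.2 this

/-- The boundary of the filling crosses the section in finitely many points of `Γ`. -/
lemma IsCrossSection.finite_frontier_inter (h : IsCrossSection φ Γ σ c) (hΓ : IsCompact Γ)
    (hδ : 0 < δ) : (frontier (outer φ Γ σ δ) ∩ Γ ∩ crossSet σ).Finite := by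
  set D := frontier (outer φ Γ σ δ) ∩ Γ ∩ crossSet σ with hD
  have hDc : IsCompact D :=
    h.isCompact_crossSet.inter_left (isClosed_frontier.inter h.isClosed)
  have key : ∀ p ∈ D, ∀ᶠ y in 𝓝 p, y ∈ D → y = p := by
    intro p hp
    have hcor : ∀ ψ : Flow ℝ S, IsCrossSection ψ Γ σ c → outer ψ Γ σ δ = outer φ Γ σ δ →
        IsCorner ψ Γ σ δ p → ∀ᶠ y in 𝓝 p, y ∈ D → y = p := by
      rintro ψ h hψ ⟨j, s, η, w, he, rfl⟩
      have := he.eventually_eq h hδ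
      rwa [hψ] at this
    rcases h.corner_cases hΓ hδ hp.1.1 hp.1.2 with hc | hc | ⟨-, g, rfl, hm⟩
    · exact hcor φ h rfl hc
    · exact hcor _ h.reverse outer_reverse hc
    · obtain ⟨j, s, hs, hjs⟩ := mem_iUnion.1 hp.2
      obtain ⟨ρ, hρ, e, hsrc, hev, -, hF⟩ := hm.frontier_iff
      have h0 : (0 : ℝ × ℝ) ∈ e.source := by rw [hsrc]; simp [hρ]
      have e0 : e 0 = g 0 := by rw [hev 0 h0]; simp
      have htd : Filter.Tendsto (fun z : ℝ × ℝ => (z.1, s)) (𝓝 0) (𝓝 (0, s)) := by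
        have : Continuous (fun z : ℝ × ℝ => (z.1, s)) := by fun_prop
        simpa using this.tendsto 0
      rw [← e0, ← e.map_nhds_eq h0, Filter.eventually_map]
      filter_upwards [e.open_source.mem_nhds h0, htd.eventually (h.eventually_notMem j hs)]
        with z hz hzT hy
      have hz2 : z.2 = 0 := by
        have := (hF z hz).1 hy.1.1
        rwa [frontier_half] at this
      have hz1 : z.1 = 0 := by
        by_contra hne
        have := hzT hne
        rw [hjs, ← hz2, ← hev z hz] at this
        exact this hy.2
      rw [show z = 0 from Prod.ext hz1 hz2]
  -- A compact set all of whose points are isolated is finite.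
  obtain ⟨t, hcov⟩ := hDc.elim_nhds_subcover' (fun x _ => {y | y ∈ D → y = x}) key
  refine (t.finite_toSet.image Subtype.val).subset fun y hy => ?_
  obtain ⟨x, hx, hyx⟩ := mem_iUnion₂.1 (hcov hy)
  exact ⟨x, hx, (hyx hy).symm⟩

lemma IsCrossSection.mem_frontier_of_mem (h : IsCrossSection φ Γ σ c) (hΓ : IsCompact Γ) {p : S}
    (hp : p ∈ Γ) (hpF : p ∈ frontier (outer φ Γ σ δ)) : p ∈ frontier Γ := by
  rw [h.isClosed.frontier_eq]
  exact ⟨hp, fun hi => (frontier_cases_aux (h.isCompact_filling hΓ).isClosed hpF).2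
    (interior_mono subset_union_left hi)⟩

/-- The boundary follows a forward orbit up to an exit corner. -/
lemma IsCrossSection.exists_lobe (h : IsCrossSection φ Γ σ c) (hΓ : IsCompact Γ) (hδ : 0 < δ)
    (hper : ∀ x ∈ Γ, ∀ T : ℝ, 0 < T → φ T x ≠ x) {p : S} (hpΓ : p ∈ Γ)
    (hp : ∃ ρ > 0, ∀ t ∈ Ico 0 ρ, φ t p ∈ frontier (outer φ Γ σ δ)) :
    ∃ l > 0, IsCorner φ Γ σ δ (φ l p) ∧
      (∀ t ∈ Ioo 0 l, IsLobePoint φ Γ (outer φ Γ σ δ) (φ t p)) ∧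
      ∀ t ∈ Icc 0 l, φ t p ∈ frontier (outer φ Γ σ δ) := by
  obtain ⟨ρ, hρ, hρF⟩ := hp
  set F := frontier (outer φ Γ σ δ) with hF
  have hpF : ∀ t, φ t p ∈ Γ := fun t => h.invariant t hpΓ
  have hpfr : p ∈ frontier Γ :=
    h.mem_frontier_of_mem hΓ hpΓ (by simpa using hρF 0 ⟨le_rfl, hρ⟩)
  -- An orbit that stayed in the boundary would meet the section near every positive integer time,
  -- always in the finite set of `finite_frontier_inter`. Two equal hits at different times would
  -- make the orbit periodic.
  have hexit : ∃ t, 0 ≤ t ∧ φ t p ∉ F := by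
    by_contra! hcon
    have hit : ∀ n : ℕ, ∃ t : ℝ, |t - (n + 1)| < 1 / 2 ∧ φ t p ∈ crossSet σ := fun n => by
      obtain ⟨t, ht, i, s, hs, e⟩ := h.hits _ (invariant_frontier h.invariant (n + 1) hpfr)
      refine ⟨t + (n + 1), by simpa using ht, ?_⟩
      rw [φ.map_add, e]; exact mem_crossSet i (Ioo_subset_Icc_self hs)
    choose t ht hT using hit
    have hmaps : ∀ n, φ (t n) p ∈ F ∩ Γ ∩ crossSet σ := fun n => by
      refine ⟨⟨hcon _ ?_, hpF _⟩, hT n⟩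
      have := (abs_lt.1 (ht n)).1
      have hn : (0 : ℝ) ≤ n := n.cast_nonneg
      linarith
    have hni : ¬ Function.Injective fun n => φ (t n) p := fun hinj =>
      Set.infinite_range_of_injective hinj
        ((h.finite_frontier_inter hΓ hδ).subset (range_subset_iff.2 hmaps))
    obtain ⟨m, n, hmn, hne⟩ : ∃ m n, φ (t m) p = φ (t n) p ∧ m ≠ n := by
      simpa [Function.Injective] using hni
    have hlt : ∀ m n : ℕ, m < n → φ (t m) p ≠ φ (t n) p := by
      intro m n hmn heq
      have h1 := (abs_lt.1 (ht m)).2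
      have h2 := (abs_lt.1 (ht n)).1
      have h3 : (m : ℝ) + 1 ≤ n := by exact_mod_cast hmn
      refine hper p hpΓ (t n - t m) (by linarith) ?_
      rw [show t n - t m = -t m + t n by ring, φ.map_add, ← heq, flow_neg_apply]
    rcases lt_or_gt_of_ne hne with h' | h'
    · exact hlt m n h' hmn
    · exact hlt n m h' hmn.symm
  set E := {t : ℝ | 0 ≤ t ∧ φ t p ∉ F} with hE
  have hEb : BddBelow E := ⟨0, fun t ht => ht.1⟩
  have hEne : E.Nonempty := hexit
  set l := sInf E with hl
  have hlt : ∀ t, 0 ≤ t → t < l → φ t p ∈ F := fun t h0 ht => by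
    by_contra hcon
    exact absurd (csInf_le hEb ⟨h0, hcon⟩) (not_le.2 ht)
  have hlpos : 0 < l := by
    refine hρ.trans_le (le_csInf hEne fun t ht => ?_)
    by_contra hcon
    exact ht.2 (hρF t ⟨ht.1, not_le.1 hcon⟩)
  have hcont : Continuous fun t => φ t p := φ.continuous continuous_id continuous_const
  have hlF : φ l p ∈ F := by
    have hcl : IsClosed {t | φ t p ∈ F} := isClosed_frontier.preimage hcont
    have : l ∈ closure (Ioo 0 l) := by
      rw [closure_Ioo hlpos.ne]; exact ⟨hlpos.le, le_rfl⟩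
    exact hcl.closure_subset_iff.2 (fun t ht => hlt t ht.1.le ht.2) this
  have hle : ∀ t ∈ Icc 0 l, φ t p ∈ F := fun t ht => by
    rcases eq_or_lt_of_le ht.2 with htl | htl
    · rw [htl]; exact hlF
    · exact hlt t ht.1 htl
  -- no entry corner at positive times
  have hnoin : ∀ t ∈ Ioc 0 l, ¬ IsCorner φ.reverse Γ σ δ (φ t p) := by
    intro t ht hc
    obtain ⟨ρ', hρ', -, h2⟩ := hc.exists_flow_mem_reverse h hδ
    have hm : 0 < min ρ' t := lt_min hρ' ht.1
    refine h2 (-(min ρ' t / 2)) ⟨by linarith [min_le_left ρ' t], by linarith⟩ ?_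
    rw [← φ.map_add]
    exact hle _ ⟨by linarith [min_le_right ρ' t], by linarith [ht.2]⟩
  refine ⟨l, hlpos, ?_, fun t ht => ?_, hle⟩
  · rcases h.corner_cases hΓ hδ hlF (hpF l) with hc | hc | hc
    · exact hc
    · exact absurd hc (hnoin l ⟨hlpos, le_rfl⟩)
    · exfalso
      obtain ⟨ρ', hρ', h'⟩ := hc.exists_flow_mem
      -- Around a lobe point the orbit would stay in the boundary beyond `l`, contradicting that `l`
      -- is the infimum of the exit times.
      have : l + ρ' ≤ l := by
        refine le_csInf hEne fun t ht => ?_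
        by_contra hcon
        refine ht.2 ?_
        rcases lt_or_ge t l with h1 | h1
        · exact hlt t ht.1 h1
        · have := h' (t - l) (by rw [abs_of_nonneg (by linarith)]; linarith [not_le.1 hcon])
          rwa [← φ.map_add, sub_add_cancel] at this
      linarith
  · rcases h.corner_cases hΓ hδ (hlt t ht.1.le ht.2) (hpF t) with hc | hc | hc
    · exfalso
      obtain ⟨ρ', hρ', -, h2⟩ := hc.exists_flow_mem h hδ
      have hm : 0 < min ρ' (l - t) := lt_min hρ' (by linarith [ht.2])
      refine h2 (min ρ' (l - t) / 2) ⟨by linarith, by linarith [min_le_left ρ' (l - t)]⟩ ?_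
      rw [← φ.map_add]
      exact hlt _ (by linarith [ht.1]) (by linarith [min_le_right ρ' (l - t)])
    · exact absurd hc (hnoin t ⟨ht.1, ht.2.le⟩)
    · exact hc

/-! #### Opposite corners -/

/-- Gaps starting at one point in opposite directions are impossible, since `Γ` accumulates there
from the side away from a gap. In a given direction the gap ends at the first point of `Γ`.
Consequently a corner determines its edge. -/
lemma IsGap.unique (h : IsCrossSection φ Γ σ c) {i j : ι} {s η w s' η' w' : ℝ}
    (hg : IsGap Γ σ i s η w) (hg' : IsGap Γ σ j s' η' w') (e : σ i s = σ j s') :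
    i = j ∧ s = s' ∧ η = η' ∧ w = w' := by
  obtain ⟨rfl, rfl⟩ := h.inj (Ioo_subset_Icc_self hg.start_mem)
    (Ioo_subset_Icc_self hg'.start_mem) e
  have hη : η = η' := by
    by_contra hne
    have hneg : -η = η' := by
      rcases hg.sign with rfl | rfl <;> rcases hg'.sign with rfl | rfl <;> simp_all
    obtain ⟨u, hu, hm⟩ := h.accumulates_of_gap_side hg.start_mem hg.sign hg.start_inv hg.pos
      hg.notMem w' hg'.pos
    rw [hneg] at hm
    exact hg'.notMem u hu hm
  subst hη
  refine ⟨rfl, rfl, rfl, ?_⟩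
  rcases lt_trichotomy w w' with hlt | heq | hlt
  · exact absurd hg.last_inv (hg'.notMem w ⟨hg.pos, hlt⟩)
  · exact heq
  · exact absurd hg'.last_inv (hg.notMem w' ⟨hg'.pos, hlt⟩)

/-- Two closed gaps that meet are equal as sets. -/
lemma IsGap.eq_of_inter (h : IsCrossSection φ Γ σ c) {i j : ι} {s η w s' η' w' u u' : ℝ}
    (hg : IsGap Γ σ i s η w) (hg' : IsGap Γ σ j s' η' w') (hu : u ∈ Icc 0 w)
    (hu' : u' ∈ Icc 0 w') (e : σ i (s + η * u) = σ j (s' + η' * u')) :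
    (σ i s = σ j s' ∧ u = u') ∨ (σ i (s + η * w) = σ j s' ∧ u = w - u') := by
  obtain ⟨hij, hpar⟩ := h.inj (Ioo_subset_Icc_self (hg.param_mem hu))
    (Ioo_subset_Icc_self (hg'.param_mem hu')) e
  subst hij
  have hη0 : η ≠ 0 := by rcases hg.sign with h | h <;> rw [h] <;> norm_num
  -- it suffices that the gaps share a start
  have fin1 : σ i s = σ i s' → (σ i s = σ i s' ∧ u = u') := fun hs => by
    obtain ⟨-, rfl, rfl, rfl⟩ := hg.unique h hg' hs
    exact ⟨rfl, mul_left_cancel₀ hη0 (add_left_cancel hpar)⟩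
  have fin2 : σ i (s + η * w) = σ i s' → (σ i (s + η * w) = σ i s' ∧ u = w - u') := fun hs => by
    obtain ⟨-, rfl, rfl, rfl⟩ := hg.flip.unique h hg' hs
    refine ⟨rfl, ?_⟩
    have : η * u = η * (w - u') := by linarith
    exact mul_left_cancel₀ hη0 this
  by_cases hΓ : σ i (s + η * u) ∈ Γ
  · have hu0 : u = 0 ∨ u = w := by
      by_contra! hcon
      exact hg.notMem u ⟨lt_of_le_of_ne hu.1 hcon.1.symm, lt_of_le_of_ne hu.2 hcon.2⟩ hΓ
    have hu0' : u' = 0 ∨ u' = w' := by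
      by_contra! hcon
      rw [e] at hΓ
      exact hg'.notMem u' ⟨lt_of_le_of_ne hu'.1 hcon.1.symm, lt_of_le_of_ne hu'.2 hcon.2⟩ hΓ
    rcases hu0 with rfl | rfl <;> rcases hu0' with rfl | rfl
    · left; exact fin1 (by simpa using e)
    · right
      have h1 := hg.unique h hg'.flip (by simpa using e)
      refine fin2 ?_
      rw [h1.2.2.1, h1.2.2.2, h1.2.1]; congr 1; ring
    · right; exact fin2 (by simpa using e)
    · left
      have h1 := hg.flip.unique h hg'.flip e
      refine fin1 ?_
      have h2 : η = η' := neg_injective h1.2.2.1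
      have h3 := h1.2.1
      rw [h2, h1.2.2.2] at h3
      rw [add_right_cancel h3]
  · have hi : u ∈ Ioo 0 w := by
      refine ⟨lt_of_le_of_ne hu.1 ?_, lt_of_le_of_ne hu.2 ?_⟩
      · rintro rfl; exact hΓ (by simpa using hg.start_inv)
      · rintro rfl; exact hΓ hg.last_inv
    have hi' : u' ∈ Ioo 0 w' := by
      rw [e] at hΓ
      refine ⟨lt_of_le_of_ne hu'.1 ?_, lt_of_le_of_ne hu'.2 ?_⟩
      · rintro rfl; exact hΓ (by simpa using hg'.start_inv)
      · rintro rfl; exact hΓ hg'.last_inv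
    -- compare the starting points along the direction of the first gap
    have hcases : s = s' ∨ s + η * w = s' := by
      have h1 := hi.1
      have h2 := hi.2
      have h3 := hi'.1
      have h4 := hi'.2
      have A : ∀ x ∈ Ioo 0 w, s + η * x ≠ s' := fun x hx hx' =>
        hg.notMem x hx (hx' ▸ hg'.start_inv)
      have B : ∀ x ∈ Ioo 0 w', s' + η' * x ≠ s := fun x hx hx' =>
        hg'.notMem x hx (hx' ▸ hg.start_inv)
      have B' : ∀ x ∈ Ioo 0 w', s' + η' * x ≠ s + η * w := fun x hx hx' =>
        hg'.notMem x hx (hx' ▸ hg.last_inv)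
      by_contra! hcon
      rcases hg.sign with rfl | rfl <;> rcases hg'.sign with rfl | rfl
      · rcases lt_trichotomy s s' with hlt | heq | hgt
        · exact A (s' - s) ⟨by linarith, by linarith⟩ (by ring)
        · exact hcon.1 heq
        · exact B (s - s') ⟨by linarith, by linarith⟩ (by ring)
      · rcases lt_trichotomy (s + 1 * w) s' with hlt | heq | hgt
        · exact B' (s' - s - w) ⟨by linarith, by linarith⟩ (by ring)
        · exact hcon.2 heq
        · exact A (s' - s) ⟨by linarith, by linarith⟩ (by ring)
      · rcases lt_trichotomy (s + -1 * w) s' with hlt | heq | hgt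
        · exact A (s - s') ⟨by linarith, by linarith⟩ (by ring)
        · exact hcon.2 heq
        · exact B' (s - w - s') ⟨by linarith, by linarith⟩ (by ring)
      · rcases lt_trichotomy s s' with hlt | heq | hgt
        · exact B (s' - s) ⟨by linarith, by linarith⟩ (by ring)
        · exact hcon.1 heq
        · exact A (s - s') ⟨by linarith, by linarith⟩ (by ring)
    rcases hcases with hc | hc
    · left; exact fin1 (by rw [hc])
    · right; exact fin2 (by rw [hc])

end Boundary

end Dumbbell

namespace Dumbbell

/-! ### Combinatorics of circuits formed by arcs and two involutions. -/

section Circuits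

variable {S : Type*} [TopologicalSpace S]

/-- The concatenation of paths `f i : [0, 1] → S`, `i : ℤ`. -/
noncomputable def concat (f : ℤ → ℝ → S) (t : ℝ) : S := f ⌊t⌋ (Int.fract t)

lemma concat_add {f : ℤ → ℝ → S} (hf : ∀ i, f i 1 = f (i + 1) 0) (i : ℤ) {x : ℝ}
    (hx : x ∈ Icc (0 : ℝ) 1) : concat f (i + x) = f i x := by
  rcases eq_or_lt_of_le hx.2 with rfl | h1
  · have : ((i : ℝ) + 1) = ((i + 1 : ℤ) : ℝ) := by push_cast; rfl
    rw [concat, this, Int.floor_intCast, Int.fract_intCast, hf]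
  · have hfl : ⌊(i : ℝ) + x⌋ = i := by
      rw [Int.floor_eq_iff]; exact ⟨by linarith [hx.1], by linarith⟩
    rw [concat, Int.fract, hfl]; congr 1; ring

lemma continuous_concat {f : ℤ → ℝ → S} (hf : ∀ i, f i 1 = f (i + 1) 0)
    (hc : ∀ i, ContinuousOn (f i) (Icc 0 1)) : Continuous (concat f) := by
  have hlf : LocallyFinite fun i : ℤ => Icc (i : ℝ) (i + 1) := by
    intro x
    refine ⟨Ioo (x - 1) (x + 1), Ioo_mem_nhds (by linarith) (by linarith), ?_⟩
    refine (finite_Icc (⌊x⌋ - 2) (⌊x⌋ + 2)).subset ?_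
    rintro i ⟨y, hy, hy'⟩
    have h1 := Int.floor_le x
    have h2 := Int.lt_floor_add_one x
    have h3 : (i : ℝ) < ⌊x⌋ + 2 := by linarith [hy.1, hy'.2]
    have h4 : (⌊x⌋ : ℝ) - 2 < i := by linarith [hy.2, hy'.1]
    constructor
    · have : ⌊x⌋ - 2 < i := by exact_mod_cast h4
      exact this.le
    · have : i < ⌊x⌋ + 2 := by exact_mod_cast h3
      exact this.le
  refine hlf.continuous ?_ (fun i => isClosed_Icc) fun i => ?_
  · ext x
    simp only [mem_iUnion, mem_univ, iff_true]
    exact ⟨⌊x⌋, Int.floor_le x, (Int.lt_floor_add_one x).le⟩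
  · have : ContinuousOn (fun t : ℝ => f i (t - i)) (Icc i (i + 1)) :=
      (hc i).comp (by fun_prop) fun t ht => ⟨by linarith [ht.1], by linarith [ht.2]⟩
    refine this.congr fun t ht => ?_
    have := concat_add hf i (x := t - i) ⟨by linarith [ht.1], by linarith [ht.2]⟩
    rwa [add_sub_cancel] at this

/-- `F` is a union of arcs `L c`, `I c`, `O c`, where `I c` joins the starting points of `L c` and
`L (a c)`, and `O c` joins the endpoints of `L c` and `L (b c)`. -/
structure IsCircuitSystem {C : Type*} (F : Set S) (a b : C → C) (L I O : C → ℝ → S) : Prop where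
  a_inv : Function.Involutive a
  b_inv : Function.Involutive b
  a_ne : ∀ c, a c ≠ c
  b_ne : ∀ c, b c ≠ c
  contL : ∀ c, ContinuousOn (L c) (Icc 0 1)
  contI : ∀ c, ContinuousOn (I c) (Icc 0 1)
  contO : ∀ c, ContinuousOn (O c) (Icc 0 1)
  I_zero : ∀ c, I c 0 = L c 0
  I_flip : ∀ c x, I (a c) x = I c (1 - x)
  O_zero : ∀ c, O c 0 = L c 1
  O_flip : ∀ c x, O (b c) x = O c (1 - x)
  union : F = ⋃ c, (L c '' Icc 0 1 ∪ I c '' Icc 0 1 ∪ O c '' Icc 0 1)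
  LL : ∀ c c', ∀ x ∈ Icc (0 : ℝ) 1, ∀ x' ∈ Icc (0 : ℝ) 1, L c x = L c' x' → c = c' ∧ x = x'
  II : ∀ c c', ∀ x ∈ Icc (0 : ℝ) 1, ∀ x' ∈ Icc (0 : ℝ) 1, I c x = I c' x' →
    (c' = c ∧ x = x') ∨ (c' = a c ∧ x = 1 - x')
  OO : ∀ c c', ∀ x ∈ Icc (0 : ℝ) 1, ∀ x' ∈ Icc (0 : ℝ) 1, O c x = O c' x' →
    (c' = c ∧ x = x') ∨ (c' = b c ∧ x = 1 - x')
  LI : ∀ c c', ∀ x ∈ Icc (0 : ℝ) 1, ∀ x' ∈ Icc (0 : ℝ) 1, L c x = I c' x' →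
    x = 0 ∧ ((c' = c ∧ x' = 0) ∨ (c' = a c ∧ x' = 1))
  LO : ∀ c c', ∀ x ∈ Icc (0 : ℝ) 1, ∀ x' ∈ Icc (0 : ℝ) 1, L c x = O c' x' →
    x = 1 ∧ ((c' = c ∧ x' = 0) ∨ (c' = b c ∧ x' = 1))
  inOut : ∀ c c', ∀ x ∈ Icc (0 : ℝ) 1, ∀ x' ∈ Icc (0 : ℝ) 1, I c x ≠ O c' x'

variable {C : Type*} {F : Set S} {a b : C → C} {L I O : C → ℝ → S}

/-- The permutation that goes once along an arc `O` and once along an arc `I`. -/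
def IsCircuitSystem.perm (h : IsCircuitSystem F a b L I O) : Equiv.Perm C :=
  (h.b_inv.toPerm b).trans (h.a_inv.toPerm a)

lemma IsCircuitSystem.perm_apply (h : IsCircuitSystem F a b L I O) (c : C) :
    h.perm c = a (b c) := rfl

/-- Two fixed point free involutions: the orbit of `a ∘ b` through `c` does not contain `b c`. -/
lemma IsCircuitSystem.iterate_ne (h : IsCircuitSystem F a b L I O) (m : ℕ) :
    ∀ c, (fun c => a (b c))^[m] c ≠ b c := by
  induction m using Nat.strong_induction_on with
  | _ m ih =>
    intro c hc
    match m, ih, hc with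
    | 0, _, hc => exact h.b_ne c hc.symm
    | 1, _, hc => exact h.a_ne (b c) hc
    | m + 2, ih, hc =>
      -- Cancelling one outer `a` and one outer `b` turns the relation for `m + 2` at `c` into the
      -- relation for `m` at `a (b c)`; the exponent drops by two.
      rw [Function.iterate_succ_apply, Function.iterate_succ_apply'] at hc
      refine ih m (by omega) (a (b c)) ?_
      have := congrArg a hc
      rw [h.a_inv] at this
      have := congrArg b this
      rwa [h.b_inv] at this

/-- A circuit follows the lobes of one `a ∘ b` orbit forwards and those of its image under `b`
backwards. The disjointness of the two index sets means that no lobe is used in both directions. -/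
lemma IsCircuitSystem.zpow_ne (h : IsCircuitSystem F a b L I O) (c : C) (k l : ℤ) :
    (h.perm ^ k) c ≠ b ((h.perm ^ l) c) := by
  have key : ∀ (m : ℕ) c, (h.perm ^ m) c ≠ b c := fun m c => by
    have := h.iterate_ne m c
    rwa [Equiv.Perm.coe_pow]
  intro heq
  rcases le_total l k with hlk | hkl
  · obtain ⟨m, hm⟩ := Int.eq_ofNat_of_zero_le (sub_nonneg.2 hlk)
    rw [show k = m + l by omega, zpow_add, zpow_natCast, Equiv.Perm.mul_apply] at heq
    exact key m _ heq
  · obtain ⟨m, hm⟩ := Int.eq_ofNat_of_zero_le (sub_nonneg.2 hkl)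
    rw [show l = m + k by omega, zpow_add, zpow_natCast, Equiv.Perm.mul_apply] at heq
    have := congrArg b heq
    rw [h.b_inv] at this
    exact key m _ this.symm

lemma IsCircuitSystem.zpow_succ (h : IsCircuitSystem F a b L I O) (c : C) (k : ℤ) :
    (h.perm ^ (k + 1)) c = a (b ((h.perm ^ k) c)) := by
  rw [add_comm, zpow_add, zpow_one, Equiv.Perm.mul_apply, h.perm_apply]

/-- The successive arcs of a circuit. -/
noncomputable def IsCircuitSystem.piece (h : IsCircuitSystem F a b L I O) (c : C) (i : ℤ) (x : ℝ) : S :=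
  -- The residue selects, in turn: a lobe forwards, its exit edge, the opposite lobe backwards, its
  -- entry edge. The quotient counts the rounds.
  if i % 4 = 0 then L ((h.perm ^ (i / 4)) c) x
  else if i % 4 = 1 then O ((h.perm ^ (i / 4)) c) x
  else if i % 4 = 2 then L (b ((h.perm ^ (i / 4)) c)) (1 - x)
  else I (b ((h.perm ^ (i / 4)) c)) x

lemma IsCircuitSystem.piece_zero (h : IsCircuitSystem F a b L I O) (c : C) (k : ℤ) (x : ℝ) :
    h.piece c (4 * k) x = L ((h.perm ^ k) c) x := by
  rw [piece, if_pos (by omega), show 4 * k / 4 = k by omega]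

lemma IsCircuitSystem.piece_one (h : IsCircuitSystem F a b L I O) (c : C) (k : ℤ) (x : ℝ) :
    h.piece c (4 * k + 1) x = O ((h.perm ^ k) c) x := by
  rw [piece, if_neg (by omega), if_pos (by omega), show (4 * k + 1) / 4 = k by omega]

lemma IsCircuitSystem.piece_two (h : IsCircuitSystem F a b L I O) (c : C) (k : ℤ) (x : ℝ) :
    h.piece c (4 * k + 2) x = L (b ((h.perm ^ k) c)) (1 - x) := by
  rw [piece, if_neg (by omega), if_neg (by omega), if_pos (by omega),
    show (4 * k + 2) / 4 = k by omega]

lemma IsCircuitSystem.piece_three (h : IsCircuitSystem F a b L I O) (c : C) (k : ℤ) (x : ℝ) :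
    h.piece c (4 * k + 3) x = I (b ((h.perm ^ k) c)) x := by
  rw [piece, if_neg (by omega), if_neg (by omega), if_neg (by omega),
    show (4 * k + 3) / 4 = k by omega]

lemma exists_four_mul_add (i : ℤ) :
    ∃ k, i = 4 * k ∨ i = 4 * k + 1 ∨ i = 4 * k + 2 ∨ i = 4 * k + 3 := ⟨i / 4, by omega⟩

lemma IsCircuitSystem.piece_match (h : IsCircuitSystem F a b L I O) (c : C) (i : ℤ) :
    h.piece c i 1 = h.piece c (i + 1) 0 := by
  have I1 : ∀ c, I c 1 = L (a c) 0 := fun c => by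
    rw [← h.I_zero, h.I_flip, sub_zero]
  have O1 : ∀ c, O c 1 = L (b c) 1 := fun c => by
    rw [← h.O_zero, h.O_flip, sub_zero]
  obtain ⟨k, rfl | rfl | rfl | rfl⟩ := exists_four_mul_add i
  · rw [h.piece_zero, h.piece_one, h.O_zero]
  · rw [h.piece_one, show 4 * k + 1 + 1 = 4 * k + 2 by ring, h.piece_two, sub_zero, O1]
  · rw [h.piece_two, show 4 * k + 2 + 1 = 4 * k + 3 by ring, h.piece_three, sub_self, h.I_zero]
  · rw [h.piece_three, show 4 * k + 3 + 1 = 4 * (k + 1) by ring, h.piece_zero, I1, h.zpow_succ]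

lemma IsCircuitSystem.continuousOn_piece (h : IsCircuitSystem F a b L I O) (c : C) (i : ℤ) :
    ContinuousOn (h.piece c i) (Icc 0 1) := by
  obtain ⟨k, rfl | rfl | rfl | rfl⟩ := exists_four_mul_add i
  · exact (h.contL _).congr fun x _ => h.piece_zero c k x
  · exact (h.contO _).congr fun x _ => h.piece_one c k x
  · have : ContinuousOn (fun x => L (b ((h.perm ^ k) c)) (1 - x)) (Icc 0 1) :=
      (h.contL _).comp (by fun_prop) fun x hx => ⟨by linarith [hx.2], by linarith [hx.1]⟩
    exact this.congr fun x _ => h.piece_two c k x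
  · exact (h.contI _).congr fun x _ => h.piece_three c k x

/-- The arcs of a circuit meet only in common endpoints. -/
lemma IsCircuitSystem.piece_injective (h : IsCircuitSystem F a b L I O) (c : C) {i i' : ℤ}
    {x x' : ℝ} (hx : x ∈ Ico (0 : ℝ) 1) (hx' : x' ∈ Ico (0 : ℝ) 1)
    (e : h.piece c i x = h.piece c i' x') :
    x = x' ∧ i % 4 = i' % 4 ∧ (h.perm ^ (i / 4)) c = (h.perm ^ (i' / 4)) c := by
  -- it suffices to treat the case of increasing residues
  have key : ∀ {i i' : ℤ} {x x' : ℝ}, x ∈ Ico (0 : ℝ) 1 → x' ∈ Ico (0 : ℝ) 1 →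
      h.piece c i x = h.piece c i' x' → i % 4 ≤ i' % 4 →
      x = x' ∧ i % 4 = i' % 4 ∧ (h.perm ^ (i / 4)) c = (h.perm ^ (i' / 4)) c := by
    intro i i' x x' hx hx' e hle
    have hxI := Ico_subset_Icc_self hx
    have hxI' := Ico_subset_Icc_self hx'
    have hy : ∀ {x : ℝ}, x ∈ Ico (0 : ℝ) 1 → 1 - x ∈ Icc (0 : ℝ) 1 := fun hx =>
      ⟨by linarith [hx.2], by linarith [hx.1]⟩
    have hx1 := hx.2
    have hx1' := hx'.2
    obtain ⟨k, rfl | rfl | rfl | rfl⟩ := exists_four_mul_add i <;>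
      obtain ⟨l, rfl | rfl | rfl | rfl⟩ := exists_four_mul_add i' <;>
      first | omega | skip
    · rw [h.piece_zero, h.piece_zero] at e
      obtain ⟨h1, h2⟩ := h.LL _ _ x hxI x' hxI' e
      exact ⟨h2, by omega, by simpa using h1⟩
    · rw [h.piece_zero, h.piece_one] at e
      have := (h.LO _ _ x hxI x' hxI' e).1
      linarith
    · rw [h.piece_zero, h.piece_two] at e
      exact absurd (h.LL _ _ x hxI _ (hy hx') e).1 (h.zpow_ne c _ _)
    · rw [h.piece_zero, h.piece_three] at e
      rcases (h.LI _ _ x hxI x' hxI' e).2 with h' | h'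
      · exact absurd h'.1.symm (h.zpow_ne c _ _)
      · linarith [h'.2]
    · rw [h.piece_one, h.piece_one] at e
      rcases h.OO _ _ x hxI x' hxI' e with h' | h'
      · refine ⟨h'.2, by omega, ?_⟩
        rw [show (4 * k + 1) / 4 = k by omega, show (4 * l + 1) / 4 = l by omega, h'.1]
      · exact absurd h'.1 (h.zpow_ne c _ _)
    · rw [h.piece_one, h.piece_two] at e
      rcases (h.LO _ _ _ (hy hx') x hxI e.symm).2 with h' | h'
      · exact absurd h'.1 (h.zpow_ne c _ _)
      · linarith [h'.2]
    · rw [h.piece_one, h.piece_three] at e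
      exact absurd e.symm (h.inOut _ _ x' hxI' x hxI)
    · rw [h.piece_two, h.piece_two] at e
      obtain ⟨h1, h2⟩ := h.LL _ _ _ (hy hx) _ (hy hx') e
      refine ⟨by linarith, by omega, ?_⟩
      rw [show (4 * k + 2) / 4 = k by omega, show (4 * l + 2) / 4 = l by omega]
      exact h.b_inv.injective h1
    · rw [h.piece_two, h.piece_three] at e
      have := (h.LI _ _ _ (hy hx) x' hxI' e).1
      linarith
    · rw [h.piece_three, h.piece_three] at e
      rcases h.II _ _ x hxI x' hxI' e with h' | h'
      · refine ⟨h'.2, by omega, ?_⟩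
        rw [show (4 * k + 3) / 4 = k by omega, show (4 * l + 3) / 4 = l by omega]
        exact h.b_inv.injective h'.1.symm
      · have := h'.1
        rw [← h.zpow_succ] at this
        exact absurd this.symm (h.zpow_ne c _ _)
  rcases le_total (i % 4) (i' % 4) with hle | hle
  · exact key hx hx' e hle
  · obtain ⟨h1, h2, h3⟩ := key hx' hx e.symm hle
    exact ⟨h1.symm, h2.symm, h3.symm⟩

/-- The part of `F` that belongs to a set of indices. -/
def arcsOver (L I O : C → ℝ → S) (Z : Set C) : Set S :=
  ⋃ c ∈ Z, (L c '' Icc 0 1 ∪ I c '' Icc 0 1 ∪ O c '' Icc 0 1)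

lemma IsCircuitSystem.isClosed_arcsOver [T2Space S] [Finite C] (h : IsCircuitSystem F a b L I O)
    (Z : Set C) : IsClosed (arcsOver L I O Z) := by
  refine Z.toFinite.isClosed_biUnion fun c _ => ?_
  exact (((isCompact_Icc.image_of_continuousOn (h.contL c)).union
    (isCompact_Icc.image_of_continuousOn (h.contI c))).union
    (isCompact_Icc.image_of_continuousOn (h.contO c))).isClosed

/-- By the incidence relations, arcs with different indices can meet only if `a` or `b` exchanges
the indices. A set stable under both therefore splits `F`. -/
lemma IsCircuitSystem.arcsOver_disjoint (h : IsCircuitSystem F a b L I O) {Z : Set C}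
    (hZa : ∀ c, a c ∈ Z ↔ c ∈ Z) (hZb : ∀ c, b c ∈ Z ↔ c ∈ Z) :
    Disjoint (arcsOver L I O Z) (arcsOver L I O Zᶜ) := by
  rw [disjoint_left]
  rintro p hp hp'
  obtain ⟨c, hc, hp⟩ := mem_iUnion₂.1 hp
  obtain ⟨c', hc', hp'⟩ := mem_iUnion₂.1 hp'
  have hne : ∀ d, (d = c ∨ d = a c ∨ d = b c) → d ≠ c' := by
    rintro d (rfl | rfl | rfl) rfl
    · exact hc' hc
    · exact hc' ((hZa _).2 hc)
    · exact hc' ((hZb _).2 hc)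
  have hne' : ∀ d, (d = c' ∨ d = a c' ∨ d = b c') → d ≠ c := by
    rintro d (rfl | rfl | rfl) rfl
    · exact hc' hc
    · exact hc' ((hZa _).1 hc)
    · exact hc' ((hZb _).1 hc)
  rcases hp with (⟨x, hx, e⟩ | ⟨x, hx, e⟩) | ⟨x, hx, e⟩ <;>
    rcases hp' with (⟨y, hy, e'⟩ | ⟨y, hy, e'⟩) | ⟨y, hy, e'⟩
  · exact hne c (Or.inl rfl) (h.LL _ _ x hx y hy (e.trans e'.symm)).1
  · rcases (h.LI _ _ x hx y hy (e.trans e'.symm)).2 with h' | h'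
    · exact hne c (Or.inl rfl) h'.1.symm
    · exact hne (a c) (by simp) h'.1.symm
  · rcases (h.LO _ _ x hx y hy (e.trans e'.symm)).2 with h' | h'
    · exact hne c (Or.inl rfl) h'.1.symm
    · exact hne (b c) (by simp) h'.1.symm
  · rcases (h.LI _ _ y hy x hx (e'.trans e.symm)).2 with h' | h'
    · exact hne' c' (Or.inl rfl) h'.1.symm
    · exact hne' (a c') (by simp) h'.1.symm
  · rcases h.II _ _ x hx y hy (e.trans e'.symm) with h' | h'
    · exact hne c (Or.inl rfl) h'.1.symm
    · exact hne (a c) (by simp) h'.1.symm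
  · exact h.inOut _ _ x hx y hy (e.trans e'.symm)
  · rcases (h.LO _ _ y hy x hx (e'.trans e.symm)).2 with h' | h'
    · exact hne' c' (Or.inl rfl) h'.1.symm
    · exact hne' (b c') (by simp) h'.1.symm
  · exact h.inOut _ _ y hy x hx (e'.trans e.symm)
  · rcases h.OO _ _ x hx y hy (e.trans e'.symm) with h' | h'
    · exact hne c (Or.inl rfl) h'.1.symm
    · exact hne (b c) (by simp) h'.1.symm

/-- The number of rounds is the period of `c` under `a ∘ b`. The curve is connected, and it covers
the arcs over a set of indices stable under `a` and `b`. The remaining arcs form a disjoint closed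
set, so the curve is a full connected component of `F`. -/
lemma IsCircuitSystem.exists_circuit [T2Space S] [Finite C] (h : IsCircuitSystem F a b L I O)
    (c : C) :
    ∃ n : ℕ, 0 < n ∧ ∃ γ : ℝ → S, Continuous γ ∧ Function.Periodic γ (4 * n) ∧
      InjOn γ (Ico 0 (4 * n)) ∧ (∀ p ∈ range γ, range γ = connectedComponentIn F p) ∧
      L c '' Icc 0 1 ∪ I c '' Icc 0 1 ∪ O c '' Icc 0 1 ⊆ range γ ∧
      ∀ k : ℕ, ∃ d, ∀ x ∈ Icc (0 : ℝ) 1, γ (4 * k + x) = L d x ∧ γ (4 * k + 1 + x) = O d x ∧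
        γ (4 * k + 2 + x) = L (b d) (1 - x) ∧ γ (4 * k + 3 + x) = I (b d) x := by
  set n := Function.minimalPeriod (h.perm • ·) c with hn
  have hper : ∀ k : ℤ, (h.perm ^ k) c = c ↔ (n : ℤ) ∣ k := fun k =>
    MulAction.zpow_smul_eq_iff_minimalPeriod_dvd (a := h.perm) (b := c) (n := k)
  have hpos : 0 < n := by
    refine Function.minimalPeriod_pos_of_mem_periodicPts ?_
    refine Function.mem_periodicPts.2 ⟨orderOf h.perm, orderOf_pos _, ?_⟩
    rw [Function.IsPeriodicPt, Function.IsFixedPt, smul_iterate, pow_orderOf_eq_one]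
    exact one_smul _ c
  have hshift : ∀ k : ℤ, (h.perm ^ (k + n)) c = (h.perm ^ k) c := fun k => by
    rw [zpow_add, Equiv.Perm.mul_apply, (hper n).2 dvd_rfl]
  set γ := concat (h.piece c) with hγ
  have hadd : ∀ (i : ℤ) {x : ℝ}, x ∈ Icc (0 : ℝ) 1 → γ (i + x) = h.piece c i x := fun i x hx =>
    concat_add (h.piece_match c) i hx
  -- The indices of the lobes on the circuit, travelled forwards or backwards.
  set Z : Set C := {d | ∃ k : ℤ, d = (h.perm ^ k) c ∨ d = b ((h.perm ^ k) c)} with hZ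
  have hZb' : ∀ d ∈ Z, b d ∈ Z := by
    rintro d ⟨k, rfl | rfl⟩
    · exact ⟨k, Or.inr rfl⟩
    · exact ⟨k, Or.inl (h.b_inv _)⟩
  have hZa' : ∀ d ∈ Z, a d ∈ Z := by
    rintro d ⟨k, rfl | rfl⟩
    · refine ⟨k - 1, Or.inr ?_⟩
      have := h.zpow_succ c (k - 1)
      rw [sub_add_cancel] at this
      rw [this, h.a_inv]
    · exact ⟨k + 1, Or.inl (h.zpow_succ c k).symm⟩
  have hZa : ∀ d, a d ∈ Z ↔ d ∈ Z := fun d =>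
    ⟨fun hd => by have := hZa' _ hd; rwa [h.a_inv] at this, hZa' d⟩
  have hZb : ∀ d, b d ∈ Z ↔ d ∈ Z := fun d =>
    ⟨fun hd => by have := hZb' _ hd; rwa [h.b_inv] at this, hZb' d⟩
  have hflip : ∀ {x : ℝ}, x ∈ Icc (0 : ℝ) 1 → 1 - x ∈ Icc (0 : ℝ) 1 := fun hx =>
    ⟨by linarith [hx.2], by linarith [hx.1]⟩
  have hsub : ∀ d ∈ Z, L d '' Icc 0 1 ∪ I d '' Icc 0 1 ∪ O d '' Icc 0 1 ⊆ range γ := by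
    have hI : ∀ k : ℤ, ∀ x ∈ Icc (0 : ℝ) 1, I (b ((h.perm ^ k) c)) x ∈ range γ :=
      fun k x hx => ⟨_, (hadd (4 * k + 3) hx).trans (h.piece_three c k x)⟩
    have hO : ∀ k : ℤ, ∀ x ∈ Icc (0 : ℝ) 1, O ((h.perm ^ k) c) x ∈ range γ :=
      fun k x hx => ⟨_, (hadd (4 * k + 1) hx).trans (h.piece_one c k x)⟩
    rintro d ⟨k, rfl | rfl⟩ p ((⟨x, hx, rfl⟩ | ⟨x, hx, rfl⟩) | ⟨x, hx, rfl⟩)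
    · exact ⟨_, (hadd (4 * k) hx).trans (h.piece_zero c k x)⟩
    · have := h.zpow_succ c (k - 1)
      rw [sub_add_cancel] at this
      rw [this, h.I_flip]
      exact hI _ _ (hflip hx)
    · exact hO k x hx
    · refine ⟨_, (hadd (4 * k + 2) (hflip hx)).trans ((h.piece_two c k _).trans ?_)⟩
      rw [sub_sub_cancel]
    · exact hI k x hx
    · rw [h.O_flip]; exact hO k _ (hflip hx)
  have hrange : range γ = arcsOver L I O Z := by
    apply Subset.antisymm
    · rintro _ ⟨t, rfl⟩
      have hfr : Int.fract t ∈ Icc (0 : ℝ) 1 := ⟨Int.fract_nonneg t, (Int.fract_lt_one t).le⟩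
      rw [← Int.floor_add_fract t, hadd _ hfr]
      obtain ⟨k, hk⟩ := exists_four_mul_add ⌊t⌋
      have h1 : (h.perm ^ k) c ∈ Z := ⟨k, Or.inl rfl⟩
      have h2 : b ((h.perm ^ k) c) ∈ Z := ⟨k, Or.inr rfl⟩
      rcases hk with hk | hk | hk | hk <;> rw [hk]
      · rw [h.piece_zero]
        exact mem_iUnion₂.2 ⟨_, h1, Or.inl (Or.inl ⟨_, hfr, rfl⟩)⟩
      · rw [h.piece_one]
        exact mem_iUnion₂.2 ⟨_, h1, Or.inr ⟨_, hfr, rfl⟩⟩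
      · rw [h.piece_two]
        exact mem_iUnion₂.2 ⟨_, h2, Or.inl (Or.inl ⟨_, hflip hfr, rfl⟩)⟩
      · rw [h.piece_three]
        exact mem_iUnion₂.2 ⟨_, h2, Or.inl (Or.inr ⟨_, hfr, rfl⟩)⟩
    · exact iUnion₂_subset hsub
  have hF : F = arcsOver L I O Z ∪ arcsOver L I O Zᶜ := by
    rw [h.union, arcsOver, arcsOver, ← biUnion_union, union_compl_self, biUnion_univ]
  have hcont : Continuous γ := continuous_concat (h.piece_match c) (h.continuousOn_piece c)
  refine ⟨n, hpos, γ, hcont, ?_, ?_, ?_, hsub c ⟨0, Or.inl rfl⟩, fun k => ?_⟩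
  · intro t
    have e1 : (t : ℝ) + 4 * n = t + ((4 * n : ℤ) : ℝ) := by push_cast; rfl
    rw [hγ, concat, concat, e1, Int.floor_add_intCast, Int.fract_add_intCast]
    obtain ⟨k, hk⟩ := exists_four_mul_add ⌊t⌋
    rcases hk with hk | hk | hk | hk <;> rw [hk]
    · rw [show 4 * k + 4 * (n : ℤ) = 4 * (k + n) by ring, h.piece_zero, h.piece_zero, hshift]
    · rw [show 4 * k + 1 + 4 * (n : ℤ) = 4 * (k + n) + 1 by ring, h.piece_one, h.piece_one, hshift]
    · rw [show 4 * k + 2 + 4 * (n : ℤ) = 4 * (k + n) + 2 by ring, h.piece_two, h.piece_two, hshift]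
    · rw [show 4 * k + 3 + 4 * (n : ℤ) = 4 * (k + n) + 3 by ring, h.piece_three, h.piece_three,
        hshift]
  · intro t ht t' ht' e
    obtain ⟨h1, h2, h3⟩ := h.piece_injective c ⟨Int.fract_nonneg t, Int.fract_lt_one t⟩
      ⟨Int.fract_nonneg t', Int.fract_lt_one t'⟩ e
    have hfl : ∀ s ∈ Ico (0 : ℝ) (4 * n), 0 ≤ ⌊s⌋ ∧ ⌊s⌋ < 4 * n := fun s hs => by
      refine ⟨Int.floor_nonneg.2 hs.1, Int.floor_lt.2 ?_⟩
      push_cast; exact hs.2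
    -- Equal values on the circuit give the same corner after `⌊t⌋ / 4` and `⌊t'⌋ / 4` rounds. These
    -- numbers then differ by a multiple of `n`, and both lie in `[0, n)`.
    have hdvd : (n : ℤ) ∣ ⌊t⌋ / 4 - ⌊t'⌋ / 4 := by
      rw [← hper, zpow_sub, Equiv.Perm.mul_apply, ← zpow_neg]
      have : (h.perm ^ (⌊t⌋ / 4)) c = (h.perm ^ (⌊t'⌋ / 4)) c := h3
      have hcomm : (h.perm ^ (⌊t⌋ / 4)) ((h.perm ^ (-(⌊t'⌋ / 4))) c) =
          (h.perm ^ (-(⌊t'⌋ / 4))) ((h.perm ^ (⌊t⌋ / 4)) c) := by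
        rw [← Equiv.Perm.mul_apply, ← Equiv.Perm.mul_apply, ← zpow_add, ← zpow_add, add_comm]
      rw [hcomm, this, ← Equiv.Perm.mul_apply, ← zpow_add]; simp
    obtain ⟨q, hq⟩ := hdvd
    have b1 := hfl t ht
    have b2 := hfl t' ht'
    have hq0 : q = 0 := by
      have hn' : (0 : ℤ) < n := by exact_mod_cast hpos
      have u1 : ⌊t⌋ / 4 - ⌊t'⌋ / 4 < n := by omega
      have u2 : -(n : ℤ) < ⌊t⌋ / 4 - ⌊t'⌋ / 4 := by omega
      rw [hq] at u1 u2
      have v1 : q < 1 := by nlinarith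
      have v2 : -1 < q := by nlinarith
      omega
    have hfloor : ⌊t⌋ = ⌊t'⌋ := by
      rw [hq0, mul_zero] at hq; omega
    rw [← Int.floor_add_fract t, ← Int.floor_add_fract t', h1, hfloor]
  · intro p hp
    have hpF : p ∈ F := by rw [hF]; exact Or.inl (hrange ▸ hp)
    apply Subset.antisymm
    · refine (isPreconnected_range hcont).subset_connectedComponentIn hp ?_
      rw [hF, hrange]; exact subset_union_left
    -- A preconnected subset of `F` that meets both closed pieces would meet their empty
    -- intersection.
    · have hconn := isPreconnected_closed_iff.1 (isPreconnected_connectedComponentIn (F := F)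
        (x := p)) _ _ (h.isClosed_arcsOver Z) (h.isClosed_arcsOver Zᶜ)
        (hF ▸ connectedComponentIn_subset F p) ⟨p, mem_connectedComponentIn hpF, hrange ▸ hp⟩
      intro q hq
      by_contra hcon
      have hq' : q ∈ arcsOver L I O Zᶜ := by
        have := connectedComponentIn_subset F p hq
        rw [hF] at this
        rcases this with h' | h'
        · exact absurd (hrange ▸ h') hcon
        · exact h'
      obtain ⟨r, -, hr⟩ := hconn ⟨q, hq, hq'⟩
      exact disjoint_left.1 (h.arcsOver_disjoint hZa hZb) hr.1 hr.2
  · refine ⟨(h.perm ^ (k : ℤ)) c, fun x hx => ⟨?_, ?_, ?_, ?_⟩⟩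
    · rw [← h.piece_zero, ← hadd _ hx]; push_cast; rfl
    · rw [← h.piece_one, ← hadd _ hx]; push_cast; rfl
    · rw [← h.piece_two, ← hadd _ hx]; push_cast; rfl
    · rw [← h.piece_three, ← hadd _ hx]; push_cast; rfl

end Circuits

end Dumbbell

namespace Dumbbell

/-! ### The boundary of the filling as a circuit system, and neighbourhoods of its edges. -/

section CircuitsOfFilling

variable {S : Type*} [TopologicalSpace S] [T2Space S] {ι : Type*} [Finite ι] {φ : Flow ℝ S}
  {Γ : Set S} {σ : ι → ℝ → S} {c δ : ℝ}

lemma IsOutEdge.injOn (h : IsCrossSection φ Γ σ c) {j : ι} {s η w : ℝ}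
    (he : IsOutEdge φ Γ σ δ j s η w) : σ j (s + η * w) ≠ σ j s := by
  have hg := he.thin.gap
  intro e
  have := (h.inj (Ioo_subset_Icc_self hg.last_mem) (Ioo_subset_Icc_self hg.start_mem) e).2
  have hw := hg.pos
  rcases hg.sign with rfl | rfl <;> linarith

/-- The exit edges, parametrized by `[0, 1]` from each of their endpoints. -/
lemma IsCrossSection.exists_edges (h : IsCrossSection φ Γ σ c) :
    ∃ (opp : {p // IsCorner φ Γ σ δ p} → {p // IsCorner φ Γ σ δ p})
      (E : {p // IsCorner φ Γ σ δ p} → ℝ → S), Function.Involutive opp ∧ (∀ p, opp p ≠ p) ∧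
      (∀ p, E p 0 = p) ∧ (∀ p x, E (opp p) x = E p (1 - x)) ∧
      (∀ p, ∃ j s η w, IsOutEdge φ Γ σ δ j s η w ∧ ∀ x, E p x = σ j (s + η * (w * x))) ∧
      (∀ j s η w, IsOutEdge φ Γ σ δ j s η w → ∃ p, E p '' Icc 0 1 = gapArc σ j s η w) ∧
      ∀ p p', ∀ x ∈ Icc (0 : ℝ) 1, ∀ x' ∈ Icc (0 : ℝ) 1, E p x = E p' x' →
        (p' = p ∧ x = x') ∨ (p' = opp p ∧ x = 1 - x') := by
  -- By `IsGap.unique` the chosen edge data depend only on the corner, so the choices at the two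
  -- ends of an edge are flips of each other.
  choose J s η w he hp using fun p : {p // IsCorner φ Γ σ δ p} => p.2
  let opp : {p // IsCorner φ Γ σ δ p} → {p // IsCorner φ Γ σ δ p} := fun p =>
    ⟨σ (J p) (s p + η p * w p), J p, _, _, _, (he p).flip, rfl⟩
  let E : {p // IsCorner φ Γ σ δ p} → ℝ → S := fun p x => σ (J p) (s p + η p * (w p * x))
  -- the data at the opposite corner
  have hopp : ∀ p, J (opp p) = J p ∧ s (opp p) = s p + η p * w p ∧ η (opp p) = -η p ∧
      w (opp p) = w p := fun p =>
    (he (opp p)).thin.gap.unique h (he p).flip.thin.gap (hp (opp p))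
  have E0 : ∀ p, E p 0 = p := fun p => by simp [E, hp]
  have E1 : ∀ p, E p 1 = opp p := fun p => by simp [E, opp]
  have Eflip : ∀ p x, E (opp p) x = E p (1 - x) := fun p x => by
    obtain ⟨h1, h2, h3, h4⟩ := hopp p
    simp only [E]
    rw [h1, h2, h3, h4]
    congr 1; ring
  have hinv : Function.Involutive opp := fun p => by
    apply Subtype.ext
    rw [← E1, Eflip, sub_self, E0]
  have hmem : ∀ p, ∀ x ∈ Icc (0 : ℝ) 1, w p * x ∈ Icc 0 (w p) := fun p x hx =>
    ⟨mul_nonneg (he p).thin.gap.pos.le hx.1,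
      mul_le_of_le_one_right (he p).thin.gap.pos.le hx.2⟩
  refine ⟨opp, E, hinv, fun p hpp => ?_, E0, Eflip, fun p => ⟨J p, s p, η p, w p, he p, fun x => rfl⟩,
    fun j s' η' w' he' => ?_, fun p p' x hx x' hx' e => ?_⟩
  · refine (he p).injOn h ?_
    rw [hp]; exact congrArg Subtype.val hpp
  · let p : {p // IsCorner φ Γ σ δ p} := ⟨σ j s', j, s', η', w', he', rfl⟩
    refine ⟨p, ?_⟩
    have := (he p).thin.gap.unique h he'.thin.gap (hp p)
    obtain ⟨h1, h2, h3, h4⟩ := this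
    have hw := he'.thin.gap.pos
    ext y
    constructor
    · rintro ⟨x, hx, rfl⟩
      refine ⟨w' * x, h4 ▸ hmem p x hx, ?_⟩
      simp only [E, h1, h2, h3, h4]
    · rintro ⟨u, hu, rfl⟩
      refine ⟨u / w', ⟨div_nonneg hu.1 hw.le, (div_le_one hw).2 hu.2⟩, ?_⟩
      simp only [E, h1, h2, h3, h4]
      rw [mul_div_cancel₀ _ hw.ne']
  · have hw := (he p).thin.gap.pos
    rcases (he p).thin.gap.eq_of_inter h (he p').thin.gap (hmem p x hx) (hmem p' x' hx') e with
      ⟨h1, h2⟩ | ⟨h1, h2⟩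
    · left
      have hpp : p' = p := Subtype.ext (by rw [← hp, ← hp p, h1])
      subst hpp
      exact ⟨rfl, mul_left_cancel₀ hw.ne' h2⟩
    · right
      have hpp : p' = opp p := Subtype.ext (by rw [← hp, ← h1])
      refine ⟨hpp, ?_⟩
      rw [hpp, (hopp p).2.2.2] at h2
      refine mul_left_cancel₀ hw.ne' (h2.trans (by ring))

/-- The boundary of the filling is a circuit system whose arcs are orbit segments in `Γ` and entry
and exit edges. -/
lemma IsCrossSection.exists_isCircuitSystem (h : IsCrossSection φ Γ σ c) (hΓ : IsCompact Γ)
    (hδ : 0 < δ) (hper : ∀ x ∈ Γ, ∀ T : ℝ, 0 < T → φ T x ≠ x) :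
    ∃ (a b : {p // IsCorner φ.reverse Γ σ δ p} → {p // IsCorner φ.reverse Γ σ δ p})
      (L I O : {p // IsCorner φ.reverse Γ σ δ p} → ℝ → S),
      IsCircuitSystem (frontier (outer φ Γ σ δ)) a b L I O ∧
      (∀ d, ∃ p ∈ Γ, ∃ l > 0, ∀ x, L d x = φ (l * x) p) ∧
      (∀ d, ∃ j s η w, IsOutEdge φ.reverse Γ σ δ j s η w ∧ ∀ x, I d x = σ j (s + η * (w * x))) ∧
      ∀ d, ∃ j s η w, IsOutEdge φ Γ σ δ j s η w ∧ ∀ x, O d x = σ j (s + η * (w * x)) := by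
  have hper' : ∀ x ∈ Γ, ∀ T : ℝ, 0 < T → φ.reverse T x ≠ x := fun x hx T hT e => by
    rw [Flow.reverse_apply] at e
    exact hper x hx T hT (flow_eq_iff.2 e.symm)
  obtain ⟨a, I, a_inv, a_ne, I0, Iflip, Iedge, Iex, II⟩ := h.reverse.exists_edges (δ := δ)
  obtain ⟨o, E, o_inv, o_ne, E0, Eflip, Eedge, Eex, EE⟩ := h.exists_edges (δ := δ)
  have hlobe : ∀ p : {p // IsCorner φ.reverse Γ σ δ p}, ∃ l > 0, IsCorner φ Γ σ δ (φ l p) ∧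
      (∀ t ∈ Ioo 0 l, IsLobePoint φ Γ (outer φ Γ σ δ) (φ t p)) ∧
      ∀ t ∈ Icc 0 l, φ t p ∈ frontier (outer φ Γ σ δ) := fun p => by
    obtain ⟨ρ, hρ, hF, -⟩ := p.2.exists_flow_mem_reverse h hδ
    exact h.exists_lobe hΓ hδ hper p.2.mem ⟨ρ, hρ, hF⟩
  choose l hl hout hmid hfr using hlobe
  -- going back from a boundary point
  have hback : ∀ q ∈ Γ, (∃ ρ > 0, ∀ t ∈ Ico 0 ρ, φ (-t) q ∈ frontier (outer φ Γ σ δ)) →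
      ∃ p : {p // IsCorner φ.reverse Γ σ δ p}, ∃ t > 0, φ t p = q ∧
        ∀ r ∈ Ioo 0 t, ¬ IsCorner φ Γ σ δ (φ r p) := by
    rintro q hq ⟨ρ, hρ, hF⟩
    obtain ⟨t, ht, hc, hm, -⟩ := h.reverse.exists_lobe hΓ hδ hper' hq
      ⟨ρ, hρ, fun t ht => by rw [Flow.reverse_apply, outer_reverse]; exact hF t ht⟩
    refine ⟨⟨_, hc⟩, t, ht, flow_apply_neg φ t q, fun r hr hcr => ?_⟩
    have := hm (t - r) ⟨by linarith [hr.2], by linarith [hr.1]⟩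
    refine IsCorner.not_isLobePoint_reverse h.reverse hδ (p := φ r (φ.reverse t q)) ?_ ?_
    · rw [reverse_reverse]; exact hcr
    · rw [Flow.reverse_apply] at this ⊢
      rwa [← φ.map_add, show r + -t = -(t - r) by ring]
  have hin : ∀ p : {p // IsCorner φ.reverse Γ σ δ p}, ∀ t ∈ Ioc 0 (l p),
      ¬ IsCorner φ.reverse Γ σ δ (φ t p) := fun p t ht hc => by
    rcases eq_or_lt_of_le ht.2 with e | hlt
    · rw [e] at hc; exact (hout p).not_reverse h hδ hc
    · exact hc.not_isLobePoint_reverse h hδ (hmid p t ⟨ht.1, hlt⟩)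
  -- When two lobes meet, flowing back until one of them starts places an entry corner on the other;
  -- it can only be the start of that lobe.
  have hLL : ∀ p p' : {p // IsCorner φ.reverse Γ σ δ p}, ∀ t ∈ Icc 0 (l p), ∀ t' ∈ Icc 0 (l p'),
      φ t p = φ t' p' → p = p' ∧ t = t' := by
    have key : ∀ p p' : {p // IsCorner φ.reverse Γ σ δ p}, ∀ t ∈ Icc 0 (l p),
        ∀ t' ∈ Icc 0 (l p'), φ t p = φ t' p' → t ≤ t' → p = p' ∧ t = t' := by
      intro p p' t ht t' ht' e hle
      have e' : (p : S) = φ (t' - t) p' := by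
        rw [flow_eq_iff.1 e, ← φ.map_add]; congr 1; ring
      rcases eq_or_lt_of_le hle with rfl | hlt
      · exact ⟨Subtype.ext (by simpa using e'), rfl⟩
      · exact absurd (e' ▸ p.2) (hin p' (t' - t) ⟨by linarith, by linarith [ht'.2, ht.1]⟩)
    intro p p' t ht t' ht' e
    rcases le_total t t' with hle | hle
    · exact key p p' t ht t' ht' e hle
    · obtain ⟨h1, h2⟩ := key p' p t' ht' t ht e.symm hle
      exact ⟨h1.symm, h2.symm⟩
  -- A lobe leads from its entry corner to its exit corner. Injectivity is disjointness of lobes,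
  -- surjectivity comes from going back along the boundary from an exit corner.
  let lam : {p // IsCorner φ.reverse Γ σ δ p} → {p // IsCorner φ Γ σ δ p} := fun p => ⟨_, hout p⟩
  have lam_bij : Function.Bijective lam := by
    constructor
    · intro p p' e
      exact (hLL p p' _ ⟨(hl p).le, le_rfl⟩ _ ⟨(hl p').le, le_rfl⟩ (congrArg Subtype.val e)).1
    · rintro ⟨q, hq⟩
      obtain ⟨ρ, hρ, hF, -⟩ := hq.exists_flow_mem h hδ
      obtain ⟨p, t, ht, rfl, hno⟩ := hback q hq.mem
        ⟨ρ, hρ, fun t ht => hF (-t) ⟨by linarith [ht.2], by linarith [ht.1]⟩⟩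
      refine ⟨p, Subtype.ext ?_⟩
      rcases lt_trichotomy t (l p) with hlt | heq | hlt
      · exact absurd (hmid p t ⟨ht, hlt⟩) (hq.not_isLobePoint h hδ)
      · simp only [lam, heq]
      · exact absurd (hout p) (hno _ ⟨hl p, hlt⟩)
  let Λ := Equiv.ofBijective lam lam_bij
  have hΛ : ∀ p, ((Λ p : {p // IsCorner φ Γ σ δ p}) : S) = φ (l p) p := fun p => rfl
  -- The involution that exchanges the ends of exit edges, transported to entry corners along the
  -- lobes.
  let b : {p // IsCorner φ.reverse Γ σ δ p} → {p // IsCorner φ.reverse Γ σ δ p} :=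
    fun p => Λ.symm (o (Λ p))
  have hb : ∀ p, Λ (b p) = o (Λ p) := fun p => Λ.apply_symm_apply _
  let L : {p // IsCorner φ.reverse Γ σ δ p} → ℝ → S := fun p x => φ (l p * x) p
  have hL : ∀ p x, L p x = φ (l p * x) p := fun p x => rfl
  have hLmem : ∀ p, ∀ x ∈ Icc (0 : ℝ) 1, l p * x ∈ Icc 0 (l p) := fun p x hx =>
    ⟨mul_nonneg (hl p).le hx.1, mul_le_of_le_one_right (hl p).le hx.2⟩
  have hLΓ : ∀ p x, L p x ∈ Γ := fun p x => h.invariant _ p.2.mem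
  have hcont : ∀ {ψ : Flow ℝ S}, IsCrossSection ψ Γ σ c → ∀ {f : ℝ → S},
      (∃ j s η w, IsOutEdge ψ Γ σ δ j s η w ∧ ∀ x, f x = σ j (s + η * (w * x))) →
      ContinuousOn f (Icc 0 1) := by
    rintro ψ h f ⟨j, s, η, w, he, hf⟩
    have hw := he.thin.gap.pos
    refine ContinuousOn.congr ?_ fun x _ => hf x
    refine (h.continuousOn j).comp (by fun_prop) fun x hx => ?_
    exact Icc_subset_Ioo_two (Ioo_subset_Icc_self (he.thin.gap.param_mem
      ⟨mul_nonneg hw.le hx.1, mul_le_of_le_one_right hw.le hx.2⟩))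
  have hend : ∀ {ψ : Flow ℝ S} {f : ℝ → S},
      (∃ j s η w, IsOutEdge ψ Γ σ δ j s η w ∧ ∀ x, f x = σ j (s + η * (w * x))) →
      ∀ x ∈ Icc (0 : ℝ) 1, f x ∈ Γ → (x = 0 ∨ x = 1) ∧ IsCorner ψ Γ σ δ (f x) := by
    rintro ψ f ⟨j, s, η, w, he, hf⟩ x hx hxΓ
    have hw := he.thin.gap.pos
    have hm : f x ∈ gapArc σ j s η w :=
      ⟨w * x, ⟨mul_nonneg hw.le hx.1, mul_le_of_le_one_right hw.le hx.2⟩, (hf x).symm⟩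
    refine ⟨?_, he.isCorner_of_mem hm hxΓ⟩
    by_contra! hcon
    rw [hf] at hxΓ
    have h0 : 0 < x := lt_of_le_of_ne hx.1 hcon.1.symm
    have h1 : x < 1 := lt_of_le_of_ne hx.2 hcon.2
    exact he.thin.gap.notMem (w * x) ⟨by positivity, by nlinarith⟩ hxΓ
  have hsubF : ∀ {ψ : Flow ℝ S}, IsCrossSection ψ Γ σ c → outer ψ Γ σ δ = outer φ Γ σ δ →
      ∀ {f : ℝ → S},
      (∃ j s η w, IsOutEdge ψ Γ σ δ j s η w ∧ ∀ x, f x = σ j (s + η * (w * x))) →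
      f '' Icc 0 1 ⊆ frontier (outer φ Γ σ δ) := by
    rintro ψ h hψ f ⟨j, s, η, w, he, hf⟩ _ ⟨x, hx, rfl⟩
    have hw := he.thin.gap.pos
    rw [← hψ]
    exact he.gapArc_subset h hδ
      ⟨w * x, ⟨mul_nonneg hw.le hx.1, mul_le_of_le_one_right hw.le hx.2⟩, (hf x).symm⟩
  refine ⟨a, b, L, I, fun p => E (Λ p), ?_, fun p => ⟨p, p.2.mem, l p, hl p, fun x => rfl⟩, Iedge,
    fun p => Eedge (Λ p)⟩
  refine ⟨a_inv, fun p => ?_, a_ne, fun p hp => ?_, fun p => ?_, fun p => hcont h.reverse (Iedge p),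
    fun p => hcont h (Eedge (Λ p)), fun p => ?_, Iflip, fun p => ?_, fun p x => ?_, ?_,
    fun p p' x hx x' hx' e => ?_, II, fun p p' x hx x' hx' e => ?_, fun p p' x hx x' hx' e => ?_,
    fun p p' x hx x' hx' e => ?_, fun p p' x hx x' hx' e => ?_⟩
  · apply Λ.injective
    rw [hb, hb, o_inv]
  · exact o_ne (Λ p) (by rw [← hb, hp])
  · exact (φ.continuous (by fun_prop) continuous_const).continuousOn
  · rw [I0, hL, mul_zero, φ.map_zero_apply]
  · rw [E0, hL, mul_one, hΛ]
  · rw [hb, Eflip]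
  · apply Subset.antisymm
    · intro q hq
      rcases h.frontier_cases hΓ hδ hq with ⟨j, s, η, w, he, hqe⟩ | ⟨j, s, η, w, he, hqe⟩ | hlp
      · obtain ⟨p, hp⟩ := Eex j s η w he
        refine mem_iUnion.2 ⟨Λ.symm p, Or.inr ?_⟩
        rw [Λ.apply_symm_apply, hp]; exact hqe
      · obtain ⟨p, hp⟩ := Iex j s η w he
        refine mem_iUnion.2 ⟨p, Or.inl (Or.inr ?_)⟩
        rw [hp]; exact hqe
      · obtain ⟨ρ, hρ, hF⟩ := hlp.exists_flow_mem
        obtain ⟨p, t, ht, rfl, hno⟩ := hback q hlp.1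
          ⟨ρ, hρ, fun t ht => hF (-t) (by rw [abs_neg, abs_of_nonneg ht.1]; exact ht.2)⟩
        refine mem_iUnion.2 ⟨p, Or.inl (Or.inl ⟨t / l p, ?_, ?_⟩)⟩
        · refine ⟨div_nonneg ht.le (hl p).le, (div_le_one (hl p)).2 ?_⟩
          by_contra hcon
          exact hno _ ⟨hl p, not_le.1 hcon⟩ (hout p)
        · rw [hL, mul_div_cancel₀ _ (hl p).ne']
    · refine iUnion_subset fun p => union_subset (union_subset ?_ ?_) ?_
      · rintro _ ⟨x, hx, rfl⟩
        exact hfr p _ (hLmem p x hx)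
      · exact hsubF h.reverse outer_reverse (Iedge p)
      · exact hsubF h rfl (Eedge (Λ p))
  · obtain ⟨h1, h2⟩ := hLL p p' _ (hLmem p x hx) _ (hLmem p' x' hx') e
    subst h1
    exact ⟨rfl, mul_left_cancel₀ (hl p).ne' h2⟩
  · rcases EE _ _ x hx x' hx' e with ⟨h1, h2⟩ | ⟨h1, h2⟩
    · exact Or.inl ⟨Λ.injective h1, h2⟩
    · exact Or.inr ⟨Λ.injective (by rw [h1, hb]), h2⟩
  · obtain ⟨h1, h2⟩ := hend (Iedge p') x' hx' (e ▸ hLΓ p x)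
    have hx0 : x = 0 := by
      by_contra hne
      rw [← e] at h2
      have hpos : 0 < x := lt_of_le_of_ne hx.1 (Ne.symm hne)
      exact hin p _ ⟨mul_pos (hl p) hpos, (hLmem p x hx).2⟩ h2
    subst hx0
    refine ⟨rfl, ?_⟩
    have e2 : I p 0 = I p' x' := by rw [← e, I0, hL, mul_zero, φ.map_zero_apply]
    rcases II _ _ 0 hx x' hx' e2 with ⟨h3, h4⟩ | ⟨h3, h4⟩
    · exact Or.inl ⟨h3, h4.symm⟩
    · exact Or.inr ⟨h3, by linarith⟩
  · obtain ⟨h1, h2⟩ := hend (Eedge (Λ p')) x' hx' (e ▸ hLΓ p x)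
    rw [← e] at h2
    have hx1 : x = 1 := by
      by_contra hne
      have hlt : x < 1 := lt_of_le_of_ne hx.2 hne
      rcases eq_or_lt_of_le hx.1 with h0 | h0
      · rw [hL, ← h0, mul_zero, φ.map_zero_apply] at h2
        exact h2.not_reverse h hδ p.2
      · have := hl p
        exact h2.not_isLobePoint h hδ (hmid p _ ⟨by positivity, by nlinarith⟩)
    subst hx1
    refine ⟨rfl, ?_⟩
    have e2 : E (Λ p) 0 = E (Λ p') x' := by rw [← e, E0, hL, mul_one, hΛ]
    rcases EE _ _ 0 ⟨le_rfl, zero_le_one⟩ x' hx' e2 with ⟨h3, h4⟩ | ⟨h3, h4⟩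
    · exact Or.inl ⟨Λ.injective h3, h4.symm⟩
    · exact Or.inr ⟨Λ.injective (by rw [h3, hb]), by linarith⟩
  -- A common point in `Γ` would be a corner of both kinds. Off `Γ` it would be thin for the
  -- reversed flow, which is excluded inside an exit edge.
  · by_cases hm : I p x ∈ Γ
    · have h1 := (hend (Iedge p) x hx hm).2
      rw [e] at hm h1
      exact (hend (Eedge (Λ p')) x' hx' hm).2.not_reverse h hδ h1
    · obtain ⟨j, s, η, w, he, hf⟩ := Iedge p
      obtain ⟨j', s', η', w', he', hf'⟩ := Eedge (Λ p')
      have hw := he.thin.gap.pos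
      have hw' := he'.thin.gap.pos
      have hthin : I p x ∈ thinSet φ.reverse Γ σ δ := ⟨j, s, η, w, he.thin, w * x,
        ⟨mul_nonneg hw.le hx.1, mul_le_of_le_one_right hw.le hx.2⟩, (hf x).symm⟩
      rw [e] at hm hthin
      rw [hf'] at hm hthin
      have h0 : 0 < x' := by
        refine lt_of_le_of_ne hx'.1 ?_
        rintro rfl
        exact hm (by simpa using he'.thin.gap.start_inv)
      have h1 : x' < 1 := by
        refine lt_of_le_of_ne hx'.2 ?_
        rintro rfl
        exact hm (by simpa using he'.thin.gap.last_inv)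
      exact he'.notMem (w' * x') ⟨by positivity, by nlinarith⟩ hthin

lemma IsCrossSection.finite_corners (h : IsCrossSection φ Γ σ c) (hΓ : IsCompact Γ) (hδ : 0 < δ) :
    Finite {p // IsCorner φ Γ σ δ p} := by
  refine Set.Finite.to_subtype ((h.finite_frontier_inter hΓ hδ).subset ?_)
  intro p (hp : IsCorner φ Γ σ δ p)
  refine ⟨⟨hp.mem_frontier_outer h hδ, hp.mem⟩, ?_⟩
  obtain ⟨j, s, η, w, he, rfl⟩ := hp
  exact mem_crossSet j (Ioo_subset_Icc_self he.thin.gap.start_mem)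

/-! #### Neighbourhoods of the edges -/

/-- In the flow box, a point of `S₀` at time coordinate `z.1 ≤ 0` reaches the arc after time `-z.1`
without leaving `S₀`. -/
lemma IsModel.exists_exit_nhd {S₀ G : Set S} {g : ℝ → S} {Q : Set ℝ}
    (hm : IsModel φ S₀ g (Iic 0) Q) (hG : ∀ᶠ x in 𝓝 (0 : ℝ), x ∈ Q → g x ∈ G) :
    ∃ V, IsOpen V ∧ g 0 ∈ V ∧ ∀ x ∈ V ∩ S₀, ∃ t : ℝ, 0 ≤ t ∧ φ t x ∈ G ∧
      ∀ s ∈ Icc 0 t, φ s x ∈ S₀ := by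
  obtain ⟨ρ, hρ, e, hs, he, hS⟩ := hm
  obtain ⟨r, hr, hG⟩ := Metric.eventually_nhds_iff_ball.1 hG
  have h0 : (0 : ℝ × ℝ) ∈ e.source := by rw [hs]; simp [hρ]
  have hB : IsOpen (univ ×ˢ Metric.ball (0 : ℝ) r : Set (ℝ × ℝ)) :=
    isOpen_univ.prod Metric.isOpen_ball
  refine ⟨e '' (e.source ∩ univ ×ˢ Metric.ball (0 : ℝ) r),
    e.isOpen_image_source_inter hB, ⟨0, ⟨h0, by simp [hr]⟩, by rw [he 0 h0]; simp⟩, ?_⟩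
  rintro _ ⟨⟨z, ⟨hz, hzr⟩, rfl⟩, hzS⟩
  obtain ⟨hz1, hz2⟩ := (hS z hz).1 hzS
  have hz1' : z.1 ≤ 0 := hz1
  refine ⟨-z.1, by linarith, ?_, fun s hs' => ?_⟩
  · rw [he z hz, flow_neg_apply]
    exact hG _ hzr.2 hz2
  · have hz' := hz
    rw [hs] at hz'
    have hm' : ((s + z.1, z.2) : ℝ × ℝ) ∈ e.source := by
      rw [hs]
      exact ⟨⟨by linarith [hs'.1, hz'.1.1], by linarith [hs'.2]⟩, hz'.2⟩
    rw [he z hz, ← φ.map_add]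
    have := (hS _ hm').2 ⟨show s + z.1 ≤ 0 by linarith [hs'.2], hz2⟩
    rwa [he _ hm'] at this

lemma IsOutEdge.exists_nhd (h : IsCrossSection φ Γ σ c) (hδ : 0 < δ) {j : ι} {s η w : ℝ}
    (he : IsOutEdge φ Γ σ δ j s η w) :
    ∃ U, IsNhdIn (outer φ Γ σ δ) (gapArc σ j s η w) U ∧
      ∀ x ∈ U, ∃ t : ℝ, 0 ≤ t ∧ (∀ s ∈ Icc 0 t, φ s x ∈ U) ∧ φ t x ∈ gapArc σ j s η w := by
  set G := gapArc σ j s η w with hG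
  set S₀ := outer φ Γ σ δ with hS₀
  -- All points that reach the edge inside `S₀` are taken at once. This set is stable under the flow
  -- up to the hit, so only the neighbourhood property needs local models.
  set U := {x | ∃ t : ℝ, 0 ≤ t ∧ φ t x ∈ G ∧ ∀ s ∈ Icc 0 t, φ s x ∈ S₀} with hU
  have hloc : ∀ p ∈ G, ∃ V, IsOpen V ∧ p ∈ V ∧ V ∩ S₀ ⊆ U := by
    have hstart : ∀ {s η w : ℝ}, IsOutEdge φ Γ σ δ j s η w → gapArc σ j s η w = G →
        ∃ V, IsOpen V ∧ σ j s ∈ V ∧ V ∩ S₀ ⊆ U := by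
      intro s η w he hG'
      obtain ⟨V, hV, hm, H⟩ := (he.model_start h hδ).exists_exit_nhd (G := G) (by
        filter_upwards [gt_mem_nhds he.thin.gap.pos] with x hx hx0
        rw [← hG']; exact ⟨x, ⟨hx0, hx.le⟩, rfl⟩)
      exact ⟨V, hV, by simpa using hm, H⟩
    rintro p ⟨u, hu, rfl⟩
    rcases eq_or_lt_of_le hu.1 with rfl | h0
    · simpa using hstart he rfl
    rcases eq_or_lt_of_le hu.2 with rfl | h1
    · exact hstart he.flip (gapArc_flip j s η u)
    · obtain ⟨V, hV, hm, H⟩ := (he.model_mid h ⟨h0, h1⟩).exists_exit_nhd (G := G) (by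
        filter_upwards [Ioo_mem_nhds (neg_lt_zero.2 h0) (sub_pos.2 h1)] with x hx _
        exact ⟨u + x, ⟨by linarith [hx.1], by linarith [hx.2]⟩, rfl⟩)
      exact ⟨V, hV, by simpa using hm, H⟩
  refine ⟨U, ⟨?_, ⋃₀ {V | IsOpen V ∧ V ∩ S₀ ⊆ U}, isOpen_sUnion fun V hV => hV.1, ?_, ?_⟩, ?_⟩
  · rintro x ⟨t, ht, -, H⟩
    simpa using H 0 ⟨le_rfl, ht⟩
  · intro p hp
    obtain ⟨V, hV, hm, H⟩ := hloc p hp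
    exact ⟨V, ⟨hV, H⟩, hm⟩
  · rintro x ⟨⟨V, ⟨-, H⟩, hxV⟩, hxS⟩
    exact H ⟨hxV, hxS⟩
  · rintro x ⟨t, ht, hG, H⟩
    refine ⟨t, ht, fun r hr => ⟨t - r, by linarith [hr.2], ?_, fun r' hr' => ?_⟩, hG⟩
    · rw [← φ.map_add, sub_add_cancel]; exact hG
    · rw [← φ.map_add]; exact H _ ⟨by linarith [hr'.1, hr.1], by linarith [hr'.2]⟩

lemma IsOutEdge.exists_nhd_reverse (h : IsCrossSection φ Γ σ c) (hδ : 0 < δ) {j : ι} {s η w : ℝ}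
    (he : IsOutEdge φ.reverse Γ σ δ j s η w) :
    ∃ U, IsNhdIn (outer φ Γ σ δ) (gapArc σ j s η w) U ∧
      ∀ x ∈ U, ∃ t : ℝ, t ≤ 0 ∧ (∀ s ∈ Icc t 0, φ s x ∈ U) ∧ φ t x ∈ gapArc σ j s η w := by
  obtain ⟨U, hU, H⟩ := he.exists_nhd h.reverse hδ
  rw [outer_reverse] at hU
  refine ⟨U, hU, fun x hx => ?_⟩
  obtain ⟨t, ht, h1, h2⟩ := H x hx
  refine ⟨-t, by linarith, fun s hs => ?_, h2⟩
  simpa [Flow.reverse_apply] using h1 (-s) ⟨by linarith [hs.2], by linarith [hs.1]⟩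

end CircuitsOfFilling

end Dumbbell

namespace Dumbbell

/-! ### Existence of cross-sections -/

section ExistsCrossSection

variable {S : Type*} [TopologicalSpace S]

lemma exists_pos_forall_le {α : Type*} {A : Set α} (hA : A.Finite) {c : α → ℝ}
    (hc : ∀ x ∈ A, 0 < c x) : ∃ d > 0, ∀ x ∈ A, d ≤ c x := by
  rcases A.eq_empty_or_nonempty with rfl | hne
  · exact ⟨1, one_pos, by simp⟩
  · obtain ⟨x, hx, hmin⟩ := hA.exists_minimalFor c A hne
    exact ⟨c x, hc x hx, fun y hy => (le_total (c x) (c y)).elim id fun h => hmin hy h⟩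

/-- Openness enters as an inequality of neighbourhood filters, the form in which level crossings
deliver it for flow boxes. -/
lemma exists_openPartialHomeomorph {f : ℝ × ℝ → S} {U : Set (ℝ × ℝ)} (hU : IsOpen U)
    (hf : ContinuousOn f U) (hinj : InjOn f U) (hnhds : ∀ z ∈ U, 𝓝 (f z) ≤ Filter.map f (𝓝 z)) :
    ∃ e : OpenPartialHomeomorph (ℝ × ℝ) S, e.source = U ∧ ∀ z ∈ e.source, e z = f z := by
  refine ⟨OpenPartialHomeomorph.ofContinuousOpenRestrict (hinj.toPartialEquiv f U) hf ?_ hU, rfl,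
    fun z _ => rfl⟩
  refine IsOpenMap.of_nhds_le fun z => ?_
  refine (hnhds z z.2).trans ?_
  rw [← map_nhds_subtype_coe_eq_nhds z.2 (hU.mem_nhds z.2), Filter.map_map]
  exact le_rfl

/-- The first coordinate of the chart `E` increases along the orbits. -/
def IsAdapted (φ : Flow ℝ S) (E : OpenPartialHomeomorph S (ℝ × ℝ)) : Prop :=
  ∀ x a b, a < b → (∀ t ∈ Icc a b, φ t x ∈ E.source) → (E (φ a x)).1 < (E (φ b x)).1

/-- The vertical arc at height `u` centred at `m`, with parameter scaled by `r`. -/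
def levelArc (E : OpenPartialHomeomorph S (ℝ × ℝ)) (u m r : ℝ) (s : ℝ) : S := E.symm (u, m + r * s)

variable {φ : Flow ℝ S} {E : OpenPartialHomeomorph S (ℝ × ℝ)}

/-- Orbits near `q` cross all levels close to that of `q`. -/
lemma IsAdapted.exists_crossing (hE : IsAdapted φ E) {W : Set S} (hW : IsOpen W)
    (hWE : W ⊆ E.source) {q : S} (hq : q ∈ W) {κ : ℝ} (hκ : 0 < κ) :
    ∃ a b, a < (E q).1 ∧ (E q).1 < b ∧ ∀ᶠ q' in 𝓝 q, ∀ u ∈ Ioo a b,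
      ∃ τ, |τ| < κ ∧ φ τ q' ∈ W ∧ (E (φ τ q')).1 = u := by
  have hnear : ∀ᶠ z : ℝ × S in 𝓝 (0, q), φ z.1 z.2 ∈ W :=
    (continuous_flow φ).continuousAt.eventually_mem (hW.mem_nhds (by simpa using hq))
  obtain ⟨A, hA, B, hB, hAB⟩ := Filter.eventually_prod_iff.1 (nhds_prod_eq (x := (0 : ℝ)) (y := q) ▸
    hnear)
  obtain ⟨r, hr, hrA⟩ := Metric.eventually_nhds_iff_ball.1 hA
  have hm : 0 < min r κ := lt_min hr hκ
  set τ := min r κ / 2 with hτ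
  have hτ0 : 0 < τ := by positivity
  have hτr : τ < r := by linarith [min_le_left r κ]
  have hτκ : τ < κ := by linarith [min_le_right r κ]
  have hstay : ∀ q', B q' → ∀ t ∈ Icc (-τ) τ, φ t q' ∈ W := fun q' hq' t ht => by
    refine hAB (hrA t ?_) hq'
    rw [Metric.mem_ball, Real.dist_0_eq_abs, abs_lt]
    exact ⟨by linarith [ht.1], by linarith [ht.2]⟩
  have hBq := hB.self_of_nhds
  have h1 : (E (φ (-τ) q)).1 < (E q).1 := by
    have := hE q (-τ) 0 (by linarith) fun t ht => hWE (hstay q hBq t ⟨ht.1, by linarith [ht.2]⟩)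
    simpa using this
  have h2 : (E q).1 < (E (φ τ q)).1 := by
    have := hE q 0 τ hτ0 fun t ht => hWE (hstay q hBq t ⟨by linarith [ht.1], ht.2⟩)
    simpa using this
  have hcE : ∀ t ∈ Icc (-τ) τ, ContinuousAt (fun x => (E (φ t x)).1) q := fun t ht => by
    have := (E.continuousAt (hWE (hstay q hBq t ht)))
    exact continuousAt_fst.comp (ContinuousAt.comp (f := fun x => φ t x) this
      (φ.continuous continuous_const continuous_id).continuousAt)
  obtain ⟨a, ha1, ha2⟩ := exists_between h1
  obtain ⟨b, hb1, hb2⟩ := exists_between h2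
  refine ⟨a, b, ha2, hb1, ?_⟩
  filter_upwards [hB, (hcE (-τ) ⟨le_rfl, by linarith⟩).eventually (gt_mem_nhds ha1),
    (hcE τ ⟨by linarith, le_rfl⟩).eventually (lt_mem_nhds hb2)] with q' hq' hqa hqb u hu
  have hcont : ContinuousOn (fun t => (E (φ t q')).1) (Icc (-τ) τ) := fun t ht => by
    have := (E.continuousAt (hWE (hstay q' hq' t ht)))
    exact (continuousAt_fst.comp (ContinuousAt.comp (f := fun t => φ t q') this
      (φ.continuous continuous_id continuous_const).continuousAt)).continuousWithinAt
  -- Near `q`, the first coordinate is still below `a` at time `-τ` and above `b` at time `τ`, so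
  -- every level in between is crossed.
  obtain ⟨t, ht, htu⟩ := intermediate_value_Icc (by linarith) hcont
    ⟨(hqa.trans hu.1).le, (hu.2.trans hqb).le⟩
  exact ⟨t, (abs_le.2 ht).trans_lt hτκ, hstay q' hq' t ht, htu⟩

lemma levelArc_mem {u m r s : ℝ} (h : (u, m + r * s) ∈ E.target) : levelArc E u m r s ∈ E.source :=
  E.map_target h

lemma apply_levelArc {u m r s : ℝ} (h : (u, m + r * s) ∈ E.target) :
    E (levelArc E u m r s) = (u, m + r * s) := E.right_inv h

lemma continuousOn_levelArc {u m r : ℝ} {A : Set ℝ} (h : ∀ s ∈ A, (u, m + r * s) ∈ E.target) :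
    ContinuousOn (levelArc E u m r) A :=
  E.continuousOn_symm.comp (by fun_prop) h

/-- Flow boxes over vertical arcs. -/
lemma IsAdapted.exists_box (hE : IsAdapted φ E) {u m r : ℝ} (hr : 0 < r)
    (hT : ∀ s ∈ Icc (-2 : ℝ) 2, (u, m + r * s) ∈ E.target) :
    ∃ c > 0, ∃ e : OpenPartialHomeomorph (ℝ × ℝ) S, e.source = Ioo (-c) c ×ˢ Ioo (-2) 2 ∧
      ∀ z ∈ e.source, e z = φ z.1 (levelArc E u m r z.2) := by
  have hK : IsCompact (levelArc E u m r '' Icc (-2) 2) :=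
    isCompact_Icc.image_of_continuousOn (continuousOn_levelArc hT)
  have hev : ∀ᶠ t in 𝓝 (0 : ℝ), ∀ x ∈ levelArc E u m r '' Icc (-2) 2, φ t x ∈ E.source := by
    refine hK.eventually_forall_of_forall_eventually (P := fun t x => φ t x ∈ E.source) ?_
    rintro _ ⟨s, hs, rfl⟩
    exact (continuous_flow φ).continuousAt.eventually_mem
      (E.open_source.mem_nhds (by simpa using levelArc_mem (hT s hs)))
  obtain ⟨d, hd, hstay⟩ := Metric.eventually_nhds_iff_ball.1 hev
  have hstay' : ∀ t, |t| < d → ∀ s ∈ Icc (-2 : ℝ) 2, φ t (levelArc E u m r s) ∈ E.source :=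
    fun t ht s hs => hstay t (by rwa [Metric.mem_ball, Real.dist_0_eq_abs]) _ ⟨s, hs, rfl⟩
  refine ⟨d / 2, by positivity, exists_openPartialHomeomorph (isOpen_Ioo.prod isOpen_Ioo) ?_ ?_ ?_⟩
  · refine (continuous_flow φ).comp_continuousOn (continuousOn_fst.prodMk ?_)
    exact (continuousOn_levelArc hT).comp continuousOn_snd fun z hz => Ioo_subset_Icc_self hz.2
  -- Two times in the box differ by less than `d`, so the orbit stays in the chart in between. The
  -- first coordinate then increases strictly, and the orbit cannot return to the level `u`.
  · have key : ∀ z ∈ Ioo (-(d / 2)) (d / 2) ×ˢ Ioo (-2 : ℝ) 2,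
        ∀ z' ∈ Ioo (-(d / 2)) (d / 2) ×ˢ Ioo (-2 : ℝ) 2,
        φ z.1 (levelArc E u m r z.2) = φ z'.1 (levelArc E u m r z'.2) → z'.1 ≤ z.1 → z = z' := by
      intro z hz z' hz' e hle
      have hz2 := Ioo_subset_Icc_self hz.2
      have hz2' := Ioo_subset_Icc_self hz'.2
      have e' : φ (z.1 - z'.1) (levelArc E u m r z.2) = levelArc E u m r z'.2 := by
        rw [show z.1 - z'.1 = -z'.1 + z.1 by ring, φ.map_add, e, flow_neg_apply]
      rcases eq_or_lt_of_le hle with h1 | h1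
      · rw [h1, sub_self, φ.map_zero_apply] at e'
        have h2 := congrArg (fun x => (E x).2) e'
        simp only [apply_levelArc (hT _ hz2), apply_levelArc (hT _ hz2')] at h2
        exact Prod.ext h1.symm (mul_left_cancel₀ hr.ne' (add_left_cancel h2))
      · have h2 := hE (levelArc E u m r z.2) 0 (z.1 - z'.1) (by linarith) fun t ht =>
          hstay' t (by
            rw [abs_of_nonneg ht.1]
            linarith [ht.2, hz.1.2, hz'.1.1]) _ hz2
        rw [e', φ.map_zero_apply, apply_levelArc (hT _ hz2), apply_levelArc (hT _ hz2')] at h2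
        exact absurd h2 (lt_irrefl _)
    intro z hz z' hz' e
    rcases le_total z'.1 z.1 with hle | hle
    · exact key z hz z' hz' e hle
    · exact (key z' hz' z hz e.symm hle).symm
  · rintro ⟨t₀, s₀⟩ hz
    have hs₀ := hT s₀ (Ioo_subset_Icc_self hz.2)
    intro N hN
    rw [Filter.mem_map, Metric.mem_nhds_iff] at hN
    obtain ⟨κ, hκ, hball⟩ := hN
    -- The radius is `r * κ` because the arc parameter is the second coordinate divided by the scale
    -- `r`. A point near the image flows back to `W`, where it crosses the level `u` within time
    -- `κ`.
    set W := E.source ∩ E ⁻¹' (univ ×ˢ Metric.ball (m + r * s₀) (r * κ)) with hW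
    have hWo : IsOpen W := E.isOpen_inter_preimage (isOpen_univ.prod Metric.isOpen_ball)
    have hx₀ : levelArc E u m r s₀ ∈ W := by
      refine ⟨levelArc_mem hs₀, ?_⟩
      rw [mem_preimage, apply_levelArc hs₀]
      exact ⟨mem_univ _, Metric.mem_ball_self (by positivity)⟩
    obtain ⟨a, b, ha, hb, hx⟩ := hE.exists_crossing hWo inter_subset_left hx₀ hκ
    rw [apply_levelArc hs₀] at ha hb
    have htd : Filter.Tendsto (fun y => φ (-t₀) y) (𝓝 (φ t₀ (levelArc E u m r s₀)))
        (𝓝 (levelArc E u m r s₀)) := by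
      have : Continuous fun y => φ (-t₀) y := φ.continuous continuous_const continuous_id
      have h' := this.tendsto (φ t₀ (levelArc E u m r s₀))
      rwa [flow_neg_apply] at h'
    filter_upwards [htd.eventually hx] with y hy
    obtain ⟨τ, hτ, hτW, hτu⟩ := hy u ⟨ha, hb⟩
    set x := φ τ (φ (-t₀) y) with hxdef
    have hxE : x = levelArc E u m r (((E x).2 - m) / r) := by
      rw [levelArc, mul_div_cancel₀ _ hr.ne', add_sub_cancel, ← hτu, Prod.mk.eta,
        E.left_inv hτW.1]
    have hyx : y = φ (t₀ - τ) x := by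
      rw [hxdef, ← φ.map_add, ← φ.map_add]
      rw [show t₀ - τ + τ + -t₀ = 0 by ring, φ.map_zero_apply]
    have hmem : ((t₀ - τ, ((E x).2 - m) / r) : ℝ × ℝ) ∈ Metric.ball (t₀, s₀) κ := by
      rw [← ball_prod_same]
      refine ⟨?_, ?_⟩
      · rw [Metric.mem_ball, Real.dist_eq]
        simpa using hτ
      · have h1 := hτW.2.2
        rw [Metric.mem_ball, Real.dist_eq] at h1 ⊢
        rw [show ((E x).2 - m) / r - s₀ = ((E x).2 - (m + r * s₀)) / r by field_simp; ring,
          abs_div, abs_of_pos hr, div_lt_iff₀ hr]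
        linarith
    have := hball hmem
    rw [mem_preimage] at this
    dsimp only at this
    rwa [← hxE, ← hyx] at this

/-- A good arc: it has a flow box, its ends are off `M`, and it has the property `P`. -/
structure IsGoodArc (φ : Flow ℝ S) (M : Set S) (P : (ℝ → S) → Prop) (τ : ℝ → S) : Prop where
  box : ∃ c > 0, ∃ e : OpenPartialHomeomorph (ℝ × ℝ) S, e.source = Ioo (-c) c ×ˢ Ioo (-2) 2 ∧
      ∀ z ∈ e.source, e z = φ z.1 (τ z.2)
  left_notMem : τ (-1) ∉ M
  right_notMem : τ 1 ∉ M
  prop : P τ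

/-- A finite family of disjoint good arcs. -/
structure IsGoodFamily (φ : Flow ℝ S) (M : Set S) (P : (ℝ → S) → Prop) (𝒯 : Set (ℝ → S)) :
    Prop where
  finite : 𝒯.Finite
  good : ∀ τ ∈ 𝒯, IsGoodArc φ M P τ
  disjoint : ∀ τ ∈ 𝒯, ∀ ρ ∈ 𝒯, ∀ s ∈ Icc (-1 : ℝ) 1, ∀ u ∈ Icc (-1 : ℝ) 1, τ s = ρ u → τ = ρ

/-- The family `𝒯` is met by the orbits of all points of `Q` in short time. -/
def IsHit (φ : Flow ℝ S) (𝒯 : Set (ℝ → S)) (Q : Set S) : Prop :=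
  ∀ x ∈ Q, ∃ t : ℝ, |t| < 1 / 2 ∧ ∃ τ ∈ 𝒯, ∃ s ∈ Ioo (-1 : ℝ) 1, φ t x = τ s

variable {M : Set S} {P : (ℝ → S) → Prop}

lemma IsGoodArc.continuousOn {τ : ℝ → S} (h : IsGoodArc φ M P τ) :
    ContinuousOn τ (Icc (-1) 1) := by
  obtain ⟨c, hc, e, hs, he⟩ := h.box
  have hmem : ∀ s ∈ Icc (-1 : ℝ) 1, ((0 : ℝ), s) ∈ e.source := fun s hs' => by
    rw [hs]; exact ⟨⟨by linarith, hc⟩, by linarith [hs'.1], by linarith [hs'.2]⟩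
  have : ContinuousOn (fun s : ℝ => e ((0 : ℝ), s)) (Icc (-1) 1) :=
    e.continuousOn.comp (by fun_prop) hmem
  refine this.congr fun s hs' => ?_
  dsimp only
  rw [he _ (hmem s hs'), φ.map_zero_apply]

/-- An orbit passes between the arcs of a finite family. -/
lemma IsGoodFamily.exists_notMem {𝒯 : Set (ℝ → S)} (h : IsGoodFamily φ M P 𝒯) (y : S) {κ : ℝ}
    (hκ : 0 < κ) : ∃ t ∈ Ioo 0 κ, ∀ τ ∈ 𝒯, φ t y ∉ τ '' Icc (-1) 1 := by
  have hfin : ∀ τ ∈ 𝒯, ∃ c > 0, ∀ t t' : ℝ, |t - t'| < c → φ t y ∈ τ '' Icc (-1) 1 →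
      φ t' y ∈ τ '' Icc (-1) 1 → t = t' := by
    intro τ hτ
    obtain ⟨c, hc, e, hs, he⟩ := (h.good τ hτ).box
    refine ⟨c, hc, ?_⟩
    rintro t t' htt ⟨s, hs1, e1⟩ ⟨s', hs1', e1'⟩
    have m1 : ((0 : ℝ), s) ∈ e.source := by
      rw [hs]; exact ⟨⟨by linarith, hc⟩, by linarith [hs1.1], by linarith [hs1.2]⟩
    have m2 : (t - t', s') ∈ e.source := by
      rw [hs]; exact ⟨abs_lt.1 htt, by linarith [hs1'.1], by linarith [hs1'.2]⟩
    have := e.injOn m1 m2 (by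
      rw [he _ m1, he _ m2]
      dsimp only
      rw [e1, e1', φ.map_zero_apply, ← φ.map_add, sub_add_cancel])
    have := congrArg Prod.fst this
    dsimp only at this
    linarith
  choose! c hc hinj using hfin
  obtain ⟨d, hd, hdc⟩ := exists_pos_forall_le h.finite hc
  set B := ⋃ τ ∈ 𝒯, {t | t ∈ Ioo 0 (min κ d) ∧ φ t y ∈ τ '' Icc (-1) 1} with hB
  have hBf : B.Finite := h.finite.biUnion fun τ hτ => by
    -- During a time shorter than the flow box of an arc, an orbit meets this arc at most once.
    refine Set.Subsingleton.finite ?_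
    rintro t ⟨ht, h1⟩ t' ⟨ht', h1'⟩
    refine hinj τ hτ t t' ?_ h1 h1'
    have := hdc τ hτ
    have h2 := ht.2.trans_le (min_le_right κ d)
    have h3 := ht'.2.trans_le (min_le_right κ d)
    rw [abs_lt]; exact ⟨by linarith [ht.1], by linarith [ht'.1]⟩
  obtain ⟨t, ht, htB⟩ := (Ioo_infinite (lt_min hκ hd)).exists_notMem_finite hBf
  refine ⟨t, ⟨ht.1, ht.2.trans_le (min_le_left _ _)⟩, fun τ hτ hmem => htB ?_⟩
  exact mem_iUnion₂.2 ⟨τ, hτ, ht, hmem⟩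

/-- Vertical arcs contain points off `M`. -/
lemma IsAdapted.exists_notMem (hE : IsAdapted φ E) (hM : IsInvariant φ M) (h_int : interior M = ∅)
    {u a b : ℝ} (hab : a < b) (hT : ∀ v ∈ Icc a b, (u, v) ∈ E.target) :
    ∃ v ∈ Ioo a b, E.symm (u, v) ∉ M := by
  by_contra! hcon
  -- With this centre and scale, parameters in `[-2, 2]` fill exactly `[a, b]`. If the whole segment
  -- lay in the invariant set `M`, its open flow box would too.
  obtain ⟨c, hc, e, hs, he⟩ := hE.exists_box (u := u) (m := (a + b) / 2) (r := (b - a) / 4)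
    (by linarith) (fun s hs => hT _ ⟨by nlinarith [hs.1], by nlinarith [hs.2]⟩)
  have h0 : (0 : ℝ × ℝ) ∈ e.source := by rw [hs]; simp [hc]
  have hsub : e.target ⊆ M := by
    intro y hy
    rw [← e.right_inv hy, he _ (e.map_target hy)]
    have := e.map_target hy
    rw [hs] at this
    exact hM _ (hcon _ ⟨by nlinarith [this.2.1], by nlinarith [this.2.2]⟩)
  have := interior_maximal hsub e.open_target (e.map_source h0)
  rw [h_int] at this
  exact this

variable [T2Space S]

/-- The point is first moved along its orbit off the existing arcs. A small vertical arc through a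
nearby level then misses them, and its ends are moved off `M`. The freedom in the level `u` is what
keeps arcs of the same chart apart. -/
lemma IsAdapted.exists_arc (hE : IsAdapted φ E) (hM : IsInvariant φ M) (h_int : interior M = ∅)
    (hP : ∀ u m r : ℝ, 0 < r → (∀ s ∈ Icc (-2 : ℝ) 2, (u, m + r * s) ∈ E.target) →
      P (levelArc E u m r))
    {𝒯 : Set (ℝ → S)} (h𝒯 : IsGoodFamily φ M P 𝒯) {y : S} (hy : y ∈ E.source) :
    ∃ N ∈ 𝓝 y, ∀ Z : Set ℝ, Z.Finite → ∃ τ : ℝ → S, IsGoodArc φ M P τ ∧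
      (∃ u ∉ Z, ∀ s ∈ Icc (-1 : ℝ) 1, τ s ∈ E.source ∧ (E (τ s)).1 = u) ∧
      (∀ τ' ∈ 𝒯, ∀ s ∈ Icc (-1 : ℝ) 1, ∀ s' ∈ Icc (-1 : ℝ) 1, τ s ≠ τ' s') ∧
      IsHit φ {τ} N := by
  have hcy : Continuous fun t => φ t y := φ.continuous continuous_id continuous_const
  have hsrc : ∀ᶠ t in 𝓝 (0 : ℝ), φ t y ∈ E.source :=
    hcy.continuousAt.eventually_mem (E.open_source.mem_nhds (by simpa using hy))
  obtain ⟨κ, hκ, hκE⟩ := Metric.eventually_nhds_iff_ball.1 hsrc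
  -- At most `1/4` is spent on leaving the old arcs and `1/4` on crossing the new one, which keeps
  -- the hitting time below `1/2`.
  obtain ⟨t, ht, htT⟩ := h𝒯.exists_notMem y (lt_min hκ (show (0 : ℝ) < 1 / 4 by norm_num))
  have ht1 := ht.2.trans_le (min_le_left _ _)
  have ht2 := ht.2.trans_le (min_le_right _ _)
  set q := φ t y with hq
  have hqE : q ∈ E.source := hκE t (by
    rw [Metric.mem_ball, Real.dist_0_eq_abs, abs_of_pos ht.1]; exact ht1)
  have hTcl : IsClosed (⋃ τ ∈ 𝒯, τ '' Icc (-1) 1) :=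
    h𝒯.finite.isClosed_biUnion fun τ hτ =>
      (isCompact_Icc.image_of_continuousOn (h𝒯.good τ hτ).continuousOn).isClosed
  set O := E.target ∩ E.symm ⁻¹' (⋃ τ ∈ 𝒯, τ '' Icc (-1) 1)ᶜ with hO
  have hOo : IsOpen O := E.symm.isOpen_inter_preimage hTcl.isOpen_compl
  have hqO : E q ∈ O := by
    refine ⟨E.map_source hqE, ?_⟩
    rw [mem_preimage, E.left_inv hqE]
    simpa using htT
  obtain ⟨r, hr, hrO⟩ := Metric.isOpen_iff.1 hOo _ hqO
  rw [← Prod.mk.eta (p := E q), ← ball_prod_same] at hrO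
  set u₀ := (E q).1 with hu₀
  set v₀ := (E q).2 with hv₀
  set d := r / 4 with hd
  have hd0 : 0 < d := by positivity
  set W := E.source ∩ E ⁻¹' (univ ×ˢ Metric.ball v₀ (d / 2)) with hW
  have hWo : IsOpen W := E.isOpen_inter_preimage (isOpen_univ.prod Metric.isOpen_ball)
  have hqW : q ∈ W := ⟨hqE, mem_univ _, Metric.mem_ball_self (by positivity)⟩
  obtain ⟨a, b, ha, hb, hx⟩ := hE.exists_crossing hWo inter_subset_left hqW
    (show (0 : ℝ) < 1 / 4 by norm_num)
  have hct : Continuous fun x => φ t x := φ.continuous continuous_const continuous_id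
  refine ⟨_, hct.continuousAt.eventually hx, fun Z hZ => ?_⟩
  obtain ⟨u, hu, huZ⟩ := (Ioo_infinite (show max a (u₀ - r) < min b (u₀ + r) from
    max_lt (lt_min (ha.trans hb) (by linarith)) (lt_min (by linarith) (by linarith)))
    ).exists_notMem_finite hZ
  have hua : a < u := (le_max_left _ _).trans_lt hu.1
  have hub : u < b := hu.2.trans_le (min_le_left _ _)
  have hur : u ∈ Metric.ball u₀ r := by
    rw [Real.ball_eq_Ioo]
    exact ⟨(le_max_right _ _).trans_lt hu.1, hu.2.trans_le (min_le_right _ _)⟩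
  have hball : ∀ v, |v - v₀| < r → (u, v) ∈ O := fun v hv =>
    hrO ⟨hur, by rwa [Metric.mem_ball, Real.dist_eq]⟩
  -- The ends are sought at distance between `d / 2` and `d` from `v₀`: beyond all the crossings,
  -- which occur within `d / 2`, and close enough for the doubled arc to stay within `r = 4 * d`.
  obtain ⟨v₁, hv₁, hv₁M⟩ := hE.exists_notMem hM h_int (u := u) (a := v₀ - d) (b := v₀ - d / 2)
    (by linarith) fun v hv => (hball v (by rw [abs_lt]; constructor <;> linarith [hv.1, hv.2])).1
  obtain ⟨v₂, hv₂, hv₂M⟩ := hE.exists_notMem hM h_int (u := u) (a := v₀ + d / 2) (b := v₀ + d)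
    (by linarith) fun v hv => (hball v (by rw [abs_lt]; constructor <;> linarith [hv.1, hv.2])).1
  have hv1a := hv₁.1
  have hv1b := hv₁.2
  have hv2a := hv₂.1
  have hv2b := hv₂.2
  set m := (v₁ + v₂) / 2 with hm
  set ρ := (v₂ - v₁) / 2 with hρ
  have hρ0 : 0 < ρ := by linarith
  have hO2 : ∀ s ∈ Icc (-2 : ℝ) 2, (u, m + ρ * s) ∈ O := fun s hs => hball _ (by
    rw [abs_lt]; constructor <;> nlinarith [hs.1, hs.2])
  have hO1 : ∀ s ∈ Icc (-1 : ℝ) 1, (u, m + ρ * s) ∈ O := fun s hs =>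
    hO2 s ⟨by linarith [hs.1], by linarith [hs.2]⟩
  refine ⟨levelArc E u m ρ, ⟨hE.exists_box hρ0 fun s hs => (hO2 s hs).1, ?_, ?_,
    hP u m ρ hρ0 fun s hs => (hO2 s hs).1⟩, ⟨u, huZ, fun s hs => ⟨levelArc_mem (hO1 s hs).1, ?_⟩⟩,
    fun τ' hτ' s hs s' hs' e => ?_, fun x hx' => ?_⟩
  · rw [levelArc, show m + ρ * -1 = v₁ by rw [hm, hρ]; ring]; exact hv₁M
  · rw [levelArc, show m + ρ * 1 = v₂ by rw [hm, hρ]; ring]; exact hv₂M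
  · rw [apply_levelArc (hO1 s hs).1]
  · exact (hO1 s hs).2 (mem_iUnion₂.2 ⟨τ', hτ', s', hs', e.symm⟩)
  · obtain ⟨θ, hθ, hθW, hθu⟩ := hx' u ⟨hua, hub⟩
    rw [← φ.map_add] at hθW hθu
    refine ⟨θ + t, ?_, _, rfl, ((E (φ (θ + t) x)).2 - m) / ρ, ?_, ?_⟩
    · have := abs_lt.1 hθ
      rw [abs_lt]; constructor <;> linarith [ht.1, this.1, this.2]
    · have h1 := hθW.2.2
      rw [Real.ball_eq_Ioo] at h1
      refine ⟨?_, ?_⟩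
      · rw [lt_div_iff₀ hρ0]; linarith [h1.1]
      · rw [div_lt_iff₀ hρ0]; linarith [h1.2]
    · rw [levelArc, mul_div_cancel₀ _ hρ0.ne', add_sub_cancel, ← hθu, Prod.mk.eta,
        E.left_inv hθW.1]

lemma IsHit.mono {𝒯 𝒯' : Set (ℝ → S)} {Q Q' : Set S} (h : IsHit φ 𝒯 Q) (h𝒯 : 𝒯 ⊆ 𝒯')
    (hQ : Q' ⊆ Q) : IsHit φ 𝒯' Q' := fun x hx => by
  obtain ⟨t, ht, τ, hτ, H⟩ := h x (hQ hx)
  exact ⟨t, ht, τ, h𝒯 hτ, H⟩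

lemma IsHit.union {𝒯 : Set (ℝ → S)} {Q Q' : Set S} (h₁ : IsHit φ 𝒯 Q) (h₂ : IsHit φ 𝒯 Q') :
    IsHit φ 𝒯 (Q ∪ Q') := fun x hx => hx.elim (h₁ x) (h₂ x)

/-- A family of arcs can be extended so as to be met from a compact set in an adapted chart. -/
lemma IsAdapted.exists_extension (hE : IsAdapted φ E) (hM : IsInvariant φ M)
    (h_int : interior M = ∅)
    (hP : ∀ u m r : ℝ, 0 < r → (∀ s ∈ Icc (-2 : ℝ) 2, (u, m + r * s) ∈ E.target) →
      P (levelArc E u m r))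
    {𝒯 : Set (ℝ → S)} (h𝒯 : IsGoodFamily φ M P 𝒯) {Q : Set S} (hQ : IsCompact Q)
    (hQE : Q ⊆ E.source) : ∃ 𝒯', 𝒯 ⊆ 𝒯' ∧ IsGoodFamily φ M P 𝒯' ∧ IsHit φ 𝒯' Q := by
  -- The finite set `Z` of forbidden levels strengthens the induction: when two subfamilies are
  -- joined, the second avoids the levels of the first and so is disjoint from it.
  have key : ∀ Z : Set ℝ, Z.Finite → ∃ 𝒜 : Set (ℝ → S), IsGoodFamily φ M P 𝒜 ∧
      (∀ τ ∈ 𝒜, ∃ u ∉ Z, ∀ s ∈ Icc (-1 : ℝ) 1, τ s ∈ E.source ∧ (E (τ s)).1 = u) ∧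
      (∀ τ ∈ 𝒜, ∀ τ' ∈ 𝒯, ∀ s ∈ Icc (-1 : ℝ) 1, ∀ s' ∈ Icc (-1 : ℝ) 1, τ s ≠ τ' s') ∧
      IsHit φ 𝒜 Q := by
    refine hQ.induction_on (p := fun Q => ∀ Z : Set ℝ, Z.Finite → ∃ 𝒜 : Set (ℝ → S),
      IsGoodFamily φ M P 𝒜 ∧
      (∀ τ ∈ 𝒜, ∃ u ∉ Z, ∀ s ∈ Icc (-1 : ℝ) 1, τ s ∈ E.source ∧ (E (τ s)).1 = u) ∧
      (∀ τ ∈ 𝒜, ∀ τ' ∈ 𝒯, ∀ s ∈ Icc (-1 : ℝ) 1, ∀ s' ∈ Icc (-1 : ℝ) 1, τ s ≠ τ' s') ∧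
      IsHit φ 𝒜 Q) ?_ ?_ ?_ ?_
    · intro Z _
      exact ⟨∅, ⟨finite_empty, by simp, by simp⟩, by simp, by simp, fun x hx => hx.elim⟩
    · intro Q Q' hsub h Z hZ
      obtain ⟨𝒜, h1, h2, h3, h4⟩ := h Z hZ
      exact ⟨𝒜, h1, h2, h3, h4.mono Subset.rfl hsub⟩
    · intro Q Q' h h' Z hZ
      obtain ⟨𝒜, h1, h2, h3, h4⟩ := h Z hZ
      obtain ⟨ℬ, k1, k2, k3, k4⟩ := h' (Z ∪ (fun τ => (E (τ 0)).1) '' 𝒜) (hZ.union (h1.finite.image _))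
      have h0 : (0 : ℝ) ∈ Icc (-1 : ℝ) 1 := by constructor <;> norm_num
      have hdis : ∀ τ ∈ 𝒜, ∀ τ' ∈ ℬ, ∀ s ∈ Icc (-1 : ℝ) 1, ∀ s' ∈ Icc (-1 : ℝ) 1,
          τ s ≠ τ' s' := by
        intro τ hτ τ' hτ' s hs s' hs' e
        obtain ⟨u, -, hu⟩ := h2 τ hτ
        obtain ⟨u', hu', hu''⟩ := k2 τ' hτ'
        refine hu' (Or.inr ⟨τ, hτ, ?_⟩)
        dsimp only
        rw [(hu 0 h0).2, ← (hu s hs).2, e, (hu'' s' hs').2]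
      refine ⟨𝒜 ∪ ℬ, ⟨h1.finite.union k1.finite, ?_, ?_⟩, ?_, ?_,
        (h4.mono subset_union_left Subset.rfl).union (k4.mono subset_union_right Subset.rfl)⟩
      · rintro τ (hτ | hτ)
        · exact h1.good τ hτ
        · exact k1.good τ hτ
      · rintro τ (hτ | hτ) τ' (hτ' | hτ') s hs s' hs' e
        · exact h1.disjoint τ hτ τ' hτ' s hs s' hs' e
        · exact absurd e (hdis τ hτ τ' hτ' s hs s' hs')
        · exact absurd e.symm (hdis τ' hτ' τ hτ s' hs' s hs)
        · exact k1.disjoint τ hτ τ' hτ' s hs s' hs' e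
      · rintro τ (hτ | hτ)
        · exact h2 τ hτ
        · obtain ⟨u, hu, H⟩ := k2 τ hτ
          exact ⟨u, fun h => hu (Or.inl h), H⟩
      · rintro τ (hτ | hτ)
        · exact h3 τ hτ
        · exact k3 τ hτ
    · intro y hy
      obtain ⟨N, hN, H⟩ := hE.exists_arc hM h_int hP h𝒯 (hQE hy)
      refine ⟨N, mem_nhdsWithin_of_mem_nhds hN, fun Z hZ => ?_⟩
      obtain ⟨τ, h1, h2, h3, h4⟩ := H Z hZ
      refine ⟨{τ}, ⟨finite_singleton τ, ?_, ?_⟩, ?_, ?_, h4⟩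
      · rintro _ rfl; exact h1
      · rintro _ rfl _ rfl _ _ _ _ _; rfl
      · rintro _ rfl; exact h2
      · rintro _ rfl; exact h3
  obtain ⟨𝒜, h1, -, h3, h4⟩ := key ∅ finite_empty
  refine ⟨𝒯 ∪ 𝒜, subset_union_left, ⟨h𝒯.finite.union h1.finite, ?_, ?_⟩,
    h4.mono subset_union_right Subset.rfl⟩
  · rintro τ (hτ | hτ)
    · exact h𝒯.good τ hτ
    · exact h1.good τ hτ
  · rintro τ (hτ | hτ) τ' (hτ' | hτ') s hs s' hs' e
    · exact h𝒯.disjoint τ hτ τ' hτ' s hs s' hs' e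
    · exact absurd e.symm (h3 τ' hτ' τ hτ s' hs' s hs)
    · exact absurd e (h3 τ hτ τ' hτ' s hs s' hs')
    · exact h1.disjoint τ hτ τ' hτ' s hs s' hs' e

/-- Existence of cross-sections: if every point of the frontier of `Γ` has an adapted chart, then
there is a cross-section consisting of vertical arcs of such charts. -/
theorem exists_isCrossSection [CompactSpace S] {Γ : Set S} (hΓ : IsClosed Γ)
    (hinv : IsInvariant φ Γ) (hiso : ∀ x ∈ Γ, ¬ IsIsolatedOrbit φ Γ x)
    (hchart : ∀ p ∈ Γ, ∃ E : OpenPartialHomeomorph S (ℝ × ℝ), p ∈ E.source ∧ IsAdapted φ E ∧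
      ∀ u m r : ℝ, 0 < r → (∀ s ∈ Icc (-2 : ℝ) 2, (u, m + r * s) ∈ E.target) →
        P (levelArc E u m r)) :
    ∃ (𝒯 : Set (ℝ → S)) (c : ℝ), 𝒯.Finite ∧
      IsCrossSection φ Γ (fun τ : 𝒯 => (τ : ℝ → S)) c ∧ ∀ τ ∈ 𝒯, P τ := by
  have hM := invariant_frontier hinv
  have h_int := interior_frontier hΓ
  have hMc : IsCompact (frontier Γ) := isClosed_frontier.isCompact
  -- The induction over compact pieces quantifies over the starting family, so that the family
  -- produced for one piece can be extended for the next.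
  have key : ∀ 𝒯, IsGoodFamily φ (frontier Γ) P 𝒯 →
      ∃ 𝒯', 𝒯 ⊆ 𝒯' ∧ IsGoodFamily φ (frontier Γ) P 𝒯' ∧ IsHit φ 𝒯' (frontier Γ) := by
    refine hMc.induction_on (p := fun Q => ∀ 𝒯, IsGoodFamily φ (frontier Γ) P 𝒯 →
      ∃ 𝒯', 𝒯 ⊆ 𝒯' ∧ IsGoodFamily φ (frontier Γ) P 𝒯' ∧ IsHit φ 𝒯' Q) ?_ ?_ ?_ ?_
    · intro 𝒯 h𝒯
      exact ⟨𝒯, Subset.rfl, h𝒯, fun x hx => hx.elim⟩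
    · intro Q Q' hsub h 𝒯 h𝒯
      obtain ⟨𝒯', h1, h2, h3⟩ := h 𝒯 h𝒯
      exact ⟨𝒯', h1, h2, h3.mono Subset.rfl hsub⟩
    · intro Q Q' h h' 𝒯 h𝒯
      obtain ⟨𝒯', h1, h2, h3⟩ := h 𝒯 h𝒯
      obtain ⟨𝒯'', k1, k2, k3⟩ := h' 𝒯' h2
      exact ⟨𝒯'', h1.trans k1, k2, (h3.mono k1 Subset.rfl).union k3⟩
    · intro p hp
      obtain ⟨E, hpE, hE, hP⟩ := hchart p (hΓ.frontier_subset hp)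
      obtain ⟨K, hK, hpK, hKE⟩ := exists_compact_subset E.open_source hpE
      exact ⟨K, mem_nhdsWithin_of_mem_nhds (mem_interior_iff_mem_nhds.1 hpK), fun 𝒯 h𝒯 =>
        hE.exists_extension hM h_int hP h𝒯 hK hKE⟩
  obtain ⟨𝒯, -, h𝒯, hhit⟩ := key ∅ ⟨finite_empty, by simp, by simp⟩
  have hbox := fun τ (hτ : τ ∈ 𝒯) => (h𝒯.good τ hτ).box
  choose! c hc hbox using hbox
  obtain ⟨d, hd, hdc⟩ := exists_pos_forall_le h𝒯.finite hc
  refine ⟨𝒯, d, h𝒯.finite, ⟨hΓ, hinv, hiso, hd, ?_, ?_, fun τ => (h𝒯.good τ τ.2).left_notMem,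
    fun τ => (h𝒯.good τ τ.2).right_notMem, fun x hx => ?_⟩, fun τ hτ => (h𝒯.good τ hτ).prop⟩
  · rintro ⟨τ, hτ⟩
    obtain ⟨e, hs, he⟩ := hbox τ hτ
    have hle := hdc τ hτ
    have hsub : Ioo (-d) d ×ˢ Ioo (-2 : ℝ) 2 ⊆ e.source := by
      rw [hs]; exact prod_mono (Ioo_subset_Ioo (by linarith) hle) Subset.rfl
    have hsrc : (e.restrOpen (Ioo (-d) d ×ˢ Ioo (-2 : ℝ) 2) (isOpen_Ioo.prod isOpen_Ioo)).source =
        Ioo (-d) d ×ˢ Ioo (-2 : ℝ) 2 := by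
      rw [OpenPartialHomeomorph.restrOpen_source, inter_eq_right.2 hsub]
    refine ⟨_, hsrc, fun z hz => ?_⟩
    rw [hsrc] at hz
    exact he z (hsub hz)
  · rintro ⟨τ, hτ⟩ ⟨τ', hτ'⟩ s hs s' hs' e
    exact Subtype.ext (h𝒯.disjoint τ hτ τ' hτ' s hs s' hs' e)
  · obtain ⟨t, ht, τ, hτ, s, hs, e⟩ := hhit x hx
    exact ⟨t, ht, ⟨τ, hτ⟩, s, hs, e⟩

end ExistsCrossSection

end Dumbbell

namespace Dumbbell

/-! ### Adapted charts of an integrated vector field -/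

section AdaptedCharts

/-- A linear isomorphism whose first coordinate is positive at a given nonzero vector. -/
lemma exists_equiv_fst_pos {v : Plane} (hv : v ≠ 0) :
    ∃ A : Plane ≃L[ℝ] ℝ × ℝ, 0 < (A v).1 := by
  have hpos : 0 < v 0 ^ 2 + v 1 ^ 2 := by
    by_contra hcon
    refine hv (PiLp.ext fun i => ?_)
    fin_cases i
    · have : v 0 = 0 := by nlinarith [sq_nonneg (v 0), sq_nonneg (v 1)]
      simpa using this
    · have : v 1 = 0 := by nlinarith [sq_nonneg (v 0), sq_nonneg (v 1)]
      simpa using this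
  let p0 : Plane →ₗ[ℝ] ℝ := (EuclideanSpace.proj (0 : Fin 2) : Plane →L[ℝ] ℝ)
  let p1 : Plane →ₗ[ℝ] ℝ := (EuclideanSpace.proj (1 : Fin 2) : Plane →L[ℝ] ℝ)
  -- The inner products with `v` and with `v` rotated by a quarter turn; the first takes the value
  -- `|v|²` at `v`.
  let f : Plane →ₗ[ℝ] ℝ × ℝ := (v 0 • p0 + v 1 • p1).prod (-v 1 • p0 + v 0 • p1)
  have hf : ∀ x : Plane, f x = (v 0 * x 0 + v 1 * x 1, -v 1 * x 0 + v 0 * x 1) := fun x => rfl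
  have hinj : Function.Injective f := by
    rw [injective_iff_map_eq_zero]
    intro x hx
    rw [hf, Prod.mk_eq_zero] at hx
    obtain ⟨h1, h2⟩ := hx
    refine PiLp.ext fun i => ?_
    fin_cases i
    · have : (v 0 ^ 2 + v 1 ^ 2) * x 0 = 0 := by linear_combination v 0 * h1 - v 1 * h2
      simpa using (mul_eq_zero.1 this).resolve_left hpos.ne'
    · have : (v 0 ^ 2 + v 1 ^ 2) * x 1 = 0 := by linear_combination v 1 * h1 + v 0 * h2
      simpa using (mul_eq_zero.1 this).resolve_left hpos.ne'
  refine ⟨(LinearEquiv.ofInjectiveOfFinrankEq f hinj (by simp)).toContinuousLinearEquiv, ?_⟩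
  have : (f v).1 = v 0 ^ 2 + v 1 ^ 2 := by rw [hf]; ring
  exact this ▸ hpos

variable {S : Type*} [TopologicalSpace S] [ChartedSpace Plane S] [IsManifold (𝓡 2) 1 S]
  {X : (x : S) → TangentSpace (𝓡 2) x} {φ : Flow ℝ S}

/-- The vector field `X` read in the chart at `p`. -/
noncomputable def chartField (X : (x : S) → TangentSpace (𝓡 2) x) (p x : S) : Plane :=
  mfderiv (𝓡 2) 𝓘(ℝ, Plane) (extChartAt (𝓡 2) p) x (X x)

/-- On the chart domain, the derivative of the chart applied to `X` is the fibre coordinate of `X`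
in the tangent bundle trivialization, so continuity of the section suffices. -/
lemma continuousOn_chartField (hX : Continuous fun x => (⟨x, X x⟩ : TangentBundle (𝓡 2) S))
    (p : S) : ContinuousOn (chartField X p) (chartAt Plane p).source := by
  set e := trivializationAt Plane (TangentSpace (𝓡 2) : S → Type _) p
  have hb : e.baseSet = (chartAt Plane p).source := TangentBundle.trivializationAt_baseSet p
  have hc : ContinuousOn (fun x => (e ⟨x, X x⟩).2) (chartAt Plane p).source := by
    refine continuous_snd.comp_continuousOn (e.continuousOn.comp hX.continuousOn fun x hx => ?_)
    rw [e.mem_source, hb]; exact hx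
  refine hc.congr fun x hx => ?_
  have h1 := DFunLike.congr_fun (TangentBundle.continuousLinearMapAt_trivializationAt (I := 𝓡 2) hx)
    (X x)
  have h2 : e.continuousLinearMapAt ℝ x (X x) = (e ⟨x, X x⟩).2 := by
    rw [Trivialization.continuousLinearMapAt_apply,
      Trivialization.coe_linearMapAt_of_mem _ (hb ▸ hx)]
  exact h1.symm.trans h2

lemma chartField_ne_zero {p : S} (hp : X p ≠ 0) : chartField X p p ≠ 0 := by
  intro h0
  have hinv := isInvertible_mfderiv_extChartAt (I := 𝓡 2) (mem_extChartAt_source (I := 𝓡 2) p)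
  obtain ⟨A, hA⟩ := hinv
  rw [chartField, ← hA] at h0
  exact hp (A.injective (h0.trans (map_zero A).symm))

lemma hasDerivAt_of_hasMFDerivAt {f : ℝ → Plane} {t : ℝ}
    {f' : TangentSpace 𝓘(ℝ, ℝ) t →L[ℝ] TangentSpace 𝓘(ℝ, Plane) (f t)}
    (h : HasMFDerivAt 𝓘(ℝ, ℝ) 𝓘(ℝ, Plane) f t f') : HasDerivAt f (f' (1 : ℝ)) t :=
  HasFDerivAt.hasDerivAt (𝕜 := ℝ) (F := Plane) (hasMFDerivAt_iff_hasFDerivAt.1 h)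

lemma hasDerivAt_chart (hφ : ∀ x, IsMIntegralCurve (fun t => φ t x) X) (p x : S) {t : ℝ}
    (ht : φ t x ∈ (chartAt Plane p).source) :
    HasDerivAt (fun t => extChartAt (𝓡 2) p (φ t x)) (chartField X p (φ t x)) t := by
  have h1 := hφ x t
  have h2 := ((contMDiffAt_extChartAt' (I := 𝓡 2) (n := 1) ht).mdifferentiableAt
    one_ne_zero).hasMFDerivAt
  have h3 := hasDerivAt_of_hasMFDerivAt (HasMFDerivAt.comp t h2 h1)
  have h4 : ((1 : ℝ →L[ℝ] ℝ).smulRight (X (φ t x)) : ℝ →L[ℝ] TangentSpace (𝓡 2) (φ t x)) 1 =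
      X (φ t x) := by simp
  have h5 : chartField X p (φ t x) = mfderiv (𝓡 2) 𝓘(ℝ, Plane) (extChartAt (𝓡 2) p) (φ t x)
      (((1 : ℝ →L[ℝ] ℝ).smulRight (X (φ t x)) : ℝ →L[ℝ] TangentSpace (𝓡 2) (φ t x)) 1) :=
    (congrArg (mfderiv (𝓡 2) 𝓘(ℝ, Plane) (extChartAt (𝓡 2) p) (φ t x)) h4).symm
  rw [h5]; exact h3

/-- Orbits are `C¹`. -/
lemma contMDiff_orbit (hX : Continuous fun x => (⟨x, X x⟩ : TangentBundle (𝓡 2) S))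
    (hφ : ∀ x, IsMIntegralCurve (fun t => φ t x) X) (x : S) :
    ContMDiff 𝓘(ℝ, ℝ) (𝓡 2) 1 (fun t => φ t x) := by
  intro t
  have hc : Continuous fun t => φ t x := φ.continuous continuous_id continuous_const
  refine contMDiffAt_iff_target.2 ⟨hc.continuousAt, ?_⟩
  rw [contMDiffAt_iff_contDiffAt]
  set p := φ t x with hp
  set u := (fun t => φ t x) ⁻¹' (chartAt Plane p).source with hu
  have huo : IsOpen u := (chartAt Plane p).open_source.preimage hc
  refine contDiffAt_one_iff.2 ⟨fun r => ContinuousLinearMap.toSpanSingleton ℝ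
    (chartField X p (φ r x)), u, huo.mem_nhds (mem_chart_source _ p), ?_, fun r hr => ?_⟩
  · have h1 : ContinuousOn (fun r => chartField X p (φ r x)) u :=
      (continuousOn_chartField hX p).comp hc.continuousOn fun r hr => hr
    exact (ContinuousLinearMap.toSpanSingletonCLE (𝕜 := ℝ) (E := Plane)).continuous.comp_continuousOn h1
  · exact (hasDerivAt_chart hφ p x hr).hasFDerivAt

/-- The arc `τ` is of class `C¹` and transverse to `X`. -/
def IsTransverseArc (X : (x : S) → TangentSpace (𝓡 2) x) (τ : ℝ → S) : Prop :=
  ∀ s ∈ Icc (-1 : ℝ) 1, ContMDiffAt 𝓘(ℝ, ℝ) (𝓡 2) 1 τ s ∧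
    LinearIndependent ℝ ![mfderiv 𝓘(ℝ, ℝ) (𝓡 2) τ s 1, X (τ s)]

/-- A linear change of coordinates makes the first component of `X` positive at `p`, hence nearby by
continuity. There the first coordinate has positive derivative along orbits, while vertical arcs
have velocity with first component zero. -/
lemma exists_isAdapted (hX : Continuous fun x => (⟨x, X x⟩ : TangentBundle (𝓡 2) S))
    (hφ : ∀ x, IsMIntegralCurve (fun t => φ t x) X) {p : S} (hp : X p ≠ 0) :
    ∃ E : OpenPartialHomeomorph S (ℝ × ℝ), p ∈ E.source ∧ IsAdapted φ E ∧
      ∀ u m r : ℝ, 0 < r → (∀ s ∈ Icc (-2 : ℝ) 2, (u, m + r * s) ∈ E.target) →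
        IsTransverseArc X (levelArc E u m r) := by
  obtain ⟨A, hA⟩ := exists_equiv_fst_pos (chartField_ne_zero hp)
  set C := chartAt Plane p with hC
  set U := C.source ∩ (fun x => (A (chartField X p x)).1) ⁻¹' Ioi 0 with hU
  have hUo : IsOpen U :=
    (continuous_fst.comp_continuousOn (A.continuous.comp_continuousOn
      (continuousOn_chartField hX p))).isOpen_inter_preimage C.open_source isOpen_Ioi
  set E := (C.trans A.toHomeomorph.toOpenPartialHomeomorph).restrOpen U hUo with hE
  have hsrc : ∀ x, x ∈ E.source ↔ x ∈ U := fun x => by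
    rw [hE, OpenPartialHomeomorph.restrOpen_source]
    exact ⟨fun h => h.2, fun h => ⟨by simpa using h.1, h⟩⟩
  have happ : ∀ x, E x = A (extChartAt (𝓡 2) p x) := fun x => rfl
  have hsymm : ∀ z, E.symm z = (extChartAt (𝓡 2) p).symm (A.symm z) := fun z => rfl
  refine ⟨E, (hsrc p).2 ⟨mem_chart_source _ p, hA⟩, ?_, ?_⟩
  · intro x a b hab hmem
    have hd : ∀ t ∈ Icc a b, HasDerivAt (fun t => (E (φ t x)).1)
        (A (chartField X p (φ t x))).1 t := fun t ht => by
      have h1 := hasDerivAt_chart hφ p x ((hsrc _).1 (hmem t ht)).1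
      have h2 := (A : Plane →L[ℝ] ℝ × ℝ).hasFDerivAt.comp_hasDerivAt t h1
      exact (ContinuousLinearMap.fst ℝ ℝ ℝ).hasFDerivAt.comp_hasDerivAt t h2
    refine strictMonoOn_of_deriv_pos (convex_Icc a b)
      (fun t ht => (hd t ht).continuousAt.continuousWithinAt) (fun t ht => ?_)
      ⟨le_rfl, hab.le⟩ ⟨hab.le, le_rfl⟩ hab
    rw [(hd t (interior_subset ht)).deriv]
    exact ((hsrc _).1 (hmem t (interior_subset ht))).2
  · intro u m r hr hT s hs
    have hev : ∀ᶠ s' in 𝓝 s, (u, m + r * s') ∈ E.target := by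
      filter_upwards [Ioo_mem_nhds (show (-2 : ℝ) < s by linarith [hs.1])
        (show s < 2 by linarith [hs.2])] with s' hs'
      exact hT s' (Ioo_subset_Icc_self hs')
    have htE := hT s ⟨by linarith [hs.1], by linarith [hs.2]⟩
    have hmemU := (hsrc _).1 (levelArc_mem htE)
    have happτ : ∀ s', (u, m + r * s') ∈ E.target →
        extChartAt (𝓡 2) p (levelArc E u m r s') = A.symm (u, m + r * s') := fun s' hs' => by
      rw [← apply_levelArc hs', happ, A.symm_apply_apply]
    have htarget : A.symm (u, m + r * s) ∈ (extChartAt (𝓡 2) p).target := by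
      rw [← happτ s htE]
      refine (extChartAt (𝓡 2) p).map_source ?_
      rw [extChartAt_source]; exact hmemU.1
    have hd : HasDerivAt (fun s' => A.symm (u, m + r * s')) (A.symm (0, r)) s := by
      have h1 : HasDerivAt (fun s' : ℝ => (u, m + r * s')) (0, r) s := by
        refine (hasDerivAt_const s u).prodMk ?_
        simpa using ((hasDerivAt_id s).const_mul r).const_add m
      exact (A.symm : ℝ × ℝ →L[ℝ] Plane).hasFDerivAt.comp_hasDerivAt s h1
    have hcd : ContDiff ℝ 1 (fun s' : ℝ => A.symm (u, m + r * s')) :=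
      A.symm.contDiff.comp (by fun_prop)
    have hsm : ContMDiffAt 𝓘(ℝ, ℝ) (𝓡 2) 1 (levelArc E u m r) s := by
      have h1 := (contMDiffOn_extChartAt_symm (I := 𝓡 2) (n := 1) p).contMDiffAt
        ((isOpen_extChartAt_target (I := 𝓡 2) p).mem_nhds htarget)
      exact ContMDiffAt.comp (g := (extChartAt (𝓡 2) p).symm)
        (f := fun s' => A.symm (u, m + r * s')) s h1 hcd.contMDiff.contMDiffAt
    refine ⟨hsm, ?_⟩
    set V := mfderiv 𝓘(ℝ, ℝ) (𝓡 2) (levelArc E u m r) s 1 with hV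
    set D := mfderiv (𝓡 2) 𝓘(ℝ, Plane) (extChartAt (𝓡 2) p) (levelArc E u m r s) with hD
    have hDV : D V = A.symm (0, r) := by
      have h2 := ((contMDiffAt_extChartAt' (I := 𝓡 2) (n := 1) hmemU.1).mdifferentiableAt
        one_ne_zero).hasMFDerivAt
      have h1 := (hsm.mdifferentiableAt one_ne_zero).hasMFDerivAt
      have h3 := hasDerivAt_of_hasMFDerivAt (HasMFDerivAt.comp s h2 h1)
      have h4 := h3.congr_of_eventuallyEq
        (hev.mono fun s' hs' => (happτ s' hs').symm : (fun s' => A.symm (u, m + r * s')) =ᶠ[𝓝 s] _)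
      exact h4.unique hd
    have hDX : D (X (levelArc E u m r s)) = chartField X p (levelArc E u m r s) := rfl
    rw [LinearIndependent.pair_iff]
    intro a b hab
    have h0 : A (D (a • V + b • X (levelArc E u m r s))) = 0 := by
      rw [hab]
      exact (congrArg A (map_zero D)).trans (map_zero A)
    -- Read in coordinates, the arc velocity is `(0, r)` and `X` has positive first component: the
    -- first component gives `b = 0`, then the second gives `a = 0`.
    have h1 : a • ((0, r) : ℝ × ℝ) + b • A (chartField X p (levelArc E u m r s)) = 0 := by
      rw [← h0, map_add, map_smul, map_smul, hDV, hDX]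
      erw [map_add, map_smul, map_smul, A.apply_symm_apply]
    have hpos : 0 < (A (chartField X p (levelArc E u m r s))).1 := hmemU.2
    have hb : b = 0 := by
      have := congrArg Prod.fst h1
      simp only [Prod.fst_add, Prod.smul_fst, smul_eq_mul, mul_zero, zero_add, Prod.fst_zero] at this
      exact (mul_eq_zero.1 this).resolve_right hpos.ne'
    have ha : a = 0 := by
      rw [hb] at h1
      have := congrArg Prod.snd h1
      simp only [Prod.snd_add, Prod.smul_snd, smul_eq_mul, zero_mul, add_zero, Prod.snd_zero] at this
      exact (mul_eq_zero.1 this).resolve_right hr.ne'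
    exact ⟨ha, hb⟩

end AdaptedCharts

end Dumbbell

namespace Dumbbell

/-! ### Segments of orbits and of transverse arcs -/

section Segments

variable {S : Type*} [TopologicalSpace S] [ChartedSpace Plane S]
  {X : (x : S) → TangentSpace (𝓡 2) x} {φ : Flow ℝ S} {γ g f : ℝ → S} {a b k d : ℝ}

/-- The velocities of `γ` and `f` lie in different fibres as types; comparing them as points of the
tangent bundle avoids transport. -/
lemma velocity_congr (h : EqOn γ f (Icc a b)) {t : ℝ} (ht : t ∈ Icc a b) :
    (⟨γ t, velocity γ a b t⟩ : TangentBundle (𝓡 2) S) = ⟨f t, velocity f a b t⟩ :=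
  tangentMapWithin_congr (I := 𝓘(ℝ, ℝ)) (I' := 𝓡 2) h ⟨t, (1 : ℝ)⟩ ht

lemma velocity_affine (hab : a < b) {t : ℝ} (ht : t ∈ Icc a b)
    (hg : MDifferentiableAt 𝓘(ℝ, ℝ) (𝓡 2) g (k * (t - a) + d)) :
    velocity (fun t => g (k * (t - a) + d)) a b t =
      k • mfderiv 𝓘(ℝ, ℝ) (𝓡 2) g (k * (t - a) + d) (1 : ℝ) := by
  have h1 : HasDerivAt (fun t => k * (t - a) + d) k t := by
    simpa using (((hasDerivAt_id t).sub_const a).const_mul k).add_const d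
  have h2 : HasMFDerivAt 𝓘(ℝ, ℝ) 𝓘(ℝ, ℝ) (fun t => k * (t - a) + d) t
      (ContinuousLinearMap.toSpanSingleton ℝ k) := hasMFDerivAt_iff_hasFDerivAt.2 h1.hasFDerivAt
  have h3 := (HasMFDerivAt.comp t hg.hasMFDerivAt h2).hasMFDerivWithinAt (s := Icc a b)
  have h4 := h3.mfderivWithin ((uniqueDiffOn_Icc hab).uniqueMDiffOn t ht)
  have h5 : velocity (fun t => g (k * (t - a) + d)) a b t =
      mfderiv 𝓘(ℝ, ℝ) (𝓡 2) g (k * (t - a) + d) k := by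
    have := DFunLike.congr_fun h4 (1 : ℝ)
    refine this.trans ?_
    exact congrArg (mfderiv 𝓘(ℝ, ℝ) (𝓡 2) g (k * (t - a) + d))
      (show ContinuousLinearMap.toSpanSingleton ℝ k (1 : ℝ) = k by simp)
  rw [h5]
  have h6 := (mfderiv 𝓘(ℝ, ℝ) (𝓡 2) g (k * (t - a) + d)).map_smul k (1 : ℝ)
  rw [← h6]
  exact congrArg _ (show k = k • (1 : ℝ) by simp)

lemma contMDiffOn_affine (h : EqOn γ (fun t => g (k * (t - a) + d)) (Icc a b))
    (hg : ∀ t ∈ Icc a b, ContMDiffAt 𝓘(ℝ, ℝ) (𝓡 2) 1 g (k * (t - a) + d)) :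
    ContMDiffOn 𝓘(ℝ, ℝ) (𝓡 2) 1 γ (Icc a b) := by
  refine ContMDiffOn.congr (fun t ht => ?_) h
  have h1 : ContDiff ℝ 1 fun t : ℝ => k * (t - a) + d := by fun_prop
  exact (ContMDiffAt.comp (f := fun t : ℝ => k * (t - a) + d) t (hg t ht)
    h1.contMDiff.contMDiffAt).contMDiffWithinAt

variable [IsManifold (𝓡 2) 1 S]

lemma isTangentSegment_of_orbit (hX : Continuous fun x => (⟨x, X x⟩ : TangentBundle (𝓡 2) S))
    (hφ : ∀ x, IsMIntegralCurve (fun t => φ t x) X) {p : S} (hp : ∀ t, X (φ t p) ≠ 0)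
    (hab : a < b) (hk : k ≠ 0) (h : EqOn γ (fun t => φ (k * (t - a) + d) p) (Icc a b)) :
    IsC1Segment γ a b ∧ IsTangentSegment φ X γ a b := by
  have hsm := contMDiff_orbit hX hφ p
  have hv : ∀ t ∈ Icc a b, velocity (fun t => φ (k * (t - a) + d) p) a b t =
      k • X (φ (k * (t - a) + d) p) := fun t ht => by
    rw [velocity_affine (g := fun t => φ t p) hab ht ((hsm _).mdifferentiableAt one_ne_zero)]
    congr 1
    have h1 := (hφ p (k * (t - a) + d)).mfderiv
    have h2 := DFunLike.congr_fun h1 (1 : ℝ)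
    refine h2.trans ?_
    exact (show ((1 : ℝ →L[ℝ] ℝ).smulRight (X (φ (k * (t - a) + d) p)) :
      ℝ →L[ℝ] TangentSpace (𝓡 2) (φ (k * (t - a) + d) p)) 1 = _ by simp)
  -- Properties are transferred as predicates on the tangent bundle, so that base point and vector
  -- are rewritten together.
  have htr : ∀ t ∈ Icc a b, ∀ Q : TangentBundle (𝓡 2) S → Prop,
      Q ⟨φ (k * (t - a) + d) p, k • X (φ (k * (t - a) + d) p)⟩ →
      Q ⟨γ t, velocity γ a b t⟩ := fun t ht Q hQ => by
    rw [velocity_congr h ht, hv t ht]; exact hQ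
  refine ⟨⟨contMDiffOn_affine (g := fun t => φ t p) h fun t _ => hsm _, fun t ht => ?_⟩, ⟨p, ?_⟩,
    fun t ht => ⟨k, ?_⟩⟩
  · exact htr t ht (fun z => z.2 ≠ 0) (smul_ne_zero hk (hp _))
  · rintro _ ⟨t, ht, rfl⟩
    rw [h ht]
    exact ⟨_, rfl⟩
  · exact htr t ht (fun z => z.2 = k • X z.1) rfl

lemma isTransverseSegment_of_arc {τ : ℝ → S} (hτ : IsTransverseArc X τ)
    (hab : a < b) (hk : k ≠ 0) (h : EqOn γ (fun t => τ (k * (t - a) + d)) (Icc a b))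
    (hmaps : ∀ t ∈ Icc a b, k * (t - a) + d ∈ Icc (-1 : ℝ) 1) :
    IsC1Segment γ a b ∧ IsTransverseSegment X γ a b := by
  have hli : ∀ t ∈ Icc a b, LinearIndependent ℝ ![velocity γ a b t, X (γ t)] := fun t ht => by
    have key : ∀ Q : TangentBundle (𝓡 2) S → Prop,
        Q ⟨τ (k * (t - a) + d), k • mfderiv 𝓘(ℝ, ℝ) (𝓡 2) τ (k * (t - a) + d) (1 : ℝ)⟩ →
        Q ⟨γ t, velocity γ a b t⟩ := fun Q hQ => by
      rw [velocity_congr h ht, velocity_affine hab ht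
        ((hτ _ (hmaps t ht)).1.mdifferentiableAt one_ne_zero)]
      exact hQ
    refine key (fun z => LinearIndependent ℝ ![z.2, X z.1]) ?_
    have := (hτ _ (hmaps t ht)).2
    rw [LinearIndependent.pair_iff] at this ⊢
    intro x y hxy
    rw [smul_smul] at hxy
    obtain ⟨h1, h2⟩ := this _ _ hxy
    exact ⟨(mul_eq_zero.1 h1).resolve_right hk, h2⟩
  exact ⟨⟨contMDiffOn_affine h fun t ht => (hτ _ (hmaps t ht)).1,
    fun t ht => (hli t ht).ne_zero 0⟩, hli⟩

end Segments

/-! ### Lengths of short subsegments. -/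

section Lengths

variable {S : Type*} [EMetricSpace S] [ChartedSpace Plane S] [IsManifold (𝓡 2) ∞ S]
  [RiemannianBundle (fun x : S => TangentSpace (𝓡 2) x)]
  [IsContMDiffRiemannianBundle (𝓡 2) ∞ Plane (fun x : S => TangentSpace (𝓡 2) x)]
  [IsRiemannianManifold (𝓡 2) S] {X : (x : S) → TangentSpace (𝓡 2) x}

/-- The speed is continuous on a compact interval, hence bounded. Finiteness is needed for absolute
continuity of the length integral. -/
lemma pathELength_ne_top {τ : ℝ → S} {a b : ℝ} (hab : a < b)
    (hτ : ContMDiffOn 𝓘(ℝ, ℝ) (𝓡 2) 1 τ (Icc a b)) : pathELength (𝓡 2) τ a b ≠ ⊤ := by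
  rw [pathELength_eq_lintegral_mfderivWithin_Icc]
  have hu := (uniqueDiffOn_Icc hab).uniqueMDiffOn
  have h1 := hτ.continuousOn_tangentMapWithin le_rfl hu
  have hsec : Continuous fun t : ℝ => (⟨t, (1 : ℝ)⟩ : TangentBundle 𝓘(ℝ, ℝ) ℝ) := by
    have : Continuous fun t : ℝ => (tangentBundleModelSpaceHomeomorph 𝓘(ℝ, ℝ)).symm (t, (1 : ℝ)) :=
      (Homeomorph.continuous _).comp (by fun_prop)
    exact this
  have h2 : ContinuousOn (fun t => (⟨τ t, mfderivWithin 𝓘(ℝ, ℝ) (𝓡 2) τ (Icc a b) t (1 : ℝ)⟩ :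
      TangentBundle (𝓡 2) S)) (Icc a b) :=
    h1.comp hsec.continuousOn fun t ht => ht
  have : IsContinuousRiemannianBundle Plane (fun x : S => TangentSpace (𝓡 2) x) := by
    obtain ⟨g, hg, H⟩ := IsContMDiffRiemannianBundle.exists_contMDiff (IB := 𝓡 2) (n := ∞)
      (F := Plane) (E := fun x : S => TangentSpace (𝓡 2) x)
    exact ⟨g, hg.continuous, H⟩
  have h3 := ContinuousOn.inner_bundle h2 h2
  obtain ⟨B, hB⟩ := isCompact_Icc.bddAbove_image h3
  have h4 : ∀ t ∈ Icc a b, ‖mfderivWithin 𝓘(ℝ, ℝ) (𝓡 2) τ (Icc a b) t (1 : ℝ)‖ₑ ≤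
      ENNReal.ofReal (Real.sqrt B) := fun t ht => by
    rw [← ofReal_norm]
    refine ENNReal.ofReal_le_ofReal (Real.le_sqrt_of_sq_le ?_)
    rw [← real_inner_self_eq_norm_sq]
    exact hB ⟨t, ht, rfl⟩
  refine ne_top_of_le_ne_top ?_ (MeasureTheory.setLIntegral_mono' measurableSet_Icc h4)
  rw [MeasureTheory.lintegral_const]
  simp [ENNReal.mul_eq_top]

/-- Short subsegments of a transverse arc have small length. -/
lemma IsTransverseArc.exists_length_lt {τ : ℝ → S} (hτ : IsTransverseArc X τ) {ε : ℝ}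
    (hε : 0 < ε) : ∃ δ > 0, ∀ {γ : ℝ → S} {a k d : ℝ}, |k| < δ →
      (∀ t ∈ Icc a (a + 1), k * (t - a) + d ∈ Icc (-1 : ℝ) 1) →
      EqOn γ (fun t => τ (k * (t - a) + d)) (Icc a (a + 1)) →
      pathELength (𝓡 2) γ a (a + 1) < ENNReal.ofReal ε := by
  have hsm : ∀ s ∈ Icc (-1 : ℝ) 1, MDifferentiableAt 𝓘(ℝ, ℝ) (𝓡 2) τ s := fun s hs =>
    (hτ s hs).1.mdifferentiableAt one_ne_zero
  have hfin := pathELength_ne_top (τ := τ) (show (-1 : ℝ) < 1 by norm_num)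
    fun s hs => (hτ s hs).1.contMDiffWithinAt
  rw [pathELength_eq_lintegral_mfderiv_Icc] at hfin
  -- Absolute continuity of the integral: over parameter sets of small measure the length is below
  -- `ε`. Invariance under affine reparametrization, of either orientation, then reduces to
  -- subintervals of length `|k|`.
  obtain ⟨δ, hδ, H⟩ := MeasureTheory.exists_pos_setLIntegral_lt_of_measure_lt hfin
    (ε := ENNReal.ofReal ε) (by simpa using hε)
  have hsub : ∀ u v, Icc u v ⊆ Icc (-1 : ℝ) 1 → ENNReal.ofReal (v - u) < δ →
      pathELength (𝓡 2) τ u v < ENNReal.ofReal ε := fun u v huv hlt => by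
    rw [pathELength_eq_lintegral_mfderiv_Icc]
    have := H (Icc u v) (by
      rw [MeasureTheory.Measure.restrict_apply measurableSet_Icc, inter_eq_left.2 huv,
        Real.volume_Icc]
      exact hlt)
    rwa [MeasureTheory.Measure.restrict_restrict measurableSet_Icc, inter_eq_left.2 huv] at this
  obtain ⟨δ', hδ', hlt'⟩ : ∃ δ' : ℝ, 0 < δ' ∧ ∀ x < δ', ENNReal.ofReal x < δ := by
    obtain ⟨r, hr0, hr⟩ := ENNReal.lt_iff_exists_nnreal_btwn.1 hδ
    refine ⟨r, by exact_mod_cast hr0, fun x hx => lt_of_le_of_lt ?_ hr⟩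
    exact ENNReal.ofReal_le_of_le_toReal (by simpa using hx.le)
  refine ⟨δ', hδ', fun {γ a k d} hk hmaps heq => ?_⟩
  rw [pathELength_congr heq]
  have hdiff : DifferentiableOn ℝ (fun t => k * (t - a) + d) (Icc a (a + 1)) := by fun_prop
  have ha := hmaps a ⟨le_rfl, by linarith⟩
  have hb := hmaps (a + 1) ⟨by linarith, le_rfl⟩
  rcases le_total 0 k with h0 | h0
  · have hmono : MonotoneOn (fun t => k * (t - a) + d) (Icc a (a + 1)) := fun x _ y _ hxy => by
      dsimp only; nlinarith
    have hs : Icc (k * (a - a) + d) (k * (a + 1 - a) + d) ⊆ Icc (-1 : ℝ) 1 :=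
      Icc_subset_Icc ha.1 hb.2
    have := pathELength_comp_of_monotoneOn (I := 𝓡 2) (γ := τ) (by linarith) hmono hdiff
      (fun s hs' => (hsm s (hs hs')).mdifferentiableWithinAt)
    refine (show pathELength (𝓡 2) (fun t => τ (k * (t - a) + d)) a (a + 1) = _ from this) ▸ ?_
    refine hsub _ _ hs (hlt' _ ?_)
    rw [abs_of_nonneg h0] at hk
    linarith
  · have hanti : AntitoneOn (fun t => k * (t - a) + d) (Icc a (a + 1)) := fun x _ y _ hxy => by
      dsimp only; nlinarith
    have hs : Icc (k * (a + 1 - a) + d) (k * (a - a) + d) ⊆ Icc (-1 : ℝ) 1 :=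
      Icc_subset_Icc hb.1 ha.2
    have := pathELength_comp_of_antitoneOn (I := 𝓡 2) (γ := τ) (by linarith) hanti hdiff
      (fun s hs' => (hsm s (hs hs')).mdifferentiableWithinAt)
    refine (show pathELength (𝓡 2) (fun t => τ (k * (t - a) + d)) a (a + 1) = _ from this) ▸ ?_
    refine hsub _ _ hs (hlt' _ ?_)
    rw [abs_of_nonpos h0] at hk
    linarith

end Lengths

/-! ### Hausdorff distance between the filling and the invariant set. -/

section Approximation

variable {S : Type*} [EMetricSpace S] {ι : Type*} [Finite ι] {φ : Flow ℝ S} {Γ : Set S}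
  {σ : ι → ℝ → S} {c : ℝ}

/-- Thin fillings are close to `Γ`. -/
lemma IsCrossSection.exists_hausdorffEDist_lt (h : IsCrossSection φ Γ σ c) {ε : ℝ} (hε : 0 < ε) :
    ∃ δ > 0, ∀ δ', δ' ≤ δ →
      Metric.hausdorffEDist Γ (filling φ Γ σ δ') < ENNReal.ofReal ε := by
  have hunif : ∀ i, ∃ δ > 0, ∀ r ∈ Icc (0 : ℝ) 2, ∀ s ∈ Icc (-1 : ℝ) 1, ∀ s' ∈ Icc (-1 : ℝ) 1,
      |s - s'| < δ → edist (φ r (σ i s)) (φ r (σ i s')) < ENNReal.ofReal (ε / 2) := fun i => by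
    have hc : ContinuousOn (fun z : ℝ × ℝ => φ z.1 (σ i z.2)) (Icc 0 2 ×ˢ Icc (-1) 1) :=
      (continuous_flow φ).comp_continuousOn (continuousOn_fst.prodMk
        ((h.continuousOn i).comp continuousOn_snd fun z hz => Icc_subset_Ioo_two hz.2))
    have hu := (isCompact_Icc.prod isCompact_Icc).uniformContinuousOn_of_continuous hc
    obtain ⟨δ, hδ, H⟩ := (Metric.uniformity_basis_dist.uniformContinuousOn_iff
      uniformity_basis_edist).1 hu (ENNReal.ofReal (ε / 2)) (by simpa using hε)
    refine ⟨δ, hδ, fun r hr s hs s' hs' hlt => H (r, s) ⟨hr, hs⟩ (r, s') ⟨hr, hs'⟩ ?_⟩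
    rw [mem_ofPred_eq, Prod.dist_eq, dist_self, Real.dist_eq]
    exact max_lt hδ hlt
  choose δ hδ H using hunif
  obtain ⟨d, hd, hdle⟩ : ∃ d > 0, ∀ i, d ≤ δ i := by
    rcases isEmpty_or_nonempty ι with hι | hι
    · exact ⟨1, one_pos, fun i => (hι.false i).elim⟩
    · obtain ⟨i, hi⟩ := Finite.exists_min δ
      exact ⟨δ i, hδ i, hi⟩
  refine ⟨d, hd, fun δ' hδ' => ?_⟩
  refine lt_of_le_of_lt (Metric.hausdorffEDist_le_of_mem_edist (r := ENNReal.ofReal (ε / 2))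
    (fun x hx => ⟨x, Or.inl hx, by simp⟩) ?_)
    ((ENNReal.ofReal_lt_ofReal_iff hε).2 (by linarith))
  rintro z (hz | ⟨x, ⟨i, s, η, w, hg, u, hu, rfl⟩, y, t, r, hnext, hr0, hrt, rfl⟩)
  · exact ⟨z, hz, by simp⟩
  -- A point of a strip is compared with the point of `Γ` on the orbit of the gap end at the same
  -- time `r`; the starting parameters differ by less than `δ'`.
  · refine ⟨φ r (σ i s), h.invariant r hg.gap.start_inv, (H i r ⟨hr0, ?_⟩ _
      (Ioo_subset_Icc_self (hg.gap.param_mem hu)) _ (Ioo_subset_Icc_self hg.gap.start_mem) ?_).le⟩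
    · exact hrt.trans hnext.2.1.le
    · rw [add_sub_cancel_left, abs_mul, abs_of_nonneg hu.1]
      have hη : |η| = 1 := by rcases hg.gap.sign with rfl | rfl <;> simp
      rw [hη, one_mul]
      linarith [hu.2, hg.lt, hdle i]

end Approximation

end Dumbbell

namespace Dumbbell

/-! ### Circuits as dumbbells, and conclusion. -/

section Assembly

variable {S : Type*} [TopologicalSpace S] [T2Space S] {ι : Type*} [Finite ι] {φ : Flow ℝ S}
  {Γ : Set S} {σ : ι → ℝ → S} {c δ : ℝ} {γ : ℝ → S} {a : ℝ}

/-- The data of an edge traversed by `γ` on `[a, a + 1]`. -/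
lemma IsOutEdge.segment {j : ι} {s η w : ℝ} (he : IsOutEdge φ Γ σ δ j s η w)
    (hγ : ∀ x ∈ Icc (0 : ℝ) 1, γ (a + x) = σ j (s + η * (w * x))) :
    η * w ≠ 0 ∧ |η * w| < δ ∧
      EqOn γ (fun t => σ j (η * w * (t - a) + s)) (Icc a (a + 1)) ∧
      (∀ t ∈ Icc a (a + 1), η * w * (t - a) + s ∈ Icc (-1 : ℝ) 1) ∧
      γ '' Icc a (a + 1) = gapArc σ j s η w := by
  have hg := he.thin.gap
  have hw := hg.pos
  have hη : |η| = 1 := by rcases hg.sign with rfl | rfl <;> simp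
  have hη0 : η ≠ 0 := by rcases hg.sign with rfl | rfl <;> norm_num
  have heq : EqOn γ (fun t => σ j (η * w * (t - a) + s)) (Icc a (a + 1)) := fun t ht => by
    have := hγ (t - a) ⟨by linarith [ht.1], by linarith [ht.2]⟩
    rw [add_sub_cancel] at this
    rw [this]
    dsimp only
    congr 1; ring
  refine ⟨mul_ne_zero hη0 hw.ne', ?_, heq, fun t ht => ?_, ?_⟩
  · rw [abs_mul, hη, one_mul, abs_of_pos hw]; exact he.thin.lt
  · rw [show η * w * (t - a) + s = s + η * (w * (t - a)) by ring]
    refine Ioo_subset_Icc_self (hg.param_mem ⟨mul_nonneg hw.le (by linarith [ht.1]), ?_⟩)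
    exact mul_le_of_le_one_right hw.le (by linarith [ht.2])
  · ext y
    constructor
    · rintro ⟨t, ht, rfl⟩
      refine ⟨w * (t - a), ⟨mul_nonneg hw.le (by linarith [ht.1]),
        mul_le_of_le_one_right hw.le (by linarith [ht.2])⟩, ?_⟩
      rw [heq ht]
      dsimp only
      congr 1; ring
    · rintro ⟨u, hu, rfl⟩
      have h0 : 0 ≤ u / w := div_nonneg hu.1 hw.le
      have h1 : u / w ≤ 1 := (div_le_one hw).2 hu.2
      refine ⟨a + u / w, ⟨by linarith, by linarith⟩, ?_⟩
      rw [hγ _ ⟨h0, h1⟩, mul_div_cancel₀ _ hw.ne']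

end Assembly

section MainTheorem

variable {S : Type*} [EMetricSpace S] [CompactSpace S] [ChartedSpace Plane S]
  [IsManifold (𝓡 2) ∞ S] [RiemannianBundle (fun x : S => TangentSpace (𝓡 2) x)]
  [IsContMDiffRiemannianBundle (𝓡 2) ∞ Plane (fun x : S => TangentSpace (𝓡 2) x)]
  [IsRiemannianManifold (𝓡 2) S] {X : (x : S) → TangentSpace (𝓡 2) x} {φ : Flow ℝ S} {Γ : Set S}
  {ι : Type*} [Finite ι] {σ : ι → ℝ → S} {c δ : ℝ}

/-- The boundary components of the filling are dumbbells. -/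
lemma IsCrossSection.exists_isDumbbellCurve (h : IsCrossSection φ Γ σ c)
    (hX : Continuous fun x => (⟨x, X x⟩ : TangentBundle (𝓡 2) S))
    (hφ : ∀ x, IsMIntegralCurve (fun t => φ t x) X) (hfix : ∀ x ∈ Γ, X x ≠ 0)
    (hper : ∀ x ∈ Γ, ∀ T : ℝ, 0 < T → φ T x ≠ x) (hσ : ∀ i, IsTransverseArc X (σ i))
    (hδ : 0 < δ) {ε : ℝ}
    (hlen : ∀ i, ∀ {γ : ℝ → S} {a k d : ℝ}, |k| < δ →
      (∀ t ∈ Icc a (a + 1), k * (t - a) + d ∈ Icc (-1 : ℝ) 1) →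
      EqOn γ (fun t => σ i (k * (t - a) + d)) (Icc a (a + 1)) →
      pathELength (𝓡 2) γ a (a + 1) < ENNReal.ofReal ε)
    {p : S} (hp : p ∈ frontier (outer φ Γ σ δ)) :
    ∃ (n : ℕ) (γ : ℝ → S), IsDumbbellCurve φ X (outer φ Γ σ δ)
        (connectedComponentIn (frontier (outer φ Γ σ δ)) p) n γ ∧
      ∀ i : ℕ, i < 4 * n → Odd i → pathELength (𝓡 2) γ i (i + 1) < ENNReal.ofReal ε := by
  have hΓ : IsCompact Γ := h.isClosed.isCompact
  have : Finite {p // IsCorner φ.reverse Γ σ δ p} := h.reverse.finite_corners hΓ hδ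
  obtain ⟨α, β, L, I, O, hsys, hL, hI, hO⟩ := h.exists_isCircuitSystem hΓ hδ hper
  obtain ⟨q, hq⟩ := mem_iUnion.1 (hsys.union ▸ hp)
  obtain ⟨n, hn, γ, hcont, hγper, hinj, hcomp, hsub, hγ⟩ := hsys.exists_circuit q
  have hrange := hcomp p (hsub hq)
  have hsplit : ∀ i : ℕ, ∃ k : ℕ, i = 4 * k ∨ i = 4 * k + 1 ∨ i = 4 * k + 2 ∨ i = 4 * k + 3 :=
    fun i => ⟨i / 4, by omega⟩
  -- lobes
  have hlobe0 : ∀ k : ℕ, IsC1Segment γ (4 * k) (4 * k + 1) ∧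
      IsTangentSegment φ X γ (4 * k) (4 * k + 1) := fun k => by
    obtain ⟨d, hd⟩ := hγ k
    obtain ⟨x, hx, l, hl, hLd⟩ := hL d
    refine isTangentSegment_of_orbit (k := l) (d := 0) hX hφ
      (fun t => hfix _ (h.invariant t hx)) (by linarith) hl.ne' fun t ht => ?_
    have := (hd (t - 4 * k) ⟨by linarith [ht.1], by linarith [ht.2]⟩).1
    rw [add_sub_cancel, hLd] at this
    rw [this]
    dsimp only
    rw [add_zero]
  have hlobe2 : ∀ k : ℕ, IsC1Segment γ (4 * k + 2) (4 * k + 2 + 1) ∧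
      IsTangentSegment φ X γ (4 * k + 2) (4 * k + 2 + 1) := fun k => by
    obtain ⟨d, hd⟩ := hγ k
    obtain ⟨x, hx, l, hl, hLd⟩ := hL (β d)
    -- This lobe is run against the flow, from time `l` down to time `0`.
    refine isTangentSegment_of_orbit (k := -l) (d := l) hX hφ
      (fun t => hfix _ (h.invariant t hx)) (by linarith) (neg_ne_zero.2 hl.ne') fun t ht => ?_
    have := (hd (t - (4 * k + 2)) ⟨by linarith [ht.1], by linarith [ht.2]⟩).2.2.1
    rw [add_sub_cancel, hLd] at this
    rw [this]
    dsimp only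
    congr 1; ring
  -- edges
  have hedge1 : ∀ k : ℕ, ∃ j s η w, IsOutEdge φ Γ σ δ j s η w ∧
      ∀ x ∈ Icc (0 : ℝ) 1, γ (4 * k + 1 + x) = σ j (s + η * (w * x)) := fun k => by
    obtain ⟨d, hd⟩ := hγ k
    obtain ⟨j, s, η, w, he, hf⟩ := hO d
    exact ⟨j, s, η, w, he, fun x hx => by rw [(hd x hx).2.1, hf]⟩
  have hedge3 : ∀ k : ℕ, ∃ j s η w, IsOutEdge φ.reverse Γ σ δ j s η w ∧
      ∀ x ∈ Icc (0 : ℝ) 1, γ (4 * k + 3 + x) = σ j (s + η * (w * x)) := fun k => by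
    obtain ⟨d, hd⟩ := hγ k
    obtain ⟨j, s, η, w, he, hf⟩ := hI (β d)
    exact ⟨j, s, η, w, he, fun x hx => by rw [(hd x hx).2.2.2, hf]⟩
  have htrans : ∀ {ψ : Flow ℝ S} {a : ℝ}, (∃ j s η w, IsOutEdge ψ Γ σ δ j s η w ∧
      ∀ x ∈ Icc (0 : ℝ) 1, γ (a + x) = σ j (s + η * (w * x))) →
      (IsC1Segment γ a (a + 1) ∧ IsTransverseSegment X γ a (a + 1)) ∧
        pathELength (𝓡 2) γ a (a + 1) < ENNReal.ofReal ε := by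
    rintro ψ a ⟨j, s, η, w, he, hf⟩
    obtain ⟨h1, h2, h3, h4, -⟩ := he.segment hf
    exact ⟨isTransverseSegment_of_arc (hσ j) (by linarith) h1 h3 h4, hlen j h2 h4 h3⟩
  have hXne : ∀ {ψ : Flow ℝ S} {f : ℝ → S}, (∃ j s η w, IsOutEdge ψ Γ σ δ j s η w ∧
      ∀ x, f x = σ j (s + η * (w * x))) → ∀ x ∈ Icc (0 : ℝ) 1, X (f x) ≠ 0 := by
    rintro ψ f ⟨j, s, η, w, he, hf⟩ x hx
    have hw := he.thin.gap.pos
    rw [hf]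
    exact ((hσ j _ (Ioo_subset_Icc_self (he.thin.gap.param_mem
      ⟨mul_nonneg hw.le hx.1, mul_le_of_le_one_right hw.le hx.2⟩))).2).ne_zero 1
  refine ⟨n, γ, ⟨hn, hcont, hγper, hinj, hrange, fun y hy => ?_, fun i _ => ?_, fun i _ hi => ?_,
    fun k _ => ?_, fun k _ => ?_⟩, fun i _ hi => ?_⟩
  -- No zero of `X` lies on a lobe, as lobes lie in `Γ`, nor on an edge, where `X` is part of an
  -- independent pair.
  · have hyF := connectedComponentIn_subset _ _ hy
    rw [hsys.union] at hyF
    obtain ⟨d, (⟨x, hx, rfl⟩ | ⟨x, hx, rfl⟩) | ⟨x, hx, rfl⟩⟩ := mem_iUnion.1 hyF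
    · obtain ⟨z, hz, l, -, hLd⟩ := hL d
      rw [hLd]; exact hfix _ (h.invariant _ hz)
    · exact hXne (hI d) x hx
    · exact hXne (hO d) x hx
  · obtain ⟨k, rfl | rfl | rfl | rfl⟩ := hsplit i <;> push_cast
    · exact (hlobe0 k).1
    · exact (htrans (hedge1 k)).1.1
    · exact (hlobe2 k).1
    · exact (htrans (hedge3 k)).1.1
  · obtain ⟨k, rfl | rfl | rfl | rfl⟩ := hsplit i
    · push_cast; exact (hlobe0 k).2
    · exact absurd hi (by rw [Nat.not_even_iff_odd]; exact ⟨2 * k, by ring⟩)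
    · push_cast; exact (hlobe2 k).2
    · exact absurd hi (by rw [Nat.not_even_iff_odd]; exact ⟨2 * k + 1, by ring⟩)
  · rw [show (4 * (k : ℝ) + 2) = 4 * k + 1 + 1 by ring]
    refine ⟨(htrans (hedge1 k)).1.2, ?_⟩
    obtain ⟨j, s, η, w, he, hf⟩ := hedge1 k
    rw [(he.segment hf).2.2.2.2]
    exact he.exists_nhd h hδ
  · rw [show (4 * (k : ℝ) + 4) = 4 * k + 3 + 1 by ring]
    refine ⟨(htrans (hedge3 k)).1.2, ?_⟩
    obtain ⟨j, s, η, w, he, hf⟩ := hedge3 k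
    rw [(he.segment hf).2.2.2.2]
    exact he.exists_nhd_reverse h hδ
  · obtain ⟨k, rfl | rfl | rfl | rfl⟩ := hsplit i
    · exact absurd hi (by rw [Nat.not_odd_iff_even]; exact ⟨2 * k, by ring⟩)
    · push_cast; exact (htrans (hedge1 k)).2
    · exact absurd hi (by rw [Nat.not_odd_iff_even]; exact ⟨2 * k + 1, by ring⟩)
    · push_cast; exact (htrans (hedge3 k)).2

end MainTheorem

end Dumbbell

theorem proposition13p1 {S : Type*} [EMetricSpace S] [CompactSpace S]
    [ChartedSpace Dumbbell.Plane S] [IsManifold (𝓡 2) ∞ S]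
    [RiemannianBundle (fun x : S => TangentSpace (𝓡 2) x)]
    [IsContMDiffRiemannianBundle (𝓡 2) ∞ Dumbbell.Plane (fun x : S => TangentSpace (𝓡 2) x)]
    [IsRiemannianManifold (𝓡 2) S]
    (hS : Dumbbell.IsOrientable S)
    (X : (x : S) → TangentSpace (𝓡 2) x)
    (hX : Continuous fun x => (⟨x, X x⟩ : TangentBundle (𝓡 2) S))
    (φ : Flow ℝ S) (hφ : ∀ x, IsMIntegralCurve (fun t => φ t x) X)
    (Γ : Set S) (hΓ : IsCompact Γ) (hinv : IsInvariant φ Γ)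
    (hfix : ∀ x ∈ Γ, X x ≠ 0)
    (hper : ∀ x ∈ Γ, ∀ T : ℝ, 0 < T → φ T x ≠ x)
    (hiso : ∀ x ∈ Γ, ¬ Dumbbell.IsIsolatedOrbit φ Γ x)
    (ε : ℝ) (hε : 0 < ε) :
    ∃ K : Set S, IsCompact K ∧ Γ ⊆ K ∧
      Metric.hausdorffEDist Γ K < ENNReal.ofReal ε ∧
      Dumbbell.IsSurfaceWithBoundary (interior K)ᶜ ∧
      ∀ p ∈ frontier (interior K)ᶜ, ∃ (n : ℕ) (γ : ℝ → S),
        Dumbbell.IsDumbbellCurve φ X (interior K)ᶜ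
          (connectedComponentIn (frontier (interior K)ᶜ) p) n γ ∧
        ∀ i : ℕ, i < 4 * n → Odd i →
          pathELength (𝓡 2) γ i (i + 1) < ENNReal.ofReal ε := by
  obtain ⟨𝒯, c, hfin, h, hσ⟩ := Dumbbell.exists_isCrossSection (P := Dumbbell.IsTransverseArc X)
    hΓ.isClosed hinv hiso fun p hp => Dumbbell.exists_isAdapted hX hφ (hfix p hp)
  have : Finite 𝒯 := hfin
  obtain ⟨δ₁, hδ₁, hclose⟩ := h.exists_hausdorffEDist_lt hε
  choose! δ hδ hlen using fun τ (hτ : τ ∈ 𝒯) => (hσ τ hτ).exists_length_lt hε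
  obtain ⟨d, hd, hdle⟩ := Dumbbell.exists_pos_forall_le hfin hδ
  -- Gaps narrower than `δ₁` keep the filling Hausdorff close to `Γ`; gaps narrower than `d` have
  -- length below `ε` on every arc of the finite family.
  refine ⟨Dumbbell.filling φ Γ (fun τ : 𝒯 => (τ : ℝ → S)) (min δ₁ d), h.isCompact_filling hΓ,
    subset_union_left, hclose _ (min_le_left _ _),
    h.isSurfaceWithBoundary hΓ (lt_min hδ₁ hd), fun p hp => ?_⟩
  refine h.exists_isDumbbellCurve hX hφ hfix hper (fun τ => hσ τ τ.2) (lt_min hδ₁ hd)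
    (fun τ {γ a k d'} hk => hlen τ τ.2 (hk.trans_le ?_)) hp
  exact (min_le_right _ _).trans (hdle τ τ.2)
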